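/- **Theorem (extended chord-arc estimate).** Let $\Omega\subset\mathbb R^2$ be a closed convex set with non-empty interior and boundary $S=\partial\Omega$ of class $C^2$, with outward unit normal $N^S$ and curvature $\kappa^S\ge 0$. Let $T\in(0,\infty]$ and let $\{\Gamma_t\}_{t\in[0,T)}$ be a compact embedded free boundary curve shortening flow in $\Omega$: $\Gamma_t=\gamma([0,1],t)$ for a smooth map $\gamma:[0,1]\times[0,T)\to\Omega$ such that each $\gamma(\cdot,t)$ is an embedding which maps $(0,1)$ into the interior of $\Omega$ and $\{0,1\}$ into $S$, with $\partial_t\gamma=-\kappa N$ on $(0,1)\times[0,T)$ and $\langle N,N^S\rangle=0$ at the endpoints, where $N$ is the unit normal to $\Gamma_t$ and $\kappa$ the curvature with respect to $N$. Let $L(t)$ be the length of $\Gamma_t$ and $\boldsymbol L(t)=2L(t)$. For $x,y\in\Gamma_t$ let $d(x,y)=|x-y|$, let $\ell(x,y)$ be the arclength along $\Gamma_t$ between $x$ and $y$, and set $$\tilde d(x,y)=\min_{z\in S}\big(|x-z|+|y-z|\big),\qquad \tilde\ell(x,y)=\min_{s\in\partial\Gamma_t}\big(\ell(x,s)+\ell(y,s)\big).$$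 For $0\le\delta\le L(t)$ the extended chord-arc profile is $$\boldsymbol\psi(\delta,t)=\min\Big\{\inf\{d(x,y):x,y\in\Gamma_t,\ \ell(x,y)=\delta\},\ \inf\{\tilde d(x,y):x,y\in\Gamma_t,\ \tilde\ell(x,y)=\delta\}\Big\}.$$ Let $K\subset\mathbb R^2$ be a compact set such that $\Gamma_t\subset K$ and $S\cap B_{3L(t)}(\partial\Gamma_t)\subset K$ for all $t\in[0,T)$, and such that every connected component of $S\setminus K$ is unbounded (when $\Omega$ is bounded this says $S\subset K$, and one may take $K=\Omega$). Let $C=\sup_{S\cap K}\kappa^S$, and suppose that $$L(0)\,(1+C)\le\frac{\varepsilon}{1000}\quad\text{for some }\varepsilon\in(0,\tfrac1{10}).$$ Given any $c\in(0,\frac1{100})$, if the inequality $$\boldsymbol\psi(\delta,t)\ \ge\ c\,\boldsymbol L(t)\left(\sin\Big((\pi-\varepsilon)\frac{\delta}{\boldsymbol L(t)}+\frac{\varepsilon}{2}\Big)-\sin\frac{\varepsilon}{2}\right)\qquad\text{for all }0\le\delta\le L(t)$$ holds at $t=0$, then it holds for all $t\in[0,T)$. -/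

import Mathlib

open Set Filter Topology
open scoped ContDiff

/-- The Euclidean plane. -/
abbrev Plane : Type := EuclideanSpace ℝ (Fin 2)

/-- Counterclockwise rotation by `π / 2`. -/
def rotJ (v : Plane) : Plane := !₂[-(v 1), v 0]

noncomputable section

/-! ### The domain and its boundary -/

/-- `f` is a local defining function of class `C²` for the closed set `Ω` at `p`: it has
non-vanishing gradient at `p`, and near `p` the set `Ω` is the sublevel set `{f ≤ 0}`. -/
structure IsDefiningAt (Ω : Set Plane) (p : Plane) (f : Plane → ℝ) : Prop where
  contDiffAt : ContDiffAt ℝ 2 f p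
  gradient_ne_zero : gradient f p ≠ 0
  mem_iff : ∀ᶠ q in 𝓝 p, (q ∈ Ω ↔ f q ≤ 0)

/-- A closed convex planar domain with non-empty interior and boundary of class `C²`. -/
structure IsConvexC2Domain (Ω : Set Plane) : Prop where
  isClosed : IsClosed Ω
  convex : Convex ℝ Ω
  interior_nonempty : (interior Ω).Nonempty
  boundary_C2 : ∀ p ∈ frontier Ω, ∃ f : Plane → ℝ, IsDefiningAt Ω p f

open Classical in
/-- A local defining function for `Ω` at `p` (and `0` if there is none).  The normal and the
curvature below do not depend on which one is chosen. -/
def definingFunction (Ω : Set Plane) (p : Plane) : Plane → ℝ :=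
  if h : ∃ f : Plane → ℝ, IsDefiningAt Ω p f then h.choose else 0

/-- The outward unit normal `N^S` to `S = ∂Ω` at `p`. -/
def outwardNormal (Ω : Set Plane) (p : Plane) : Plane :=
  ‖gradient (definingFunction Ω p) p‖⁻¹ • gradient (definingFunction Ω p) p

/-- The unit tangent `T^S = J N^S` to `S = ∂Ω` at `p`. -/
def boundaryTangent (Ω : Set Plane) (p : Plane) : Plane := rotJ (outwardNormal Ω p)

/-- The curvature `κ^S` of `S = ∂Ω` at `p` with respect to the outward unit normal, as the
curvature `D²f(T^S, T^S) / |∇f|` of the level set of a defining function; it is nonnegative for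
convex `Ω` (and equals `1 / R` for a disc of radius `R`). -/
def boundaryCurvature (Ω : Set Plane) (p : Plane) : ℝ :=
  fderiv ℝ (fderiv ℝ (definingFunction Ω p)) p (boundaryTangent Ω p) (boundaryTangent Ω p) /
    ‖gradient (definingFunction Ω p) p‖

/-! ### Geometry of a parametrised curve `c : [0,1] → ℝ²` -/

/-- The velocity `c'` (one-sided at the two endpoints). -/
def velocity (c : ℝ → Plane) (x : ℝ) : Plane := derivWithin c (Icc 0 1) x

/-- The unit tangent `T = c' / |c'|`. -/
def unitTangent (c : ℝ → Plane) (x : ℝ) : Plane := ‖velocity c x‖⁻¹ • velocity c x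

/-- The unit normal `N = - J T`, so that `T = J N`. -/
def unitNormal (c : ℝ → Plane) (x : ℝ) : Plane := -rotJ (unitTangent c x)

/-- The curvature `κ` with respect to `N`, defined by `dT/ds = - κ N`, that is,
`κ = - ⟪dT/ds, N⟫` with `d/ds = |c'|⁻¹ d/dx`. -/
def curvature (c : ℝ → Plane) (x : ℝ) : ℝ :=
  -inner ℝ (‖velocity c x‖⁻¹ • derivWithin (unitTangent c) (Icc 0 1) x) (unitNormal c x)

/-- The arclength `ℓ(x,y)` between the points with parameters `x` and `y`. -/
def arcDist (c : ℝ → Plane) (x y : ℝ) : ℝ := |∫ u in x..y, ‖velocity c u‖|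

/-- The length `L` of the curve. -/
def curveLength (c : ℝ → Plane) : ℝ := ∫ u in (0 : ℝ)..1, ‖velocity c u‖

/-- The length of the formal double of the curve (boldface `L`). -/
def doubledLength (c : ℝ → Plane) : ℝ := 2 * curveLength c

/-- The reflected distance between two points: the infimum (attained, if `∂Ω ≠ ∅`) over
`z ∈ ∂Ω` of `|p - z| + |q - z|`. -/
def reflectedDist (Ω : Set Plane) (p q : Plane) : ℝ :=
  sInf {r : ℝ | ∃ z ∈ frontier Ω, r = dist p z + dist q z}

/-- The reflected arclength: the minimum over the two endpoints `s` of `ℓ(x,s) + ℓ(y,s)`. -/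
def reflectedArcDist (c : ℝ → Plane) (x y : ℝ) : ℝ :=
  min (arcDist c x 0 + arcDist c y 0) (arcDist c x 1 + arcDist c y 1)

/-- The classical chord-arc profile. -/
def chordArcProfile (c : ℝ → Plane) (δ : ℝ) : ℝ :=
  sInf {r : ℝ | ∃ x ∈ Icc (0 : ℝ) 1, ∃ y ∈ Icc (0 : ℝ) 1,
    arcDist c x y = δ ∧ r = dist (c x) (c y)}

/-- The reflected chord-arc profile. -/
def reflectedProfile (Ω : Set Plane) (c : ℝ → Plane) (δ : ℝ) : ℝ :=
  sInf {r : ℝ | ∃ x ∈ Icc (0 : ℝ) 1, ∃ y ∈ Icc (0 : ℝ) 1,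
    reflectedArcDist c x y = δ ∧ r = reflectedDist Ω (c x) (c y)}

/-- The extended chord-arc profile (boldface `ψ`).  Both infima are over non-empty sets for
`0 ≤ δ ≤ L`, and these are all the values taken by `ℓ` and by the reflected arclength. -/
def extendedProfile (Ω : Set Plane) (c : ℝ → Plane) (δ : ℝ) : ℝ :=
  min (chordArcProfile c δ) (reflectedProfile Ω c δ)

/-! ### Free boundary curve shortening flow -/

/-- The time interval `[0,T)`, where `T` may be infinite. -/
def timeInterval (T : EReal) : Set ℝ := {t : ℝ | 0 ≤ t ∧ (t : EReal) < T}

/-- `γ : [0,1] × [0,T) → Ω` parametrises a compact, embedded free boundary curve shortening flow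
in `Ω`, with timeslices `Γ_t = γ([0,1], t)`. -/
structure IsFreeBoundaryCSF (Ω : Set Plane) (T : EReal) (γ : ℝ → ℝ → Plane) : Prop where
  smooth : ContDiffOn ℝ ∞ (fun p : ℝ × ℝ => γ p.1 p.2) (Icc 0 1 ×ˢ timeInterval T)
  immersed : ∀ t ∈ timeInterval T, ∀ x ∈ Icc (0 : ℝ) 1, velocity (fun u => γ u t) x ≠ 0
  embedded : ∀ t ∈ timeInterval T, InjOn (fun u => γ u t) (Icc 0 1)
  interior_mem : ∀ t ∈ timeInterval T, ∀ x ∈ Ioo (0 : ℝ) 1, γ x t ∈ interior Ω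
  endpoint_mem : ∀ t ∈ timeInterval T, ∀ x ∈ ({0, 1} : Set ℝ), γ x t ∈ frontier Ω
  evolution : ∀ t ∈ timeInterval T, ∀ x ∈ Ioo (0 : ℝ) 1,
    derivWithin (fun s => γ x s) (timeInterval T) t =
      -(curvature (fun u => γ u t) x • unitNormal (fun u => γ u t) x)
  orthogonal : ∀ t ∈ timeInterval T, ∀ x ∈ ({0, 1} : Set ℝ),
    inner ℝ (unitNormal (fun u => γ u t) x) (outwardNormal Ω (γ x t)) = 0

/-- The lower bound for the extended chord-arc profile of the curve `c` in `Ω`. -/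
def ChordArcBound (Ω : Set Plane) (c : ℝ → Plane) (ε a : ℝ) : Prop :=
  ∀ δ ∈ Icc (0 : ℝ) (curveLength c),
    a * doubledLength c *
        (Real.sin ((Real.pi - ε) * (δ / doubledLength c) + ε / 2) - Real.sin (ε / 2)) ≤
      extendedProfile Ω c δ

end

/-!
The proof is a maximum principle argument for the two-point functions
`|x - y| - 𝐋 φ(ℓ/𝐋)` and `|x - z| + |y - z| - 𝐋 φ(ℓ̃/𝐋)`, `z ∈ ∂Ω`, where
`φ(s) = c (sin((π - ε) s + ε/2) - sin(ε/2))` is the comparison function `model`.  Since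
`φ(1 - s) = φ(s)`, the reflected arclength `ℓ̃` may be measured from the starting point of the curve.
Replacing `c` by a smaller constant makes the inequalities strict at the initial time.  Uniformly on
compact time intervals they hold for short chords (`IsFreeBoundaryCSF.exists_short`), so that if
one of them fails, there is a first time at which one of the functions vanishes at a pair of
distinct points.  There its time derivative is nonpositive, while `FBArc.direct_rate_pos` and
`FBArc.reflected_rate_pos` show that it is positive.

The latter two are statements about a single curve `X`, parametrised by arclength, for which both
functions are nonnegative.  With `E = ∫ k²` the length satisfies `dL/dt = -E`, so the derivative in
time is the sum of the curvature terms `⟪w, k J T⟫` from the motion of the endpoints of the chord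
and of positive terms which involve `E` and the energy of the subarcs.  The second variation
inequality at a minimum bounds the curvature terms below by `4 φ'' / 𝐋` (or by `0`), and what
remains is to bound the energies from below.

* For a direct chord, the arc between its endpoints is almost closed, as the slope of `φ` is at most
  `π / 100`; hence it has energy at least `15 / ℓ` (`UnitArc.loop_energy`).  If an endpoint of the
  chord is an endpoint of the curve, only a one-sided first variation of the direct distance is
  available; the missing inequality comes from the reflected distance
  (`FBArc.first_variation_start`).
* For a reflected chord, the reflected bound holds for all reflection points outside the interior of
  `Ω`, since segments from the curve to such points cross `∂Ω`.  Therefore the reflection point may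
  be varied along the tangent line of `∂Ω`, and the curvature of `∂Ω` does not enter the second
  variation.  The first variation says that the chord is reflected both by `∂Ω` and by the curve;
  together with the directions of the curve at its ends this determines the turning angles of the
  curve up to multiples of `2π` (`UnitArc.exists_turning`), and the energy is bounded below by
  the Cauchy-Schwarz inequality.  If the outward normals at the two ends are nearly equal, this
  suffices, with no room to spare except that provided by `ε` (`model_same_ineq`).  If they are
  nearly opposite, then one of the two turning angles may be small, but on that side the position
  of the reflection point forces the curve to double back (`UnitArc.positional_energy`,
  `model_opposite_ineq`).

The assumption on the length is used to see that the normal at the reflection point is nearly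
parallel to the normals at the two ends of the curve
(`IsConvexC2Domain.abs_inner_normal_tangent_le`).  As `∂Ω` has only a `C²` defining function, no
parametrisation of `∂Ω` is used: with `u` tangent to `∂Ω` at an endpoint, and `C' > κ^S`, the function
`⟪N, u⟫ - C' ⟪·, u⟫` on `∂Ω` strictly increases in one direction along `∂Ω`
(`IsConvexC2Domain.exists_increase`), so that its maximum on a compact piece of `∂Ω` is attained
at the end of that piece.  When the normals make an obtuse angle, the relevant piece of `∂Ω` need
not be close to the curve, and it lies in `K` because it is a bounded part of `∂Ω` cut off by a
line (`BoundaryCoords.mem_of_gap`).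
-/

/-! ### Linear algebra of the plane -/

section PlaneAlgebra

lemma Plane.inner_eq (u v : Plane) : inner ℝ u v = u 0 * v 0 + u 1 * v 1 := by
  simp [PiLp.inner_apply, Fin.sum_univ_two, mul_comm]

lemma Plane.norm_sq_eq (u : Plane) : ‖u‖ ^ 2 = u 0 ^ 2 + u 1 ^ 2 := by
  rw [← real_inner_self_eq_norm_sq, Plane.inner_eq]; ring

@[simp] lemma rotJ_apply_zero (v : Plane) : rotJ v 0 = -v 1 := by simp [rotJ]
@[simp] lemma rotJ_apply_one (v : Plane) : rotJ v 1 = v 0 := by simp [rotJ]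

lemma Plane.ext_coord {u v : Plane} (h0 : u 0 = v 0) (h1 : u 1 = v 1) : u = v := by
  ext i; fin_cases i <;> assumption

@[simp] lemma rotJ_add (u v : Plane) : rotJ (u + v) = rotJ u + rotJ v := by
  apply Plane.ext_coord <;> simp; ring
@[simp] lemma rotJ_smul (a : ℝ) (v : Plane) : rotJ (a • v) = a • rotJ v := by
  apply Plane.ext_coord <;> simp
@[simp] lemma rotJ_neg (v : Plane) : rotJ (-v) = -rotJ v := by
  apply Plane.ext_coord <;> simp
@[simp] lemma rotJ_sub (u v : Plane) : rotJ (u - v) = rotJ u - rotJ v := by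
  apply Plane.ext_coord <;> simp; ring
@[simp] lemma rotJ_rotJ (v : Plane) : rotJ (rotJ v) = -v := by
  apply Plane.ext_coord <;> simp

@[simp] lemma inner_rotJ_rotJ (u v : Plane) :
    inner ℝ (rotJ u) (rotJ v) = inner ℝ u v := by
  simp only [Plane.inner_eq, rotJ_apply_zero, rotJ_apply_one]; ring
@[simp] lemma inner_rotJ_self (u : Plane) : inner ℝ (rotJ u) u = 0 := by
  simp only [Plane.inner_eq, rotJ_apply_zero, rotJ_apply_one]; ring
@[simp] lemma inner_self_rotJ (u : Plane) : inner ℝ u (rotJ u) = 0 := by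
  simp only [Plane.inner_eq, rotJ_apply_zero, rotJ_apply_one]; ring
lemma inner_rotJ_left (u v : Plane) : inner ℝ (rotJ u) v = -inner ℝ u (rotJ v) := by
  simp only [Plane.inner_eq, rotJ_apply_zero, rotJ_apply_one]; ring
@[simp] lemma norm_rotJ (v : Plane) : ‖rotJ v‖ = ‖v‖ := by
  rw [← sq_eq_sq₀ (norm_nonneg _) (norm_nonneg _), Plane.norm_sq_eq, Plane.norm_sq_eq]
  simp; ring

/-- `rotJ` as a continuous linear map. -/
noncomputable def rotJL : Plane →L[ℝ] Plane :=
  LinearMap.toContinuousLinearMap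
    { toFun := rotJ, map_add' := rotJ_add, map_smul' := rotJ_smul }

lemma continuous_rotJ : Continuous rotJ := rotJL.continuous

lemma HasDerivAt.rotJ {f : ℝ → Plane} {f' : Plane} {x : ℝ} (h : HasDerivAt f f' x) :
    HasDerivAt (fun y => rotJ (f y)) (rotJ f') x :=
  rotJL.hasFDerivAt.comp_hasDerivAt x h

/-- Decomposition of the inner product in the orthonormal frame `n, J n`. -/
lemma inner_eq_frame {n : Plane} (hn : ‖n‖ = 1) (u v : Plane) :
    inner ℝ u v = inner ℝ u n * inner ℝ v n + inner ℝ u (rotJ n) * inner ℝ v (rotJ n) := by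
  have h := Plane.norm_sq_eq n
  rw [hn] at h
  simp only [Plane.inner_eq, rotJ_apply_zero, rotJ_apply_one]
  linear_combination (u 0 * v 0 + u 1 * v 1) * h

lemma norm_sq_eq_frame {n : Plane} (hn : ‖n‖ = 1) (u : Plane) :
    ‖u‖ ^ 2 = inner ℝ u n ^ 2 + inner ℝ u (rotJ n) ^ 2 := by
  rw [← real_inner_self_eq_norm_sq, inner_eq_frame hn]; ring

lemma eq_frame {n : Plane} (hn : ‖n‖ = 1) (u : Plane) :
    u = inner ℝ u n • n + inner ℝ u (rotJ n) • rotJ n := by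
  have h := Plane.norm_sq_eq n
  rw [hn] at h
  apply Plane.ext_coord
  · simp only [Plane.inner_eq, rotJ_apply_zero, rotJ_apply_one, PiLp.add_apply, PiLp.smul_apply,
      smul_eq_mul]
    linear_combination u 0 * h
  · simp only [Plane.inner_eq, rotJ_apply_zero, rotJ_apply_one, PiLp.add_apply, PiLp.smul_apply,
      smul_eq_mul]
    linear_combination u 1 * h

lemma ext_frame {n u v : Plane} (hn : ‖n‖ = 1) (h0 : inner ℝ u n = inner ℝ v n)
    (h1 : inner ℝ u (rotJ n) = inner ℝ v (rotJ n)) : u = v := by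
  rw [eq_frame hn u, eq_frame hn v, h0, h1]

/-- Counterclockwise rotation by the angle `θ`. -/
noncomputable def rot (θ : ℝ) (v : Plane) : Plane := Real.cos θ • v + Real.sin θ • rotJ v

lemma rot_rot (a b : ℝ) (v : Plane) : rot a (rot b v) = rot (a + b) v := by
  apply Plane.ext_coord <;> simp [rot, Real.cos_add, Real.sin_add] <;> ring

@[simp] lemma rot_zero (v : Plane) : rot 0 v = v := by simp [rot]

@[simp] lemma norm_rot (θ : ℝ) (v : Plane) : ‖rot θ v‖ = ‖v‖ := by
  rw [← sq_eq_sq₀ (norm_nonneg _) (norm_nonneg _), Plane.norm_sq_eq, Plane.norm_sq_eq]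
  simp [rot]
  linear_combination (v 0 ^ 2 + v 1 ^ 2) * Real.sin_sq_add_cos_sq θ

lemma inner_rot_self (θ : ℝ) {v : Plane} (hv : ‖v‖ = 1) : inner ℝ (rot θ v) v = Real.cos θ := by
  simp [rot, inner_add_left, inner_smul_left, hv]

lemma inner_rot_rotJ (θ : ℝ) {v : Plane} (hv : ‖v‖ = 1) :
    inner ℝ (rot θ v) (rotJ v) = Real.sin θ := by
  simp [rot, inner_add_left, inner_smul_left, hv]

lemma rot_pi (v : Plane) : rot Real.pi v = -v := by simp [rot]

/-- Two rotations agree on a unit vector only if the angles agree modulo `2π`. -/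
lemma rot_eq_rot {a b : ℝ} {v : Plane} (hv : ‖v‖ = 1) (h : rot a v = rot b v) :
    ∃ m : ℤ, a = b + 2 * Real.pi * m := by
  have hc : Real.cos a = Real.cos b := by
    rw [← inner_rot_self a hv, ← inner_rot_self b hv, h]
  have hs : Real.sin a = Real.sin b := by
    rw [← inner_rot_rotJ a hv, ← inner_rot_rotJ b hv, h]
  have : (a : Real.Angle) = (b : Real.Angle) := Real.Angle.cos_sin_inj hc hs
  obtain ⟨m, hm⟩ := Real.Angle.angle_eq_iff_two_pi_dvd_sub.mp this
  exact ⟨m, by linarith⟩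

lemma exists_rot_eq {v w : Plane} (hv : ‖v‖ = 1) (hw : ‖w‖ = 1) : ∃ θ : ℝ, w = rot θ v := by
  have h := norm_sq_eq_frame hv w
  rw [hw] at h
  set x := inner ℝ w v
  set y := inner ℝ w (rotJ v)
  let z : ℂ := ⟨x, y⟩
  have hz : ‖z‖ = 1 := by
    rw [← sq_eq_sq₀ (norm_nonneg _) zero_le_one, Complex.sq_norm, Complex.normSq_apply]
    simp only [z]; linarith
  refine ⟨z.arg, ?_⟩
  have h1 := Complex.norm_mul_cos_arg z
  have h2 := Complex.norm_mul_sin_arg z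
  rw [hz, one_mul] at h1 h2
  rw [rot, h1, h2]
  exact eq_frame hv w

/-- A unit vector with small component along `J v` which does not point away
from `v`, is a small rotation of `v`. -/
lemma exists_rot_small {v w : Plane} (hv : ‖v‖ = 1) (hw : ‖w‖ = 1) {e : ℝ}
    (h : |inner ℝ w (rotJ v)| ≤ e) (h0 : 0 ≤ inner ℝ w v) :
    ∃ ρ : ℝ, |ρ| ≤ Real.pi / 2 * e ∧ w = rot ρ v := by
  have h2 := norm_sq_eq_frame hv w
  rw [hw] at h2
  set x := inner ℝ w v with hx
  set y := inner ℝ w (rotJ v) with hy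
  have hy1 : -1 ≤ y := by nlinarith
  have hy2 : y ≤ 1 := by nlinarith
  refine ⟨Real.arcsin y, ?_, ?_⟩
  · have key : ∀ t : ℝ, 0 ≤ t → t ≤ 1 → Real.arcsin t ≤ Real.pi / 2 * t := by
      intro t ht ht1
      rw [Real.arcsin_le_iff_le_sin ⟨by linarith, ht1⟩ ⟨by nlinarith [Real.pi_pos], by
        nlinarith [Real.pi_pos]⟩]
      have := Real.mul_le_sin (x := Real.pi / 2 * t) (by positivity) (by nlinarith [Real.pi_pos])
      have e1 : 2 / Real.pi * (Real.pi / 2 * t) = t := by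
        field_simp
      linarith
    have hpi := Real.pi_pos
    rcases le_total 0 y with hp | hp
    · rw [abs_of_nonneg (Real.arcsin_nonneg.2 hp)]
      rw [abs_of_nonneg hp] at h
      calc _ ≤ _ := key y hp hy2
        _ ≤ _ := by gcongr
    · rw [abs_of_nonpos (Real.arcsin_nonpos.2 hp), ← Real.arcsin_neg]
      rw [abs_of_nonpos hp] at h
      calc _ ≤ _ := key (-y) (by linarith) (by linarith)
        _ ≤ _ := by gcongr
  · rw [rot, Real.sin_arcsin hy1 hy2, Real.cos_arcsin, show 1 - y ^ 2 = x ^ 2 by linarith,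
      Real.sqrt_sq h0]
    exact eq_frame hv w

end PlaneAlgebra

/-! ### Arcs parametrised by arclength -/

section UnitArc

/-- A plane curve `X`, defined on the whole line and parametrised by arclength, with unit tangent
`T` and continuous curvature `k`, so that `T' = k J T`. -/
structure UnitArc (X T : ℝ → Plane) (k : ℝ → ℝ) : Prop where
  norm_T : ∀ s, ‖T s‖ = 1
  hasDerivAt_X : ∀ s, HasDerivAt X (T s) s
  hasDerivAt_T : ∀ s, HasDerivAt T (k s • rotJ (T s)) s
  continuous_k : Continuous k

variable {X T : ℝ → Plane} {k : ℝ → ℝ}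

lemma UnitArc.intervalIntegrable_sq (h : UnitArc X T k) (a b : ℝ) :
    IntervalIntegrable (fun s => k s ^ 2) MeasureTheory.volume a b :=
  (h.continuous_k.pow 2).intervalIntegrable a b

/-- The same curve run backwards from the parameter `L`. -/
lemma UnitArc.reverse (h : UnitArc X T k) (L : ℝ) :
    UnitArc (fun s => X (L - s)) (fun s => -T (L - s)) (fun s => -k (L - s)) where
  norm_T s := by simpa using h.norm_T (L - s)
  hasDerivAt_X s := by
    have := (h.hasDerivAt_X (L - s)).scomp s ((hasDerivAt_id s).const_sub L)
    simpa [Function.comp_def] using this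
  hasDerivAt_T s := by
    have := ((h.hasDerivAt_T (L - s)).scomp s ((hasDerivAt_id s).const_sub L)).fun_neg
    simpa [Function.comp_def] using this
  continuous_k := by
    have := h.continuous_k
    fun_prop

/-- The tangent turns by the integral of the curvature. -/
lemma UnitArc.T_eq_rot (h : UnitArc X T k) (a b : ℝ) : T b = rot (∫ s in a..b, k s) (T a) := by
  set Θ : ℝ → ℝ := fun s => ∫ u in a..s, k u with hΘ
  have hΘd : ∀ s, HasDerivAt Θ (k s) s := fun s => by
    simpa using intervalIntegral.integral_hasDerivAt_right
      (h.continuous_k.intervalIntegrable a s)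
      h.continuous_k.stronglyMeasurable.stronglyMeasurableAtFilter h.continuous_k.continuousAt
  set g : ℝ → Plane := fun s => rot (-Θ s) (T s)
  have hg : ∀ s, HasDerivAt g 0 s := fun s => by
    have h1 : HasDerivAt (fun s => Real.cos (-Θ s)) (-Real.sin (-Θ s) * (-k s)) s :=
      (hΘd s).neg.cos
    have h2 : HasDerivAt (fun s => Real.sin (-Θ s)) (Real.cos (-Θ s) * (-k s)) s :=
      (hΘd s).neg.sin
    refine ((h1.smul (h.hasDerivAt_T s)).add (h2.smul (h.hasDerivAt_T s).rotJ)).congr_deriv ?_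
    simp only [rotJ_smul, rotJ_rotJ]
    module
  have hconst : g b = g a := by
    apply is_const_of_deriv_eq_zero (fun s => (hg s).differentiableAt)
    intro s
    exact (hg s).deriv
  have ha : g a = T a := by simp [g, hΘ]
  have hb : rot (Θ b) (g b) = T b := by simp [g, rot_rot]
  rw [← hb, hconst, ha]

lemma sq_integral_le_of_continuous {k : ℝ → ℝ} (hk : Continuous k) {a b : ℝ} (hab : a ≤ b) :
    (∫ s in a..b, k s) ^ 2 ≤ (b - a) * ∫ s in a..b, k s ^ 2 := by
  rcases hab.eq_or_lt with rfl | hlt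
  · simp
  set I := ∫ s in a..b, k s
  set m := I / (b - a)
  have h0 : 0 ≤ ∫ s in a..b, (k s - m) ^ 2 :=
    intervalIntegral.integral_nonneg hab fun _ _ => sq_nonneg _
  have h1 : ∫ s in a..b, (k s - m) ^ 2 =
      (∫ s in a..b, k s ^ 2) - 2 * m * I + m ^ 2 * (b - a) := by
    have e : ∀ s, (k s - m) ^ 2 = k s ^ 2 - 2 * m * k s + m ^ 2 := fun s => by ring
    simp_rw [e]
    rw [intervalIntegral.integral_add, intervalIntegral.integral_sub,
      intervalIntegral.integral_const_mul, intervalIntegral.integral_const]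
    · simp [I]; ring
    all_goals apply Continuous.intervalIntegrable; fun_prop
  have hm : m * (b - a) = I := by
    have : b - a ≠ 0 := by linarith
    simp only [m]; field_simp
  rw [h1] at h0
  have : 0 ≤ (b - a) * ((∫ s in a..b, k s ^ 2) - 2 * m * I + m ^ 2 * (b - a)) :=
    mul_nonneg (by linarith) h0
  nlinarith [this, hm]

/-- Along an arc the tangent stays close to its initial value when `∫ k²` is small. -/
lemma UnitArc.inner_T_ge (h : UnitArc X T k) {a b : ℝ} (hab : a ≤ b) :
    1 - (b - a) * (∫ s in a..b, k s ^ 2) / 2 ≤ inner ℝ (T b) (T a) := by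
  rw [h.T_eq_rot a b, inner_rot_self _ (h.norm_T a)]
  have h1 := Real.one_sub_sq_div_two_le_cos (x := ∫ s in a..b, k s)
  have h2 := sq_integral_le_of_continuous h.continuous_k hab
  linarith

lemma UnitArc.energy_mono (h : UnitArc X T k) {a b a' b' : ℝ} (ha : a' ≤ a) (hab : a ≤ b)
    (hb : b ≤ b') : ∫ s in a..b, k s ^ 2 ≤ ∫ s in a'..b', k s ^ 2 :=
  intervalIntegral.integral_mono_interval ha hab hb
    (Eventually.of_forall fun _ => sq_nonneg _) (h.intervalIntegrable_sq _ _)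

lemma UnitArc.energy_nonneg {a b : ℝ} (hab : a ≤ b) : 0 ≤ ∫ s in a..b, k s ^ 2 :=
  intervalIntegral.integral_nonneg hab fun _ _ => sq_nonneg _

/-- The displacement in the direction of the initial tangent. -/
lemma UnitArc.inner_chord_start_ge (h : UnitArc X T k) {a b : ℝ} (hab : a ≤ b) :
    (b - a) - (b - a) ^ 2 / 4 * (∫ s in a..b, k s ^ 2) ≤ inner ℝ (X b - X a) (T a) := by
  set E := ∫ s in a..b, k s ^ 2
  set f : ℝ → ℝ := fun s => inner ℝ (X s - X a) (T a) - (s - a) + (s - a) ^ 2 / 4 * E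
  have hd : ∀ s, HasDerivAt f (inner ℝ (T s) (T a) - 1 + (s - a) / 2 * E) s := fun s => by
    have h1 : HasDerivAt (fun s => inner ℝ (X s - X a) (T a)) (inner ℝ (T s) (T a)) s := by
      have := ((h.hasDerivAt_X s).sub_const (X a)).inner ℝ (hasDerivAt_const s (T a))
      simpa using this
    have h2 : HasDerivAt (fun s : ℝ => s - a) 1 s := (hasDerivAt_id s).sub_const a
    refine ((h1.sub h2).add (((h2.pow 2).div_const 4).mul_const E)).congr_deriv ?_
    norm_num
    left; ring
  have hmono : MonotoneOn f (Icc a b) := by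
    apply monotoneOn_of_deriv_nonneg (convex_Icc a b)
    · exact fun s _ => (hd s).continuousAt.continuousWithinAt
    · exact fun s _ => (hd s).differentiableAt.differentiableWithinAt
    · intro s hs
      rw [interior_Icc] at hs
      rw [(hd s).deriv]
      have h1 := h.inner_T_ge hs.1.le
      have h2 := h.energy_mono le_rfl hs.1.le hs.2.le
      have h3 : (s - a) * ∫ u in a..s, k u ^ 2 ≤ (s - a) * E :=
        mul_le_mul_of_nonneg_left h2 (by linarith [hs.1])
      linarith
  have := hmono (left_mem_Icc.2 hab) (right_mem_Icc.2 hab) hab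
  simp only [f, sub_self, inner_zero_left] at this
  linarith

/-- The displacement in the direction of the final tangent. -/
lemma UnitArc.inner_chord_end_ge (h : UnitArc X T k) {a b : ℝ} (hab : a ≤ b) :
    (b - a) - (b - a) ^ 2 / 4 * (∫ s in a..b, k s ^ 2) ≤ inner ℝ (X b - X a) (T b) := by
  have := (h.reverse (a + b)).inner_chord_start_ge hab
  simp only [add_sub_cancel_left, add_sub_cancel_right, neg_sq, inner_neg_right] at this
  rw [intervalIntegral.integral_comp_sub_left (fun s => k s ^ 2)] at this
  simp only [add_sub_cancel_left, add_sub_cancel_right] at this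
  rwa [← inner_neg_left, neg_sub] at this

/-- An arc whose endpoints are close together has large energy: compare the chord with the tangent at
the midpoint of the arc. -/
lemma UnitArc.loop_energy (h : UnitArc X T k) {a b : ℝ} (hab : a ≤ b) :
    16 * ((b - a) - dist (X a) (X b)) ≤ (b - a) ^ 2 * ∫ s in a..b, k s ^ 2 := by
  set m := (a + b) / 2 with hm
  have h1 := h.inner_chord_end_ge (show a ≤ m by rw [hm]; linarith)
  have h2 := h.inner_chord_start_ge (show m ≤ b by rw [hm]; linarith)
  have h3 : inner ℝ (X m - X a) (T m) + inner ℝ (X b - X m) (T m) ≤ dist (X a) (X b) := by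
    rw [← inner_add_left, dist_comm, dist_eq_norm]
    calc _ ≤ _ := real_inner_le_norm _ _
      _ = _ := by rw [h.norm_T]; simp [sub_add_sub_cancel']
  have h4 := intervalIntegral.integral_add_adjacent_intervals
    (h.intervalIntegrable_sq a m) (h.intervalIntegrable_sq m b)
  have e1 : m - a = (b - a) / 2 := by rw [hm]; ring
  have e2 : b - m = (b - a) / 2 := by rw [hm]; ring
  rw [e1] at h1
  rw [e2] at h2
  rw [← h4]
  nlinarith

/-- A bound on the displacement from a pointwise bound of the curvature. -/
lemma UnitArc.inner_chord_start_ge_of_bound (h : UnitArc X T k) {a b M : ℝ} (hab : a ≤ b)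
    (hM : ∀ s ∈ Icc a b, |k s| ≤ M) (hs : (b - a) * M ≤ 1 / 2) :
    3 / 4 * (b - a) ≤ inner ℝ (X b - X a) (T a) := by
  have h1 := h.inner_chord_start_ge hab
  have hE : ∫ s in a..b, k s ^ 2 ≤ (b - a) * M ^ 2 := by
    have : ∫ s in a..b, k s ^ 2 ≤ ∫ s in a..b, M ^ 2 := by
      apply intervalIntegral.integral_mono_on hab (h.intervalIntegrable_sq _ _)
        (by simp)
      intro s hs
      have := hM s hs
      rw [← sq_abs]
      gcongr
    simpa using this
  have hM0 : 0 ≤ M := (abs_nonneg _).trans (hM a (left_mem_Icc.2 hab))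
  have hba : 0 ≤ b - a := by linarith
  have h5 : ((b - a) * M) ^ 2 ≤ 1 / 4 := by
    have : 0 ≤ (b - a) * M := by positivity
    nlinarith
  have h6 : (b - a) ^ 2 / 4 * (∫ s in a..b, k s ^ 2) ≤ (b - a) * (1 / 16) := by
    calc _ ≤ (b - a) ^ 2 / 4 * ((b - a) * M ^ 2) := by gcongr
      _ = (b - a) * (((b - a) * M) ^ 2 / 4) := by ring
      _ ≤ _ := by
        apply mul_le_mul_of_nonneg_left _ hba
        linarith
  linarith

end UnitArc

/-! ### Normals of a convex domain of class `C²` -/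

section Normal

variable {Ω : Set Plane} {p : Plane} {f : Plane → ℝ}

lemma IsDefiningAt.hasFDerivAt (hf : IsDefiningAt Ω p f) :
    HasFDerivAt f (fderiv ℝ f p) p :=
  (hf.contDiffAt.differentiableAt (by norm_num)).hasFDerivAt

lemma inner_gradient_eq (f : Plane → ℝ) (p v : Plane) :
    inner ℝ (gradient f p) v = fderiv ℝ f p v := by
  rw [gradient, InnerProductSpace.toDual_symm_apply]

lemma IsDefiningAt.apply_eq_zero (hf : IsDefiningAt Ω p f) (hΩ : IsClosed Ω)
    (hp : p ∈ frontier Ω) : f p = 0 := by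
  have h1 : f p ≤ 0 := hf.mem_iff.self_of_nhds.1 (hΩ.frontier_subset hp)
  by_contra hne
  have hlt : f p < 0 := lt_of_le_of_ne h1 hne
  have h2 : ∀ᶠ q in 𝓝 p, f q < 0 := hf.contDiffAt.continuousAt.eventually_lt_const hlt
  have h3 : Ω ∈ 𝓝 p := by
    filter_upwards [h2, hf.mem_iff] with q hq1 hq2
    exact hq2.2 hq1.le
  exact hp.2 (mem_interior_iff_mem_nhds.2 h3)

lemma IsDefiningAt.tendsto_slope (hf : IsDefiningAt Ω p f) (hΩ : IsClosed Ω)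
    (hp : p ∈ frontier Ω) (v : Plane) :
    Tendsto (fun r : ℝ => r⁻¹ * f (p + r • v)) (𝓝[>] 0) (𝓝 (inner ℝ (gradient f p) v)) := by
  have h1 : HasDerivAt (fun r : ℝ => f (p + r • v)) (fderiv ℝ f p v) 0 := by
    have h2 : HasDerivAt (fun r : ℝ => p + r • v) v 0 := by
      simpa using ((hasDerivAt_id (0 : ℝ)).smul_const v).const_add p
    have h3 : HasFDerivAt f (fderiv ℝ f p) (p + (0 : ℝ) • v) := by simpa using hf.hasFDerivAt
    exact h3.comp_hasDerivAt (0 : ℝ) h2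
  rw [hasDerivAt_iff_tendsto_slope_zero] at h1
  have h4 := h1.mono_left (nhdsWithin_mono (t := {0}ᶜ) 0 (show Ioi (0 : ℝ) ⊆ {0}ᶜ from fun r hr => (mem_Ioi.1 hr).ne'))
  rw [inner_gradient_eq]
  simpa [hf.apply_eq_zero hΩ hp] using h4

lemma tendsto_add_smul_nhdsGT (p v : Plane) :
    Tendsto (fun r : ℝ => p + r • v) (𝓝[>] 0) (𝓝 p) := by
  have : Continuous fun r : ℝ => p + r • v := by fun_prop
  simpa using (this.tendsto 0).mono_left nhdsWithin_le_nhds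

lemma IsDefiningAt.eventually_mem (hf : IsDefiningAt Ω p f) (hΩ : IsClosed Ω)
    (hp : p ∈ frontier Ω) {v : Plane} (hv : inner ℝ (gradient f p) v < 0) :
    ∀ᶠ r : ℝ in 𝓝[>] 0, p + r • v ∈ Ω := by
  filter_upwards [(hf.tendsto_slope hΩ hp v).eventually_lt_const hv,
    (tendsto_add_smul_nhdsGT p v).eventually hf.mem_iff, self_mem_nhdsWithin] with r h1 h2 h3
  refine h2.2 ?_
  have h3 : 0 < r⁻¹ := inv_pos.2 h3
  nlinarith

lemma IsDefiningAt.eventually_notMem (hf : IsDefiningAt Ω p f) (hΩ : IsClosed Ω)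
    (hp : p ∈ frontier Ω) {v : Plane} (hv : 0 < inner ℝ (gradient f p) v) :
    ∀ᶠ r : ℝ in 𝓝[>] 0, p + r • v ∉ Ω := by
  filter_upwards [(hf.tendsto_slope hΩ hp v).eventually_const_lt hv,
    (tendsto_add_smul_nhdsGT p v).eventually hf.mem_iff, self_mem_nhdsWithin] with r h1 h2 h3
  rw [h2]
  have h3 : 0 < r⁻¹ := inv_pos.2 h3
  intro h4
  nlinarith

lemma IsDefiningAt.support (hf : IsDefiningAt Ω p f) (hΩ : IsConvexC2Domain Ω)
    (hp : p ∈ frontier Ω) {q : Plane} (hq : q ∈ Ω) : inner ℝ (gradient f p) (q - p) ≤ 0 := by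
  by_contra! hlt
  have h1 := hf.eventually_notMem hΩ.isClosed hp hlt
  have h2 : ∀ᶠ r : ℝ in 𝓝[>] 0, r < 1 :=
    nhdsWithin_le_nhds (eventually_lt_nhds one_pos)
  obtain ⟨r, h3, h4, h5⟩ := (h1.and (h2.and self_mem_nhdsWithin)).exists
  exact h3 (hΩ.convex.add_smul_sub_mem (hΩ.isClosed.frontier_subset hp) hq ⟨le_of_lt h5, h4.le⟩)

/-- The only unit vector supporting `Ω` at a boundary point is the normalised gradient of a
defining function. -/
lemma IsDefiningAt.eq_of_support (hf : IsDefiningAt Ω p f) (hΩ : IsConvexC2Domain Ω)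
    (hp : p ∈ frontier Ω) {u : Plane} (hu : ‖u‖ = 1) (hs : ∀ q ∈ Ω, inner ℝ u (q - p) ≤ 0) :
    u = ‖gradient f p‖⁻¹ • gradient f p := by
  set g := gradient f p
  have hg : 0 < ‖g‖ := norm_pos_iff.2 hf.gradient_ne_zero
  set n := ‖g‖⁻¹ • g with hn
  have hn1 : ‖n‖ = 1 := by rw [hn, norm_smul, norm_inv, norm_norm, inv_mul_cancel₀ hg.ne']
  have hgn : g = ‖g‖ • n := by rw [hn, smul_smul, mul_inv_cancel₀ hg.ne', one_smul]
  have huu : inner ℝ u u = 1 := by rw [real_inner_self_eq_norm_sq, hu]; norm_num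
  have hnn : inner ℝ n n = 1 := by rw [real_inner_self_eq_norm_sq, hn1]; norm_num
  by_contra hne
  have h1 : inner ℝ u n < 1 := inner_lt_one_iff_real_of_norm_eq_one hu hn1 |>.2 hne
  have h2 : inner ℝ g (u - n) < 0 := by
    rw [hgn, inner_smul_left, inner_sub_right, hnn, real_inner_comm]
    simp only [conj_trivial]
    nlinarith
  obtain ⟨r, h3, h4⟩ :=
    ((hf.eventually_mem hΩ.isClosed hp h2).and self_mem_nhdsWithin).exists
  have h5 := hs _ h3
  have h4 : 0 < r := h4
  rw [add_sub_cancel_left, inner_smul_right, inner_sub_right, huu] at h5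
  nlinarith

lemma IsConvexC2Domain.isDefiningAt (hΩ : IsConvexC2Domain Ω) (hp : p ∈ frontier Ω) :
    IsDefiningAt Ω p (definingFunction Ω p) := by
  have h := hΩ.boundary_C2 p hp
  rw [definingFunction, dif_pos h]
  exact h.choose_spec

lemma IsConvexC2Domain.norm_outwardNormal (hΩ : IsConvexC2Domain Ω) (hp : p ∈ frontier Ω) :
    ‖outwardNormal Ω p‖ = 1 := by
  have hg := norm_pos_iff.2 (hΩ.isDefiningAt hp).gradient_ne_zero
  rw [outwardNormal, norm_smul, norm_inv, norm_norm, inv_mul_cancel₀ hg.ne']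

lemma IsConvexC2Domain.gradient_eq (hΩ : IsConvexC2Domain Ω) (hp : p ∈ frontier Ω) :
    gradient (definingFunction Ω p) p =
      ‖gradient (definingFunction Ω p) p‖ • outwardNormal Ω p := by
  have hg := norm_pos_iff.2 (hΩ.isDefiningAt hp).gradient_ne_zero
  rw [outwardNormal, smul_smul, mul_inv_cancel₀ hg.ne', one_smul]

/-- `Ω` lies on the inner side of each of its tangent lines. -/
lemma IsConvexC2Domain.support (hΩ : IsConvexC2Domain Ω) (hp : p ∈ frontier Ω) {q : Plane}
    (hq : q ∈ Ω) : inner ℝ (outwardNormal Ω p) (q - p) ≤ 0 := by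
  have h := (hΩ.isDefiningAt hp).support hΩ hp hq
  have hg := norm_pos_iff.2 (hΩ.isDefiningAt hp).gradient_ne_zero
  rw [hΩ.gradient_eq hp, inner_smul_left] at h
  simp only [conj_trivial] at h
  exact nonpos_of_mul_nonpos_right h hg

lemma IsConvexC2Domain.eventually_mem (hΩ : IsConvexC2Domain Ω) (hp : p ∈ frontier Ω)
    {v : Plane} (hv : inner ℝ (outwardNormal Ω p) v < 0) :
    ∀ᶠ r : ℝ in 𝓝[>] 0, p + r • v ∈ Ω := by
  have hg := norm_pos_iff.2 (hΩ.isDefiningAt hp).gradient_ne_zero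
  apply (hΩ.isDefiningAt hp).eventually_mem hΩ.isClosed hp
  rw [hΩ.gradient_eq hp, inner_smul_left]
  exact mul_neg_of_pos_of_neg hg hv

lemma IsConvexC2Domain.eventually_notMem (hΩ : IsConvexC2Domain Ω) (hp : p ∈ frontier Ω)
    {v : Plane} (hv : 0 < inner ℝ (outwardNormal Ω p) v) :
    ∀ᶠ r : ℝ in 𝓝[>] 0, p + r • v ∉ Ω := by
  have hg := norm_pos_iff.2 (hΩ.isDefiningAt hp).gradient_ne_zero
  apply (hΩ.isDefiningAt hp).eventually_notMem hΩ.isClosed hp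
  rw [hΩ.gradient_eq hp, inner_smul_left]
  exact mul_pos hg hv

lemma IsConvexC2Domain.eq_outwardNormal (hΩ : IsConvexC2Domain Ω) (hp : p ∈ frontier Ω)
    {u : Plane} (hu : ‖u‖ = 1) (hs : ∀ q ∈ Ω, inner ℝ u (q - p) ≤ 0) :
    u = outwardNormal Ω p :=
  (hΩ.isDefiningAt hp).eq_of_support hΩ hp hu hs

/-- Points of the interior lie strictly on the inner side of each tangent line. -/
lemma IsConvexC2Domain.support_lt (hΩ : IsConvexC2Domain Ω) (hp : p ∈ frontier Ω) {q : Plane}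
    (hq : q ∈ interior Ω) : inner ℝ (outwardNormal Ω p) (q - p) < 0 := by
  have h1 : ∀ᶠ r : ℝ in 𝓝[>] 0, q + r • outwardNormal Ω p ∈ Ω :=
    (tendsto_add_smul_nhdsGT q _).eventually (mem_interior_iff_mem_nhds.1 hq)
  obtain ⟨r, h2, h3⟩ := (h1.and self_mem_nhdsWithin).exists
  have h3 : 0 < r := h3
  have h4 := hΩ.support hp h2
  rw [add_sub_right_comm, inner_add_right, inner_smul_right, real_inner_self_eq_norm_sq,
    hΩ.norm_outwardNormal hp] at h4
  linarith

/-- If `p` and `q` are boundary points and `q` lies on the tangent line at `p`, then the tangent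
lines agree. -/
lemma IsConvexC2Domain.outwardNormal_eq_of_inner_eq_zero (hΩ : IsConvexC2Domain Ω)
    (hp : p ∈ frontier Ω) {q : Plane} (hq : q ∈ frontier Ω)
    (h : inner ℝ (outwardNormal Ω p) (q - p) = 0) : outwardNormal Ω p = outwardNormal Ω q := by
  apply hΩ.eq_outwardNormal hq (hΩ.norm_outwardNormal hp)
  intro w hw
  have := hΩ.support hp hw
  rw [← sub_add_sub_cancel w q p, inner_add_right, h] at this
  linarith

/-- A single defining function computes the normal at all nearby boundary points. -/
lemma IsConvexC2Domain.eventually_outwardNormal_eq (hΩ : IsConvexC2Domain Ω)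
    (hf : IsDefiningAt Ω p f) :
    ∀ᶠ q in 𝓝 p, q ∈ frontier Ω → outwardNormal Ω q = ‖gradient f q‖⁻¹ • gradient f q := by
  have hc : ContinuousAt (fun q => gradient f q) p := by
    have : ContinuousAt (fderiv ℝ f) p :=
      (hf.contDiffAt.fderiv_right (m := 1) (by norm_num)).continuousAt
    exact (InnerProductSpace.toDual ℝ Plane).symm.continuous.continuousAt.comp this
  filter_upwards [hf.contDiffAt.eventually (by simp),
    hc.eventually_ne hf.gradient_ne_zero, hf.mem_iff.eventually_nhds] with q h1 h2 h3 hq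
  exact IsDefiningAt.eq_of_support ⟨h1, h2, h3⟩ hΩ hq (hΩ.norm_outwardNormal hq)
    (fun w hw => hΩ.support hq hw)

lemma IsConvexC2Domain.continuousOn_outwardNormal (hΩ : IsConvexC2Domain Ω) :
    ContinuousOn (outwardNormal Ω) (frontier Ω) := by
  intro p hp
  have hf := hΩ.isDefiningAt hp
  set f := definingFunction Ω p
  have hc : ContinuousAt (fun q => gradient f q) p := by
    have : ContinuousAt (fderiv ℝ f) p :=
      (hf.contDiffAt.fderiv_right (m := 1) (by norm_num)).continuousAt
    exact (InnerProductSpace.toDual ℝ Plane).symm.continuous.continuousAt.comp this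
  have hc2 : ContinuousAt (fun q => ‖gradient f q‖⁻¹ • gradient f q) p :=
    (hc.norm.inv₀ (norm_ne_zero_iff.2 hf.gradient_ne_zero)).smul hc
  refine hc2.continuousWithinAt.congr_of_eventuallyEq ?_ rfl
  have := hΩ.eventually_outwardNormal_eq hf
  filter_upwards [nhdsWithin_le_nhds this, self_mem_nhdsWithin] with q h1 h2
  exact h1 h2

/-- A segment from a point of `Ω` to a point outside the interior meets the boundary. -/
lemma exists_frontier_segment {Ω : Set Plane} {x z : Plane} (hx : x ∈ Ω)
    (hz : z ∉ interior Ω) : ∃ w ∈ segment ℝ x z, w ∈ frontier Ω := by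
  by_contra! hno
  have hx' : x ∈ interior Ω := by
    by_contra hx'
    exact hno x (left_mem_segment ℝ x z) ⟨subset_closure hx, hx'⟩
  have hz' : z ∉ closure Ω := fun h => hno z (right_mem_segment ℝ x z) ⟨h, hz⟩
  obtain ⟨w, -, hw1, hw2⟩ := (convex_segment (𝕜 := ℝ) x z).isPreconnected (interior Ω)
    (closure Ω)ᶜ isOpen_interior isClosed_closure.isOpen_compl
    (fun w hw => by
      by_cases h1 : w ∈ interior Ω
      · exact Or.inl h1
      · exact Or.inr fun h2 => hno w hw ⟨h2, h1⟩)
    ⟨x, left_mem_segment ℝ x z, hx'⟩ ⟨z, right_mem_segment ℝ x z, hz'⟩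
  exact hw2 (interior_subset_closure hw1)

end Normal

/-! ### Turning of the normal along the boundary -/

section Turning

variable {Ω : Set Plane} {p : Plane}

/-- The Riesz isomorphism of the plane as an `ℝ`-linear map. -/
noncomputable def rieszL : StrongDual ℝ Plane →L[ℝ] Plane :=
  LinearMap.toContinuousLinearMap
    { toFun := (InnerProductSpace.toDual ℝ Plane).symm
      map_add' := fun a b => by simp
      map_smul' := fun a v => by simp }

/-- The derivative of the component `⟪N, u⟫` of the unit normal in the direction of the tangent `τ`
is `κ ⟪τ, u⟫`. -/
lemma IsConvexC2Domain.hasFDerivAt_normal (hΩ : IsConvexC2Domain Ω) (hp : p ∈ frontier Ω)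
    (u : Plane) :
    ∃ A : Plane →L[ℝ] ℝ,
      HasFDerivAt (fun q => inner ℝ (‖gradient (definingFunction Ω p) q‖⁻¹ •
        gradient (definingFunction Ω p) q) u) A p ∧
      A (boundaryTangent Ω p) = boundaryCurvature Ω p * inner ℝ (boundaryTangent Ω p) u := by
  have hf := hΩ.isDefiningAt hp
  have hfg := hΩ.gradient_eq hp
  have hκ : boundaryCurvature Ω p = fderiv ℝ (fderiv ℝ (definingFunction Ω p)) p
    (boundaryTangent Ω p) (boundaryTangent Ω p) / ‖gradient (definingFunction Ω p) p‖ := rfl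
  set f := definingFunction Ω p
  set n := outwardNormal Ω p with hn
  have hn1 : ‖n‖ = 1 := hΩ.norm_outwardNormal hp
  set τ := boundaryTangent Ω p with hτ
  have hτn : τ = rotJ n := rfl
  set G : Plane → Plane := fun q => gradient f q
  have hg : 0 < ‖G p‖ := norm_pos_iff.2 hf.gradient_ne_zero
  set D := fderiv ℝ (fderiv ℝ f) p
  have hD : HasFDerivAt (fderiv ℝ f) D p :=
    ((hf.contDiffAt.fderiv_right (m := 1) (by norm_num)).differentiableAt
      (by norm_num)).hasFDerivAt
  set B : Plane →L[ℝ] Plane :=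
rieszL.comp D with hB
  have hG : HasFDerivAt G B p :=
rieszL.hasFDerivAt.comp p hD
  have hBin : ∀ v w, inner ℝ (B v) w = D v w := fun v w => by
    change inner ℝ ((InnerProductSpace.toDual ℝ Plane).symm (D v)) w = D v w
    rw [InnerProductSpace.toDual_symm_apply]
  have hdiff : DifferentiableAt ℝ (fun q => inner ℝ (‖G q‖⁻¹ • G q) u) p := by
    have h1 : DifferentiableAt ℝ (fun q => ‖G q‖⁻¹ • G q) p :=
      ((hG.differentiableAt.norm ℝ hf.gradient_ne_zero).inv hg.ne').smul hG.differentiableAt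
    exact h1.inner ℝ (differentiableAt_const u)
  refine ⟨_, hdiff.hasFDerivAt, ?_⟩
  set A := fderiv ℝ (fun q => inner ℝ (‖G q‖⁻¹ • G q) u) p
  -- the derivative along the line `p + t τ`
  have hline : HasDerivAt (fun t : ℝ => p + t • τ) τ 0 := by
    simpa using ((hasDerivAt_id (0 : ℝ)).smul_const τ).const_add p
  have e0 : p + (0 : ℝ) • τ = p := by simp
  have hGl : HasDerivAt (fun t : ℝ => G (p + t • τ)) (B τ) 0 :=
    HasFDerivAt.comp_hasDerivAt (0 : ℝ) (f := fun t : ℝ => p + t • τ) (l := G)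
      (by rw [e0]; exact hG) hline
  have hNl : DifferentiableAt ℝ (fun t : ℝ => ‖G (p + t • τ)‖) 0 :=
    hGl.differentiableAt.norm ℝ (by rw [e0]; exact hf.gradient_ne_zero)
  obtain ⟨M, hM⟩ : ∃ M, HasDerivAt (fun t : ℝ => ‖G (p + t • τ)‖) M 0 := ⟨_, hNl.hasDerivAt⟩
  have hMv : M * ‖G p‖ = inner ℝ (B τ) (G p) := by
    have h1 := hM.fun_mul hM
    have h2 := hGl.inner ℝ hGl
    have h3 : (fun t : ℝ => ‖G (p + t • τ)‖ * ‖G (p + t • τ)‖) =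
        fun t => inner ℝ (G (p + t • τ)) (G (p + t • τ)) := by
      funext t; rw [real_inner_self_eq_norm_mul_norm]
    rw [h3] at h1
    have h4 := h1.unique h2
    simp only [e0] at h4
    rw [real_inner_comm] at h4
    linarith
  have hAl : HasDerivAt (fun t : ℝ => inner ℝ (‖G (p + t • τ)‖⁻¹ • G (p + t • τ)) u) (A τ) 0 :=
    HasFDerivAt.comp_hasDerivAt (0 : ℝ)
      (f := fun t : ℝ => p + t • τ) (l := fun q => inner ℝ (‖G q‖⁻¹ • G q) u)
      (by rw [e0]; exact hdiff.hasFDerivAt) hline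
  have hA2 : HasDerivAt (fun t : ℝ => inner ℝ (‖G (p + t • τ)‖⁻¹ • G (p + t • τ)) u)
      (inner ℝ (‖G p‖⁻¹ • B τ + (-M / ‖G p‖ ^ 2) • G p) u) 0 := by
    have h1 := ((hM.fun_inv (by rw [e0]; exact hg.ne')).smul hGl).inner ℝ (hasDerivAt_const (0 : ℝ) u)
    simpa [e0] using h1
  rw [hAl.unique hA2, hκ, ← hBin]
  rw [inner_add_left, inner_smul_left, inner_smul_left]
  simp only [conj_trivial]
  have hGp : G p = ‖G p‖ • n := hfg
  have hBn : M = inner ℝ (B τ) n := by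
    rw [hGp, inner_smul_right] at hMv
    rw [norm_smul, norm_norm, hn1, mul_one] at hMv
    exact mul_left_cancel₀ hg.ne' (by linarith)
  have h5 : inner ℝ (G p) u = ‖G p‖ * inner ℝ n u := by
    conv_lhs => rw [hGp]
    rw [inner_smul_left]; rfl
  rw [h5, inner_eq_frame hn1 (B τ) u, ← hτn, hBn, real_inner_comm n u, real_inner_comm τ u]
  change _ = inner ℝ (B τ) τ / ‖G p‖ * _
  field_simp
  ring

/-- Near a boundary point, the boundary contains points in both tangential directions, at
distance `o(r)` from the tangent line. -/
lemma IsConvexC2Domain.exists_frontier_near (hΩ : IsConvexC2Domain Ω) (hp : p ∈ frontier Ω)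
    {v : Plane} (hv : inner ℝ (outwardNormal Ω p) v = 0) {η : ℝ} (hη : 0 < η) :
    ∀ᶠ r : ℝ in 𝓝[>] 0, ∃ w : Plane, ‖w‖ ≤ η ∧ p + r • (v + w) ∈ frontier Ω := by
  set n := outwardNormal Ω p
  have hn1 : ‖n‖ = 1 := hΩ.norm_outwardNormal hp
  have hnn : inner ℝ n n = 1 := by rw [real_inner_self_eq_norm_sq, hn1]; norm_num
  have h1 := hΩ.eventually_mem hp (v := v - η • n) (by
    rw [inner_sub_right, inner_smul_right]; simp only [n] at *; rw [hv, hnn]; linarith)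
  have h2 := hΩ.eventually_notMem hp (v := v + η • n) (by
    rw [inner_add_right, inner_smul_right]; simp only [n] at *; rw [hv, hnn]; linarith)
  filter_upwards [h1, h2, self_mem_nhdsWithin] with r h3 h4 h5
  obtain ⟨w, hw1, hw2⟩ := exists_frontier_segment h3 (fun h => h4 (interior_subset h))
  rw [segment_eq_image_lineMap] at hw1
  obtain ⟨t, ht, rfl⟩ := hw1
  refine ⟨((2 * t - 1) * η) • n, ?_, ?_⟩
  · rw [norm_smul, hn1, mul_one, Real.norm_eq_abs, abs_mul, abs_of_pos hη]
    have : |2 * t - 1| ≤ 1 := abs_le.2 ⟨by linarith [ht.1], by linarith [ht.2]⟩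
    nlinarith
  · convert hw2 using 1
    rw [AffineMap.lineMap_apply_module]
    module

/-- The comparison principle for the turning of the normal: if `κ < C'` at the boundary point `p`,
then moving along the boundary in the direction in which `⟪·, u⟫` decreases makes
`⟪N, u⟫ - C' ⟪·, u⟫` increase. -/
lemma IsConvexC2Domain.exists_increase (hΩ : IsConvexC2Domain Ω) (hp : p ∈ frontier Ω)
    {u : Plane} (hu : inner ℝ (boundaryTangent Ω p) u ≠ 0) {C' : ℝ}
    (hκ : boundaryCurvature Ω p < C') {U : Set Plane} (hU : U ∈ 𝓝 p) :
    ∃ q ∈ frontier Ω ∩ U, inner ℝ q u < inner ℝ p u ∧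
      inner ℝ (outwardNormal Ω p) u - C' * inner ℝ p u <
        inner ℝ (outwardNormal Ω q) u - C' * inner ℝ q u := by
  obtain ⟨A, hA, hAτ⟩ := hΩ.hasFDerivAt_normal hp u
  have hNeq := hΩ.eventually_outwardNormal_eq (hΩ.isDefiningAt hp)
  set f := definingFunction Ω p
  set τ := boundaryTangent Ω p with hτ
  have hτn : inner ℝ (outwardNormal Ω p) τ = 0 := by simp [hτ, boundaryTangent]
  obtain ⟨σ, hσ⟩ : ∃ σ : ℝ, σ * inner ℝ τ u < 0 :=
    ⟨-inner ℝ τ u, by have := mul_self_pos.2 hu; linarith⟩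
  set v := σ • τ
  have hvu : inner ℝ v u < 0 := by simpa [v, inner_smul_left] using hσ
  have hvn : inner ℝ (outwardNormal Ω p) v = 0 := by simp [v, inner_smul_right, hτn]
  set H : Plane → ℝ := fun q => inner ℝ (‖gradient f q‖⁻¹ • gradient f q) u - C' * inner ℝ q u
  set B : Plane →L[ℝ] ℝ := A - C' • (innerSL ℝ u) with hB
  have hH : HasFDerivAt H B p := by
    have h1 : HasFDerivAt (fun q : Plane => C' * inner ℝ q u) (C' • innerSL ℝ u) p := by
      have := (innerSL ℝ u).hasFDerivAt (x := p)
      have := this.const_mul C'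
      simpa [real_inner_comm] using this
    exact hA.sub h1
  have hBv : 0 < B v := by
    have : B v = (boundaryCurvature Ω p - C') * inner ℝ v u := by
      simp only [hB, v, _root_.sub_apply, map_smul, hAτ, inner_smul_left,
        _root_.smul_apply, innerSL_apply_apply, smul_eq_mul, conj_trivial,
        real_inner_comm]
      ring
    rw [this]
    exact mul_pos_of_neg_of_neg (by linarith) hvu
  -- `η` is small enough for the errors in position and in the Taylor expansion
  obtain ⟨η, hη, h1, h2⟩ : ∃ η : ℝ, 0 < η ∧ inner ℝ v u + η * ‖u‖ < 0 ∧
      η * ‖B‖ + η * (‖v‖ + η) < B v := by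
    have c1 : Tendsto (fun η : ℝ => inner ℝ v u + η * ‖u‖) (𝓝[>] 0) (𝓝 (inner ℝ v u + 0 * ‖u‖)) :=
      ((by fun_prop : Continuous fun η : ℝ => inner ℝ v u + η * ‖u‖).tendsto 0).mono_left
        nhdsWithin_le_nhds
    have c2 : Tendsto (fun η : ℝ => η * ‖B‖ + η * (‖v‖ + η)) (𝓝[>] 0)
        (𝓝 (0 * ‖B‖ + 0 * (‖v‖ + 0))) :=
      ((by fun_prop : Continuous fun η : ℝ => η * ‖B‖ + η * (‖v‖ + η)).tendsto 0).mono_left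
        nhdsWithin_le_nhds
    have d1 := c1.eventually_lt_const (u := 0) (by simpa using hvu)
    have d2 := c2.eventually_lt_const (u := B v) (by simpa using hBv)
    obtain ⟨η, e1, e2, e3⟩ := (d1.and (d2.and self_mem_nhdsWithin)).exists
    exact ⟨η, e3, e1, e2⟩
  have hLO := (hasFDerivAt_iff_isLittleO.1 hH).def hη
  have hnear : ∀ᶠ q in 𝓝 p, q ∈ U ∧ ‖H q - H p - B (q - p)‖ ≤ η * ‖q - p‖ ∧
      (q ∈ frontier Ω → outwardNormal Ω q = ‖gradient f q‖⁻¹ • gradient f q) := by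
    filter_upwards [hU, hLO, hNeq] with q a b c using ⟨a, b, c⟩
  obtain ⟨ρ, hρ, hball⟩ := Metric.eventually_nhds_iff.1 hnear
  have hsmall : ∀ᶠ r : ℝ in 𝓝[>] 0, r * (‖v‖ + η) < ρ := by
    have c1 : Tendsto (fun r : ℝ => r * (‖v‖ + η)) (𝓝[>] 0) (𝓝 (0 * (‖v‖ + η))) :=
      ((by fun_prop : Continuous fun r : ℝ => r * (‖v‖ + η)).tendsto 0).mono_left
        nhdsWithin_le_nhds
    exact c1.eventually_lt_const (by simpa using hρ)
  obtain ⟨r, ⟨w, hw, hq⟩, h4, h5⟩ :=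
    ((hΩ.exists_frontier_near hp hvn hη).and (hsmall.and self_mem_nhdsWithin)).exists
  have h5 : 0 < r := h5
  set q := p + r • (v + w) with hqdef
  have hqp : q - p = r • (v + w) := by simp [hqdef]
  have hvw : ‖v + w‖ ≤ ‖v‖ + η := (norm_add_le _ _).trans (by linarith)
  have hdist : ‖q - p‖ ≤ r * (‖v‖ + η) := by
    rw [hqp, norm_smul, Real.norm_of_nonneg h5.le]; gcongr
  obtain ⟨k1, k2, k3⟩ := hball (y := q) (by rw [dist_eq_norm]; linarith)
  refine ⟨q, ⟨hq, k1⟩, ?_, ?_⟩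
  · have e1 : inner ℝ q u = inner ℝ p u + r * (inner ℝ v u + inner ℝ w u) := by
      rw [hqdef, inner_add_left, inner_smul_left, inner_add_left]; rfl
    have e2 : inner ℝ w u ≤ η * ‖u‖ :=
      (real_inner_le_norm _ _).trans (mul_le_mul_of_nonneg_right hw (norm_nonneg _))
    rw [e1]
    nlinarith
  · have e1 : B (q - p) = r * (B v + B w) := by rw [hqp, map_smul, map_add]; rfl
    have e2 : |B w| ≤ ‖B‖ * η := (B.le_opNorm w).trans (by gcongr)
    have e3 := (abs_le.1 k2).1
    have e4 : η * ‖q - p‖ ≤ η * (r * (‖v‖ + η)) := by gcongr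
    have e5 := (abs_le.1 e2).1
    have e6 : 0 < r * (B v + B w) - η * (r * (‖v‖ + η)) := by
      have : 0 < B v + B w - η * (‖v‖ + η) := by linarith
      calc 0 < r * (B v + B w - η * (‖v‖ + η)) := mul_pos h5 this
        _ = _ := by ring
    have e7 : H p < H q := by rw [e1] at e3; linarith
    have e8 : H p = inner ℝ (outwardNormal Ω p) u - C' * inner ℝ p u := rfl
    have e9 : H q = inner ℝ (outwardNormal Ω q) u - C' * inner ℝ q u := by
      rw [k3 hq]
    rwa [← e8, ← e9]

end Turning

/-! ### Normals at nearby boundary points -/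

section Coordinates

/-- Cartesian coordinates `x, y` adapted to a boundary point `p` of `Ω`: the origin is `p`, the
`x`-axis is the tangent line, and the `y`-axis points into `Ω`.  The functions `N₁, N₂` are the
components of the outward normal.  The direction of the `x`-axis is not specified.
Besides the choice of coordinates, the fields record that `Ω` is convex (`sup`, `chord`), that
boundary points on a common tangent line have the same normal (`uniq`), and the comparison principle
for the turning of the normal (`increase`). -/
structure BoundaryCoords (Ω : Set Plane) (p : Plane) (x y N₁ N₂ : Plane → ℝ) : Prop where
  sup : ∀ s ∈ frontier Ω, ∀ w ∈ Ω, N₁ s * (x w - x s) + N₂ s * (y w - y s) ≤ 0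
  uniq : ∀ s ∈ frontier Ω, ∀ w ∈ frontier Ω, N₁ s * (x w - x s) + N₂ s * (y w - y s) = 0 →
    N₂ s = N₂ w
  unit : ∀ s ∈ frontier Ω, N₁ s ^ 2 + N₂ s ^ 2 = 1
  x_self : x p = 0
  y_self : y p = 0
  N₁_self : N₁ p = 0
  N₂_self : N₂ p = -1
  chord : ∀ w ∈ Ω, ∀ t ∈ Icc (0 : ℝ) 1, ∃ w' ∈ Ω, x w' = t * x w ∧ y w' = t * y w
  inj : ∀ a b, x a = x b → y a = y b → a = b
  dist_sq : ∀ a, dist a p ^ 2 = x a ^ 2 + y a ^ 2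
  cont_x : Continuous x
  cont_y : Continuous y
  cont_N₁ : ContinuousOn N₁ (frontier Ω)
  cont_N₂ : ContinuousOn N₂ (frontier Ω)
  increase : ∀ s ∈ frontier Ω, N₂ s ≠ 0 → ∀ C' : ℝ, boundaryCurvature Ω s < C' → ∀ U ∈ 𝓝 s,
    ∃ q ∈ frontier Ω ∩ U, x q < x s ∧ N₁ s - C' * x s < N₁ q - C' * x q

variable {Ω : Set Plane} {p q : Plane}

lemma IsConvexC2Domain.boundaryCoords (hΩ : IsConvexC2Domain Ω) (hp : p ∈ frontier Ω)
    {σ : ℝ} (hσ : σ ^ 2 = 1) :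
    BoundaryCoords Ω p (fun w => σ * inner ℝ (w - p) (boundaryTangent Ω p))
      (fun w => -inner ℝ (w - p) (outwardNormal Ω p))
      (fun w => σ * inner ℝ (outwardNormal Ω w) (boundaryTangent Ω p))
      (fun w => -inner ℝ (outwardNormal Ω w) (outwardNormal Ω p)) := by
  set n := outwardNormal Ω p with hn
  have hn1 : ‖n‖ = 1 := hΩ.norm_outwardNormal hp
  have hτ : boundaryTangent Ω p = rotJ n := rfl
  rw [hτ]
  have key : ∀ a b : Plane, (σ * inner ℝ a (rotJ n)) * (σ * inner ℝ b (rotJ n)) +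
      (-inner ℝ a n) * (-inner ℝ b n) = inner ℝ a b := fun a b => by
    rw [inner_eq_frame hn1 a b]
    linear_combination (inner ℝ a (rotJ n) * inner ℝ b (rotJ n)) * hσ
  have key2 : ∀ a s w : Plane, (σ * inner ℝ a (rotJ n)) *
        (σ * inner ℝ (w - p) (rotJ n) - σ * inner ℝ (s - p) (rotJ n)) +
      (-inner ℝ a n) * (-inner ℝ (w - p) n - -inner ℝ (s - p) n) = inner ℝ a (w - s) := by
    intro a s w
    rw [← key a (w - s)]
    simp only [inner_sub_left]
    ring
  have hσ0 : σ ≠ 0 := by rintro rfl; norm_num at hσ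
  refine ⟨?_, ?_, ?_, by simp, by simp, by simp [← hn], ?_, ?_, ?_, ?_, by fun_prop, by fun_prop,
    ?_, ?_, ?_⟩
  · intro s hs w hw
    rw [key2]; exact hΩ.support hs hw
  · intro s hs w hw h
    rw [key2] at h
    rw [hΩ.outwardNormal_eq_of_inner_eq_zero hs hw h]
  · intro s hs
    have := key (outwardNormal Ω s) (outwardNormal Ω s)
    rw [real_inner_self_eq_norm_sq, hΩ.norm_outwardNormal hs] at this
    linarith
  · simp only [← hn]; rw [real_inner_self_eq_norm_sq, hn1]; norm_num
  · intro w hw t ht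
    refine ⟨p + t • (w - p), hΩ.convex.add_smul_sub_mem (hΩ.isClosed.frontier_subset hp) hw ht,
      ?_, ?_⟩
    · simp only [add_sub_cancel_left, inner_smul_left, conj_trivial]; ring
    · simp only [add_sub_cancel_left, inner_smul_left, conj_trivial]; ring
  · intro a b h1 h2
    have := ext_frame (u := a - p) (v := b - p) hn1 (by linarith) (mul_left_cancel₀ hσ0 h1)
    simpa using this
  · intro a
    rw [dist_eq_norm, ← real_inner_self_eq_norm_sq, ← key (a - p) (a - p)]
    ring
  · exact (hΩ.continuousOn_outwardNormal.inner continuousOn_const).const_mul σ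
  · exact (hΩ.continuousOn_outwardNormal.inner continuousOn_const).neg
  · intro s hs hN C' hκ U hU
    obtain ⟨q, hq, h1, h2⟩ := hΩ.exists_increase hs (u := σ • rotJ n) (C' := C') (by
      rw [inner_smul_right, boundaryTangent, inner_rotJ_rotJ]
      exact mul_ne_zero hσ0 (fun h => hN (by simp [h]))) hκ hU
    simp only [inner_smul_right] at h1 h2
    refine ⟨q, hq, ?_, ?_⟩
    · rw [inner_sub_left, inner_sub_left]; linarith
    · rw [inner_sub_left, inner_sub_left]; linarith

variable {x y N₁ N₂ : Plane → ℝ}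

lemma BoundaryCoords.y_nonneg (h : BoundaryCoords Ω p x y N₁ N₂) (hp : p ∈ frontier Ω)
    {w : Plane} (hw : w ∈ Ω) : 0 ≤ y w := by
  have := h.sup p hp w hw
  rw [h.x_self, h.y_self, h.N₁_self, h.N₂_self] at this
  linarith

/-- A boundary point with `N = (1, 0)` cannot lie in `x ≤ 0`. -/
lemma BoundaryCoords.N₁_eq_neg_one (h : BoundaryCoords Ω p x y N₁ N₂) (hp : p ∈ frontier Ω)
    (hΩ : IsClosed Ω) {s : Plane} (hs : s ∈ frontier Ω) (h2 : N₂ s = 0) (hx : x s ≤ 0) :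
    N₁ s = -1 := by
  have h1 := h.unit s hs
  rw [h2] at h1
  have h3 : (N₁ s - 1) * (N₁ s + 1) = 0 := by linarith
  rcases mul_eq_zero.1 h3 with h4 | h4
  · have h5 : N₁ s = 1 := by linarith
    have h6 := h.sup s hs p (hΩ.frontier_subset hp)
    rw [h5, h2, h.x_self] at h6
    have h7 : x s = 0 := by linarith
    have h8 := h.uniq s hs p hp (by rw [h2, h7, h.x_self]; ring)
    rw [h2, h.N₂_self] at h8
    norm_num at h8
  · linarith

lemma BoundaryCoords.abs_x_le (h : BoundaryCoords Ω p x y N₁ N₂) (a : Plane) :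
    |x a| ≤ dist a p := by
  apply abs_le_of_sq_le_sq _ dist_nonneg
  rw [h.dist_sq]; nlinarith [sq_nonneg (y a)]

lemma BoundaryCoords.abs_y_le (h : BoundaryCoords Ω p x y N₁ N₂) (a : Plane) :
    |y a| ≤ dist a p := by
  apply abs_le_of_sq_le_sq _ dist_nonneg
  rw [h.dist_sq]; nlinarith [sq_nonneg (x a)]

lemma ContinuousOn.eventually_lt_on {f : Plane → ℝ} {S : Set Plane} (hf : ContinuousOn f S)
    {s : Plane} (hs : s ∈ S) {a : ℝ} (ha : f s < a) : {w | w ∈ S → f w < a} ∈ 𝓝 s := by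
  have := (hf s hs).eventually_lt_const ha
  exact eventually_nhdsWithin_iff.1 this

/-- On the side of the boundary on which the normals `N(p)` and `N(q)` make an acute angle, the
normal turns at most by curvature times distance. -/
lemma BoundaryCoords.turning_same (h : BoundaryCoords Ω p x y N₁ N₂) (hΩ : IsClosed Ω)
    (hp : p ∈ frontier Ω) (hq : q ∈ frontier Ω) {C' : ℝ} (hC' : 0 ≤ C')
    (hκ : ∀ s ∈ frontier Ω, dist s p ≤ dist q p → boundaryCurvature Ω s < C')
    (hsmall : C' * dist q p < 1) (hN₂ : N₂ q ≤ 0) (hx : x q ≤ 0) :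
    |N₁ q| ≤ C' * dist q p := by
  have hqΩ := hΩ.frontier_subset hq
  have hpΩ := hΩ.frontier_subset hp
  have hyq : 0 ≤ y q := h.y_nonneg hp hqΩ
  have supqp := h.sup q hq p hpΩ
  rw [h.x_self, h.y_self] at supqp
  rcases hx.lt_or_eq with hx | hx
  swap
  · have hy : y q = 0 := by
      by_contra hne
      have hy : 0 < y q := lt_of_le_of_ne hyq (Ne.symm hne)
      have h0 : N₂ q = 0 := by rw [hx] at supqp; nlinarith
      have := h.uniq q hq p hp (by rw [hx, h0, h.x_self]; ring)
      rw [h0, h.N₂_self] at this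
      norm_num at this
    have : q = p := h.inj q p (by rw [hx, h.x_self]) (by rw [hy, h.y_self])
    rw [this, h.N₁_self]; simp
  -- the boundary arc between `p` and `q`
  set A : Set Plane := {s | s ∈ frontier Ω ∧ x q ≤ x s ∧ x s ≤ 0 ∧ y s ≤ y q ∧ N₂ s ≤ 0} with hA
  have hAball : A ⊆ Metric.closedBall p (dist q p) := by
    rintro s ⟨hs, h1, h2, h3, h4⟩
    rw [Metric.mem_closedBall]
    apply le_of_sq_le_sq _ dist_nonneg
    rw [h.dist_sq, h.dist_sq]
    have := h.y_nonneg hp (hΩ.frontier_subset hs)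
    nlinarith
  have hAclosed : IsClosed A := by
    have h1 : IsClosed (frontier Ω ∩ N₂ ⁻¹' Iic 0) :=
      h.cont_N₂.preimage_isClosed_of_isClosed isClosed_frontier isClosed_Iic
    have h2 : IsClosed {s | x q ≤ x s ∧ x s ≤ 0 ∧ y s ≤ y q} :=
      (isClosed_le continuous_const h.cont_x).inter
        ((isClosed_le h.cont_x continuous_const).inter (isClosed_le h.cont_y continuous_const))
    convert h1.inter h2 using 1
    ext s; simp only [hA, mem_ofPred_eq, mem_inter_iff, mem_preimage, mem_Iic]; tauto
  have hAcomp : IsCompact A :=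
    (isCompact_closedBall p (dist q p)).of_isClosed_subset hAclosed hAball
  have hpA : p ∈ A := ⟨hp, by rw [h.x_self]; exact hx.le, by rw [h.x_self],
    by rw [h.y_self]; exact hyq, by rw [h.N₂_self]; norm_num⟩
  have hAS : A ⊆ frontier Ω := fun s hs => hs.1
  obtain ⟨s, hsA, hmax⟩ := hAcomp.exists_isMaxOn ⟨p, hpA⟩
    (f := fun s => N₁ s - C' * x s)
    ((h.cont_N₁.mono hAS).sub (h.cont_x.continuousOn.const_mul C'))
  have hHs : 0 ≤ N₁ s - C' * x s := by
    have : N₁ p - C' * x p ≤ N₁ s - C' * x s := hmax hpA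
    rw [h.N₁_self, h.x_self] at this
    linarith
  obtain ⟨hs, hs1, hs2, hs3, hs4⟩ := hsA
  have hxq := (abs_le.1 (h.abs_x_le q)).1
  have hN₂s : N₂ s < 0 := by
    refine lt_of_le_of_ne hs4 fun h0 => ?_
    have h1 := h.N₁_eq_neg_one hp hΩ hs h0 hs2
    rw [h1] at hHs
    nlinarith
  have hxs : x s = x q := by
    by_contra hne
    have hlt : x q < x s := lt_of_le_of_ne hs1 (Ne.symm hne)
    have hU : {w | x q < x w} ∩ {w | w ∈ frontier Ω → N₂ w < 0} ∈ 𝓝 s :=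
      inter_mem ((isOpen_lt continuous_const h.cont_x).mem_nhds hlt)
        (h.cont_N₂.eventually_lt_on hs hN₂s)
    obtain ⟨w, ⟨hw, hwx, hwN⟩, h1, h2⟩ := h.increase s hs hN₂s.ne C'
      (hκ s hs (by simpa using hAball ⟨hs, hs1, hs2, hs3, hs4⟩)) _ hU
    have hwN := hwN hw
    have hwx : x q < x w := hwx
    have hwA : w ∈ A := by
      refine ⟨hw, hwx.le, by linarith, ?_, hwN.le⟩
      -- the point of the chord `pq` with the same abscissa lies above `w`
      have ht0 : 0 ≤ x w / x q := div_nonneg_of_nonpos (by linarith) hx.le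
      have ht1 : x w / x q ≤ 1 := by rw [div_le_one_of_neg hx]; exact hwx.le
      obtain ⟨w', hw', e1, e2⟩ := h.chord q hqΩ (x w / x q) ⟨ht0, ht1⟩
      have h3 := h.sup w hw w' hw'
      rw [e1, e2, div_mul_cancel₀ _ hx.ne, sub_self, mul_zero, zero_add] at h3
      have h4 : 0 ≤ x w / x q * y q - y w := nonneg_of_mul_nonpos_right h3 hwN
      nlinarith
    have : N₁ w - C' * x w ≤ N₁ s - C' * x s := hmax hwA
    linarith
  have hys : y s = y q := by
    by_contra hne
    have hlt : y s < y q := lt_of_le_of_ne hs3 hne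
    have h1 := h.sup q hq s (hΩ.frontier_subset hs)
    rw [hxs, sub_self, mul_zero, zero_add] at h1
    have h2 : N₂ q = 0 := by nlinarith
    have h3 := h.uniq q hq s hs (by rw [hxs, h2]; ring)
    linarith
  have hsq : s = q := h.inj s q hxs hys
  rw [hsq] at hHs
  have hN₁ : N₁ q ≤ 0 := by
    by_contra! hpos
    nlinarith [mul_nonneg (neg_nonneg.2 hN₂) hyq, mul_pos hpos (neg_pos.2 hx)]
  rw [abs_of_nonpos hN₁]
  nlinarith [mul_le_mul_of_nonneg_left hxq hC']

/-- Between boundary points `p` and `q` whose normals make an obtuse angle, and on the side to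
which the tangent lines converge, the boundary is a bounded arc separated from the rest by the line
`pq`; hence it is contained in `K` as soon as the components of `∂Ω \ K` are unbounded. -/
lemma BoundaryCoords.mem_of_gap (h : BoundaryCoords Ω p x y N₁ N₂) (hΩ : IsClosed Ω)
    (hp : p ∈ frontier Ω) (hq : q ∈ frontier Ω) {K : Set Plane} (hpK : p ∈ K) (hqK : q ∈ K)
    (hgap : ∀ p ∈ frontier Ω \ K,
      ¬ Bornology.IsBounded (connectedComponentIn (frontier Ω \ K) p))
    (hN₂ : 0 < N₂ q) (hN₁ : N₁ q < 0) {s : Plane} (hs : s ∈ frontier Ω) (hxs : x s ≤ 0)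
    (hN₂s : N₂ s ≤ 0) : s ∈ K := by
  by_contra hsK
  have hqΩ := hΩ.frontier_subset hq
  have hpΩ := hΩ.frontier_subset hp
  have supqp := h.sup q hq p hpΩ
  rw [h.x_self, h.y_self] at supqp
  have hyq : 0 < y q := by
    refine lt_of_le_of_ne (h.y_nonneg hp hqΩ) fun h0 => ?_
    have := h.uniq p hp q hq (by rw [h.N₁_self, h.y_self, ← h0]; ring)
    rw [h.N₂_self] at this
    linarith
  have hqp : 0 < N₁ q * x q + N₂ q * y q := by
    refine lt_of_le_of_ne (by linarith) fun h0 => ?_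
    have := h.uniq q hq p hp (by rw [h.x_self, h.y_self]; linarith)
    rw [h.N₂_self] at this
    linarith
  set g : Plane → ℝ := fun w => x q * y w - y q * x w with hg
  have hgc : Continuous g := by have := h.cont_x; have := h.cont_y; fun_prop
  -- the line `pq` meets the boundary in `p` and `q` only
  have hgne : ∀ w ∈ frontier Ω \ K, g w ≠ 0 := by
    rintro w ⟨hw, hwK⟩ h0
    have hwΩ := hΩ.frontier_subset hw
    set t := y w / y q with ht
    have hyw : y w = t * y q := by rw [ht]; field_simp
    have hxw : x w = t * x q := by
      have : y q * x w = y q * (t * x q) := by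
        simp only [hg] at h0
        rw [hyw] at h0
        linarith
      exact mul_left_cancel₀ hyq.ne' this
    have ht0 : 0 ≤ t := div_nonneg (h.y_nonneg hp hwΩ) hyq.le
    have h1 := h.sup w hw p hpΩ
    have h2 := h.sup w hw q hqΩ
    have h3 := h.sup q hq w hwΩ
    rw [h.x_self, h.y_self, hxw, hyw] at h1
    rw [hxw, hyw] at h2 h3
    have ht0 : 0 < t := by
      refine lt_of_le_of_ne ht0 fun h0 => hwK ?_
      rw [← h0, zero_mul] at hxw hyw
      rwa [h.inj w p (by rw [hxw, h.x_self]) (by rw [hyw, h.y_self])]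
    have ht1 : t ≠ 1 := by
      intro h0
      rw [h0, one_mul] at hxw hyw
      exact hwK (by rwa [h.inj w q hxw hyw])
    rcases ht1.lt_or_gt with ht1 | ht1
    · have e1 : 0 ≤ N₁ w * x q + N₂ w * y q := by nlinarith
      have e2 : N₁ w * x q + N₂ w * y q ≤ 0 := by nlinarith
      have e3 := le_antisymm e2 e1
      have e4 := h.uniq w hw p hp (by
        rw [h.x_self, h.y_self, hxw, hyw]; linear_combination (-t) * e3)
      have e5 := h.uniq w hw q hq (by
        rw [hxw, hyw]; linear_combination (1 - t) * e3)
      rw [h.N₂_self] at e4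
      linarith
    · nlinarith
  have hsd : s ∈ frontier Ω \ K := ⟨hs, hsK⟩
  have hgs : 0 < g s := by
    by_contra! hle
    have hlt : g s < 0 := lt_of_le_of_ne hle (hgne s hsd)
    simp only [hg] at hlt
    have hys := h.y_nonneg hp (hΩ.frontier_subset hs)
    rcases le_or_gt 0 (x q) with hxq | hxq
    · nlinarith [mul_nonneg hxq hys, mul_nonneg hyq.le (neg_nonneg.2 hxs)]
    · set t := x s / x q with ht
      have hxt : x s = t * x q := by rw [ht, div_mul_cancel₀ _ hxq.ne]
      have ht0 : 0 ≤ t := div_nonneg_of_nonpos hxs hxq.le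
      have hyt : t * y q < y s := by
        rw [hxt] at hlt
        have : 0 < (-x q) * (y s - t * y q) := by linarith
        linarith [pos_of_mul_pos_right this (by linarith)]
      rcases le_or_gt t 1 with ht1 | ht1
      · obtain ⟨w, hw, e1, e2⟩ := h.chord q hqΩ t ⟨ht0, ht1⟩
        have h1 := h.sup s hs w hw
        rw [e1, e2, ← hxt, sub_self, mul_zero, zero_add] at h1
        have h2 : N₂ s = 0 := by nlinarith
        have h3 := h.N₁_eq_neg_one hp hΩ hs h2 hxs
        have h4 := h.sup s hs q hqΩ
        rw [h3, h2] at h4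
        have h5 : x q = x s := by nlinarith
        have h6 := h.uniq s hs q hq (by rw [h5, h2]; ring)
        linarith
      · have h1 := h.sup q hq s (hΩ.frontier_subset hs)
        have h2 : x s < x q := by rw [hxt]; nlinarith
        have h3 : y q < y s := by nlinarith
        nlinarith [mul_pos_of_neg_of_neg hN₁ (sub_neg.2 h2), mul_pos hN₂ (sub_pos.2 h3)]
  refine hgap s hsd ?_
  set Y := connectedComponentIn (frontier Ω \ K) s with hY
  have hYsub : Y ⊆ frontier Ω \ K := connectedComponentIn_subset _ _
  have hgY : ∀ w ∈ Y, 0 < g w := by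
    intro w hw
    by_contra! hle
    obtain ⟨w', hw', h0⟩ := isPreconnected_connectedComponentIn.intermediate_value hw
      (mem_connectedComponentIn hsd) hgc.continuousOn ⟨hle, hgs.le⟩
    exact hgne w' (hYsub hw') h0
  set d := dist q p
  have hxd := abs_le.1 (h.abs_x_le q)
  have hyd := abs_le.1 (h.abs_y_le q)
  set X₁ := max d ((N₂ q * y q - N₁ q * d) / (-N₁ q)) with hX₁
  set Y₁ := (N₂ q * y q + (-N₁ q) * (2 * d)) / N₂ q with hY₁
  refine (Metric.isBounded_closedBall (x := p) (r := X₁ + Y₁)).subset fun w hw => ?_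
  have hwΩ := hΩ.frontier_subset (hYsub hw).1
  have hyw := h.y_nonneg hp hwΩ
  have hgw := hgY w hw
  simp only [hg] at hgw
  have hsup := h.sup q hq w hwΩ
  have hx1 : x w ≤ d := by
    rcases le_or_gt (x q) 0 with hxq | hxq
    · nlinarith [mul_nonneg (neg_nonneg.2 hxq) hyw, dist_nonneg (x := q) (y := p)]
    · have e1 : N₂ q * (y q * x w) < N₂ q * (x q * y w) := mul_lt_mul_of_pos_left (by linarith) hN₂
      have e2 : x q * (N₂ q * y w) ≤ x q * (N₂ q * y q - N₁ q * (x w - x q)) :=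
        mul_le_mul_of_nonneg_left (by linarith) hxq.le
      have e3 : (N₁ q * x q + N₂ q * y q) * (x w - x q) < 0 := by nlinarith
      have e4 : x w - x q < 0 := neg_of_mul_neg_right e3 hqp.le
      linarith
  have hx2 : -X₁ ≤ x w := by
    have : -x w ≤ (N₂ q * y q - N₁ q * d) / (-N₁ q) := by
      rw [le_div_iff₀ (by linarith)]
      nlinarith [mul_nonneg hN₂.le hyw]
    linarith [le_max_right d ((N₂ q * y q - N₁ q * d) / (-N₁ q))]
  have hy1 : y w ≤ Y₁ := by
    rw [hY₁, le_div_iff₀ hN₂]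
    nlinarith
  rw [Metric.mem_closedBall]
  have hX0 : |x w| ≤ X₁ := abs_le.2 ⟨hx2, hx1.trans (le_max_left _ _)⟩
  apply le_of_sq_le_sq _ (by linarith [abs_nonneg (x w)])
  rw [h.dist_sq, ← sq_abs (x w)]
  nlinarith [abs_nonneg (x w)]

/-- Boundary points whose normals make an obtuse angle have almost opposite normals: otherwise the
boundary arc joining them on the side to which the tangent lines converge would have to turn by a
definite amount over a short distance. -/
lemma BoundaryCoords.turning_opposite (h : BoundaryCoords Ω p x y N₁ N₂) (hΩ : IsClosed Ω)
    (hp : p ∈ frontier Ω) (hq : q ∈ frontier Ω) {K : Set Plane} (hpK : p ∈ K) (hqK : q ∈ K)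
    (hgap : ∀ p ∈ frontier Ω \ K,
      ¬ Bornology.IsBounded (connectedComponentIn (frontier Ω \ K) p))
    {C' : ℝ} (hC' : 0 ≤ C') (hκ : ∀ s ∈ frontier Ω ∩ K, boundaryCurvature Ω s < C')
    (hN₂ : 0 < N₂ q) {μ : ℝ} (hμ : N₁ q = -μ) (hμ0 : 0 < μ) :
    μ ≤ C' * dist q p * (μ + 1) := by
  by_contra! hsmall
  have hqΩ := hΩ.frontier_subset hq
  have hN₁ : N₁ q < 0 := by linarith
  set d := dist q p
  have hd : 0 ≤ d := dist_nonneg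
  have hxd := abs_le.1 (h.abs_x_le q)
  have hyd := abs_le.1 (h.abs_y_le q)
  have hN₂1 : N₂ q ≤ 1 := by nlinarith [h.unit q hq]
  set A : Set Plane := {s | s ∈ frontier Ω ∧ x s ≤ 0 ∧ N₂ s ≤ 0} with hA
  have hAS : A ⊆ frontier Ω := fun s hs => hs.1
  have hAK : A ⊆ K := fun s hs => h.mem_of_gap hΩ hp hq hpK hqK hgap hN₂ hN₁ hs.1 hs.2.1 hs.2.2
  have hAx : ∀ s ∈ A, μ * (-x s) ≤ d * (μ + 1) := by
    intro s hs
    have h1 := h.sup q hq s (hΩ.frontier_subset hs.1)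
    have h2 := h.y_nonneg hp (hΩ.frontier_subset hs.1)
    rw [hμ] at h1
    have h3 : N₂ q * y q ≤ d := by nlinarith [h.y_nonneg hp hqΩ]
    nlinarith [mul_nonneg hN₂.le h2]
  have hAbdd : Bornology.IsBounded A := by
    set X₁ := d * (μ + 1) / μ
    set Y₁ := (N₂ q * y q + μ * d) / N₂ q with hY₁
    refine (Metric.isBounded_closedBall (x := p) (r := X₁ + Y₁)).subset fun s hs => ?_
    have h1 := h.sup q hq s (hΩ.frontier_subset hs.1)
    have h2 := h.y_nonneg hp (hΩ.frontier_subset hs.1)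
    have h3 : -x s ≤ X₁ := by rw [le_div_iff₀ hμ0]; linarith [hAx s hs]
    have h4 : |x s| ≤ X₁ := by rw [abs_of_nonpos hs.2.1]; exact h3
    have h5 : y s ≤ Y₁ := by
      rw [hY₁, le_div_iff₀ hN₂]
      rw [hμ] at h1
      nlinarith [hs.2.1]
    rw [Metric.mem_closedBall]
    apply le_of_sq_le_sq _ (by linarith [abs_nonneg (x s)])
    rw [h.dist_sq, ← sq_abs (x s)]
    nlinarith [abs_nonneg (x s)]
  have hAclosed : IsClosed A := by
    have h1 : IsClosed (frontier Ω ∩ N₂ ⁻¹' Iic 0) :=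
      h.cont_N₂.preimage_isClosed_of_isClosed isClosed_frontier isClosed_Iic
    have h2 : IsClosed {s | x s ≤ 0} := isClosed_le h.cont_x continuous_const
    convert h1.inter h2 using 1
    ext s; simp only [hA, mem_ofPred_eq, mem_inter_iff, mem_preimage, mem_Iic]; tauto
  have hAcomp : IsCompact A := Metric.isCompact_of_isClosed_isBounded hAclosed hAbdd
  have hpA : p ∈ A := ⟨hp, by rw [h.x_self], by rw [h.N₂_self]; norm_num⟩
  obtain ⟨s, hsA, hmax⟩ := hAcomp.exists_isMaxOn ⟨p, hpA⟩
    (f := fun s => N₁ s - C' * x s)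
    ((h.cont_N₁.mono hAS).sub (h.cont_x.continuousOn.const_mul C'))
  -- at every point of `A` with `N₂ < 0` the function can still be increased
  have hinc : ∀ s ∈ A, N₂ s < 0 → ∃ w ∈ A, N₁ s - C' * x s < N₁ w - C' * x w := by
    intro s hs hneg
    obtain ⟨w, ⟨hw, hwN⟩, h1, h2⟩ := h.increase s hs.1 hneg.ne C' (hκ s ⟨hs.1, hAK hs⟩) _
      (h.cont_N₂.eventually_lt_on hs.1 hneg)
    exact ⟨w, ⟨hw, h1.le.trans hs.2.1, (hwN hw).le⟩, h2⟩
  have hpos : 0 < N₁ s - C' * x s := by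
    obtain ⟨w, hw, h1⟩ := hinc p hpA (by rw [h.N₂_self]; norm_num)
    have h2 : N₁ w - C' * x w ≤ N₁ s - C' * x s := hmax hw
    rw [h.N₁_self, h.x_self] at h1
    linarith
  have hN₂s : N₂ s = 0 := by
    by_contra hne
    obtain ⟨w, hw, h1⟩ := hinc s hsA (lt_of_le_of_ne hsA.2.2 hne)
    have h2 : N₁ w - C' * x w ≤ N₁ s - C' * x s := hmax hw
    linarith
  rw [h.N₁_eq_neg_one hp hΩ hsA.1 hN₂s hsA.2.1] at hpos
  have h1 := hAx s hsA
  have h2 : μ * 1 < μ * (C' * (-x s)) := mul_lt_mul_of_pos_left (by linarith) hμ0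
  nlinarith [mul_le_mul_of_nonneg_left h1 hC']

/-- Nearby boundary points have almost parallel normals (pointing in the same or in opposite
directions). -/
lemma IsConvexC2Domain.abs_inner_normal_tangent_le (hΩ : IsConvexC2Domain Ω)
    (hp : p ∈ frontier Ω) (hq : q ∈ frontier Ω) {K : Set Plane} (hpK : p ∈ K) (hqK : q ∈ K)
    (hgap : ∀ p ∈ frontier Ω \ K,
      ¬ Bornology.IsBounded (connectedComponentIn (frontier Ω \ K) p))
    {C' : ℝ} (hC' : 0 ≤ C') (hκ : ∀ s ∈ frontier Ω ∩ K, boundaryCurvature Ω s < C')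
    (hball : ∀ s ∈ frontier Ω, dist s p ≤ dist q p → s ∈ K)
    (hsmall : C' * dist q p ≤ 1 / 4) :
    |inner ℝ (outwardNormal Ω q) (boundaryTangent Ω p)| ≤ 4 / 3 * (C' * dist q p) := by
  obtain ⟨σ, hσ, hσx, hσN⟩ : ∃ σ : ℝ, σ ^ 2 = 1 ∧
      (inner ℝ (outwardNormal Ω q) (outwardNormal Ω p) < 0 →
        σ * inner ℝ (outwardNormal Ω q) (boundaryTangent Ω p) ≤ 0) ∧
      (0 ≤ inner ℝ (outwardNormal Ω q) (outwardNormal Ω p) →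
        σ * inner ℝ (q - p) (boundaryTangent Ω p) ≤ 0) := by
    by_cases h : inner ℝ (outwardNormal Ω q) (outwardNormal Ω p) < 0
    · rcases le_total (inner ℝ (outwardNormal Ω q) (boundaryTangent Ω p)) 0 with h1 | h1
      · exact ⟨1, by norm_num, fun _ => by linarith, fun h' => by linarith⟩
      · exact ⟨-1, by norm_num, fun _ => by linarith, fun h' => by linarith⟩
    · rcases le_total (inner ℝ (q - p) (boundaryTangent Ω p)) 0 with h1 | h1
      · exact ⟨1, by norm_num, fun h' => absurd h' h, fun _ => by linarith⟩
      · exact ⟨-1, by norm_num, fun h' => absurd h' h, fun _ => by linarith⟩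
  have hc := hΩ.boundaryCoords hp hσ
  have hσabs : |σ| = 1 := by
    rw [← sq_eq_sq₀ (abs_nonneg _) zero_le_one, sq_abs, hσ]; norm_num
  have hd : 0 ≤ C' * dist q p := mul_nonneg hC' dist_nonneg
  rcases lt_or_ge (inner ℝ (outwardNormal Ω q) (outwardNormal Ω p)) 0 with h | h
  · have h1 := hσx h
    rcases h1.lt_or_eq with h2 | h2
    · have h3 := hc.turning_opposite hΩ.isClosed hp hq hpK hqK hgap hC' hκ (by simpa using h)
        (μ := -(σ * inner ℝ (outwardNormal Ω q) (boundaryTangent Ω p))) (by simp) (by linarith)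
      have h4 : |inner ℝ (outwardNormal Ω q) (boundaryTangent Ω p)| =
          -(σ * inner ℝ (outwardNormal Ω q) (boundaryTangent Ω p)) := by
        rw [← abs_of_neg h2, abs_mul, hσabs, one_mul]
      rw [← h4] at h3
      nlinarith [abs_nonneg (inner ℝ (outwardNormal Ω q) (boundaryTangent Ω p))]
    · have : inner ℝ (outwardNormal Ω q) (boundaryTangent Ω p) = 0 := by
        rcases mul_eq_zero.1 h2 with h3 | h3
        · rw [h3] at hσ; norm_num at hσ
        · exact h3
      rw [this, abs_zero]; linarith
  · have h1 := hc.turning_same hΩ.isClosed hp hq hC'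
      (fun s hs hd => hκ s ⟨hs, hball s hs hd⟩) (by linarith) (by simpa using h) (hσN h)
    rw [abs_mul, hσabs, one_mul] at h1
    linarith

end Coordinates

/-! ### The comparison function -/

section Model

/-- The comparison function `φ(s) = c (sin((π - ε) s + ε/2) - sin(ε/2))` on `[0,1]`. -/
noncomputable def model (c ε s : ℝ) : ℝ :=
  c * (Real.sin ((Real.pi - ε) * s + ε / 2) - Real.sin (ε / 2))

/-- The derivative of the comparison function. -/
noncomputable def model' (c ε s : ℝ) : ℝ :=
  c * ((Real.pi - ε) * Real.cos ((Real.pi - ε) * s + ε / 2))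

/-- The second derivative of the comparison function. -/
noncomputable def model'' (c ε s : ℝ) : ℝ :=
  -(c * ((Real.pi - ε) ^ 2 * Real.sin ((Real.pi - ε) * s + ε / 2)))

variable {c ε s : ℝ}

lemma hasDerivAt_model (c ε s : ℝ) : HasDerivAt (model c ε) (model' c ε s) s := by
  have h1 : HasDerivAt (fun s => (Real.pi - ε) * s + ε / 2) (Real.pi - ε) s := by
    simpa using ((hasDerivAt_id s).const_mul (Real.pi - ε)).add_const (ε / 2)
  have := (h1.sin.sub_const (Real.sin (ε / 2))).const_mul c
  refine this.congr_deriv ?_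
  rw [model']; ring

lemma hasDerivAt_model' (c ε s : ℝ) : HasDerivAt (model' c ε) (model'' c ε s) s := by
  have h1 : HasDerivAt (fun s => (Real.pi - ε) * s + ε / 2) (Real.pi - ε) s := by
    simpa using ((hasDerivAt_id s).const_mul (Real.pi - ε)).add_const (ε / 2)
  have := (h1.cos.const_mul (Real.pi - ε)).const_mul c
  refine this.congr_deriv ?_
  rw [model'']; ring

lemma continuous_model (c ε : ℝ) : Continuous (model c ε) :=
  continuous_iff_continuousAt.2 fun s => (hasDerivAt_model c ε s).continuousAt

lemma model_zero (c ε : ℝ) : model c ε 0 = 0 := by simp [model]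

lemma model_symm (c ε s : ℝ) : model c ε (1 - s) = model c ε s := by
  rw [model, model, show (Real.pi - ε) * (1 - s) + ε / 2 =
    Real.pi - ((Real.pi - ε) * s + ε / 2) by ring, Real.sin_pi_sub]

lemma model'_symm (c ε s : ℝ) : model' c ε (1 - s) = -model' c ε s := by
  rw [model', model', show (Real.pi - ε) * (1 - s) + ε / 2 =
    Real.pi - ((Real.pi - ε) * s + ε / 2) by ring, Real.cos_pi_sub]
  ring

lemma model''_symm (c ε s : ℝ) : model'' c ε (1 - s) = model'' c ε s := by
  rw [model'', model'', show (Real.pi - ε) * (1 - s) + ε / 2 =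
    Real.pi - ((Real.pi - ε) * s + ε / 2) by ring, Real.sin_pi_sub]

lemma model_one (c ε : ℝ) : model c ε 1 = 0 := by
  have := model_symm c ε 0
  rwa [sub_zero, model_zero] at this

/-- The slope is at most `c π`, and `π / 100 < 63 / 2000`. -/
lemma abs_model'_le (hε : ε ∈ Ioo (0 : ℝ) (1 / 10)) (hc : c ∈ Ioo (0 : ℝ) (1 / 100)) :
    |model' c ε s| ≤ 63 / 2000 := by
  obtain ⟨he0, he1⟩ := hε
  obtain ⟨hc0, hc1⟩ := hc
  have hpi := Real.pi_lt_d2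
  have hpi' := Real.pi_gt_d2
  rw [model', abs_mul, abs_mul, abs_of_pos hc0, abs_of_pos (by linarith : 0 < Real.pi - ε)]
  have h1 := Real.abs_cos_le_one ((Real.pi - ε) * s + ε / 2)
  have h2 : (Real.pi - ε) * |Real.cos ((Real.pi - ε) * s + ε / 2)| ≤ 3.15 * 1 := by
    apply mul_le_mul _ h1 (abs_nonneg _) (by norm_num)
    linarith
  calc c * ((Real.pi - ε) * |Real.cos ((Real.pi - ε) * s + ε / 2)|) ≤ (1 / 100) * (3.15 * 1) := by
        have : 0 ≤ (Real.pi - ε) * |Real.cos ((Real.pi - ε) * s + ε / 2)| :=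
          mul_nonneg (by linarith) (abs_nonneg _)
        gcongr
    _ = _ := by norm_num

lemma model_le_mul (hε : ε ∈ Ioo (0 : ℝ) (1 / 10)) (hc : c ∈ Ioo (0 : ℝ) (1 / 100))
    (hs : 0 ≤ s) : model c ε s ≤ 63 / 2000 * s := by
  have h := Convex.norm_image_sub_le_of_norm_hasDerivWithin_le (f := model c ε) (s := univ)
    (x := 0) (y := s) (C := 63 / 2000)
    (fun x _ => (hasDerivAt_model c ε x).hasDerivWithinAt) (fun x _ => abs_model'_le hε hc)
    convex_univ (mem_univ _) (mem_univ _)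
  rw [model_zero, sub_zero, sub_zero, Real.norm_eq_abs, Real.norm_eq_abs, abs_of_nonneg hs] at h
  exact (le_abs_self _).trans h

lemma model_le_mul' (hε : ε ∈ Ioo (0 : ℝ) (1 / 10)) (hc : c ∈ Ioo (0 : ℝ) (1 / 100))
    (hs : s ≤ 1) : model c ε s ≤ 63 / 2000 * (1 - s) := by
  rw [← model_symm]; exact model_le_mul hε hc (by linarith)

/-- Strict concavity of the comparison function, tested against the endpoint `0`. -/
lemma model_sub_pos (hε : ε ∈ Ioo (0 : ℝ) (1 / 10)) (hc : 0 < c) (hs0 : 0 < s) (hs1 : s ≤ 1) :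
    0 < model c ε s - s * model' c ε s := by
  obtain ⟨he0, he1⟩ := hε
  have hpi := Real.pi_gt_three
  obtain ⟨ξ, ⟨h1, h2⟩, h3⟩ := exists_hasDerivAt_eq_slope (model c ε) (model' c ε) hs0
    (continuous_model c ε).continuousOn (fun x _ => hasDerivAt_model c ε x)
  rw [model_zero, sub_zero, sub_zero, eq_div_iff hs0.ne'] at h3
  rw [← h3]
  have h4 : model' c ε s < model' c ε ξ := by
    rw [model', model']
    have : Real.cos ((Real.pi - ε) * s + ε / 2) < Real.cos ((Real.pi - ε) * ξ + ε / 2) := by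
      apply Real.cos_lt_cos_of_nonneg_of_le_pi
      · have : 0 ≤ (Real.pi - ε) * ξ := mul_nonneg (by linarith) h1.le
        linarith
      · nlinarith
      · nlinarith
    have h6 : 0 < Real.pi - ε := by linarith
    gcongr
  nlinarith

lemma model_add_pos (hε : ε ∈ Ioo (0 : ℝ) (1 / 10)) (hc : 0 < c) (hs0 : 0 ≤ s) (hs1 : s < 1) :
    0 < model c ε s + (1 - s) * model' c ε s := by
  have := model_sub_pos hε hc (s := 1 - s) (by linarith) (by linarith)
  rw [model_symm, model'_symm] at this
  linarith

lemma model_pos (hε : ε ∈ Ioo (0 : ℝ) (1 / 10)) (hc : 0 < c) (hs0 : 0 < s) (hs1 : s < 1) :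
    0 < model c ε s := by
  have h1 := model_sub_pos hε hc hs0 hs1.le
  have h2 := model_add_pos hε hc hs0.le hs1
  nlinarith

lemma model'_nonneg (hε : ε ∈ Ioo (0 : ℝ) (1 / 10)) (hc : 0 < c) (hs0 : 0 ≤ s)
    (hs1 : s ≤ 1 / 2) : 0 ≤ model' c ε s := by
  obtain ⟨he0, he1⟩ := hε
  have hpi := Real.pi_gt_three
  have : 0 ≤ Real.cos ((Real.pi - ε) * s + ε / 2) := by
    apply Real.cos_nonneg_of_neg_pi_div_two_le_of_le
    · have : 0 ≤ (Real.pi - ε) * s := mul_nonneg (by linarith) hs0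
      linarith
    · nlinarith
  rw [model']
  have : 0 ≤ Real.pi - ε := by linarith
  positivity

/-- The comparison function in terms of the angle `x = (π - ε)(1/2 - s)` measured from the middle
of the interval, together with the elementary bounds used below. -/
lemma model_angle (c : ℝ) (hε : ε ∈ Ioo (0 : ℝ) (1 / 10)) (hs : s ∈ Ioo (0 : ℝ) 1) :
    ∃ x C S σ : ℝ, x = (Real.pi - ε) * (1 / 2 - s) ∧ model c ε s = c * (C - σ) ∧
      model' c ε s = c * ((Real.pi - ε) * S) ∧ model'' c ε s = -(c * ((Real.pi - ε) ^ 2 * C)) ∧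
      1 - x ^ 2 / 2 ≤ C ∧ C ≤ 1 ∧ 0 ≤ C ∧ 63 / 100 * x ^ 2 ≤ x * S ∧ |S| ≤ |x| ∧ 0 < σ ∧
      σ ≤ ε / 2 := by
  obtain ⟨he0, he1⟩ := hε
  obtain ⟨hs0, hs1⟩ := hs
  have hpi := Real.pi_gt_three
  have hpi2 := Real.pi_lt_d2
  set x := (Real.pi - ε) * (1 / 2 - s) with hx
  have hθ : (Real.pi - ε) * s + ε / 2 = Real.pi / 2 - x := by rw [hx]; ring
  have hxa : |x| ≤ Real.pi / 2 := by
    rw [abs_le]; constructor <;> rw [hx] <;> nlinarith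
  refine ⟨x, Real.cos x, Real.sin x, Real.sin (ε / 2), rfl, ?_, ?_, ?_,
    Real.one_sub_sq_div_two_le_cos, Real.cos_le_one x,
    Real.cos_nonneg_of_neg_pi_div_two_le_of_le (abs_le.1 hxa).1 (abs_le.1 hxa).2, ?_,
    Real.abs_sin_le_abs, Real.sin_pos_of_pos_of_lt_pi (by linarith) (by linarith),
    Real.sin_le (by linarith)⟩
  · rw [model, hθ, Real.sin_pi_div_two_sub]
  · rw [model', hθ, Real.cos_pi_div_two_sub]
  · rw [model'', hθ, Real.sin_pi_div_two_sub]
  · have h1 := Real.mul_le_sin (abs_nonneg x) hxa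
    have h2 : x * Real.sin x = |x| * Real.sin |x| := by
      rcases abs_cases x with ⟨h, _⟩ | ⟨h, _⟩ <;> rw [h]
      rw [Real.sin_neg]; ring
    rw [h2, ← sq_abs]
    have h3 : 63 / 100 ≤ 2 / Real.pi := by
      rw [le_div_iff₀ Real.pi_pos]; linarith
    have h4 : 63 / 100 * |x| ≤ Real.sin |x| :=
      (mul_le_mul_of_nonneg_right h3 (abs_nonneg x)).trans h1
    nlinarith [mul_le_mul_of_nonneg_left h4 (abs_nonneg x)]

/-- The numerical inequality behind the case of a direct chord; `15` stands for a lower bound of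
length times energy of the arc between the endpoints of the chord. -/
lemma model_interior_ineq (hε : ε ∈ Ioo (0 : ℝ) (1 / 10)) (hc : c ∈ Ioo (0 : ℝ) (1 / 100))
    (hs0 : 0 < s) (hs1 : s ≤ 1 / 2) :
    0 < 15 * (2 * model c ε s + (1 - 2 * s) * model' c ε s) + 4 * model'' c ε s * s := by
  have hφ := model_pos hε hc.1 hs0 (by linarith)
  have hφ' := model'_nonneg hε hc.1 hs0.le hs1
  obtain ⟨x, C, S, σ, hx, h1, h2, h3, h4, h5, h6, h7, h8, h9, h10⟩ :=
    model_angle c hε ⟨hs0, by linarith⟩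
  obtain ⟨he0, he1⟩ := hε
  have hpi := Real.pi_lt_d2
  have hpi' := Real.pi_gt_three
  have hm : (Real.pi - ε) ^ 2 ≤ 9.93 := by nlinarith
  have h11 : (1 - 2 * s) * model' c ε s = c * (2 * (x * S)) := by rw [h2, hx]; ring
  rw [h11, h1, h3]
  have h12 : (Real.pi - ε) ^ 2 * C * s ≤ 9.93 * C * (1 / 2) := by gcongr
  have h13 : 0 < 15 * (2 * (C - σ) + 2 * (x * S)) - 4 * ((Real.pi - ε) ^ 2 * C * s) := by
    nlinarith [sq_nonneg x]
  have := mul_pos hc.1 h13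
  nlinarith

lemma model_split (hs : s ∈ Ioo (0 : ℝ) 1) (φ φ' : ℝ) :
    (φ + (1 - s) * φ') / s + (φ - s * φ') / (1 - s) =
      (φ + (1 - 2 * s) * φ') / (s * (1 - s)) := by
  have h1 : s ≠ 0 := hs.1.ne'
  have h2 : 1 - s ≠ 0 := by linarith [hs.2]
  field_simp
  ring

/-- The numerical inequality behind the reflected case when the normals of the boundary at the two
endpoints of the curve are nearly opposite.  The constants are lower bounds for length times energy:
`147 / 10` on the side of the reflection point, and the square of an angle close to `π` on the other
side. -/
lemma model_opposite_ineq (hε : ε ∈ Ioo (0 : ℝ) (1 / 10)) (hc : c ∈ Ioo (0 : ℝ) (1 / 100))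
    (hs : s ∈ Ioo (0 : ℝ) 1) :
    0 < 147 / 10 * ((model c ε s + (1 - s) * model' c ε s) / s) +
      92 / 10 * ((model c ε s - s * model' c ε s) / (1 - s)) + 4 * model'' c ε s := by
  have hu := model_add_pos hε hc.1 hs.1.le hs.2
  have hφ := model_pos hε hc.1 hs.1 hs.2
  have hsplit := model_split hs (model c ε s) (model' c ε s)
  obtain ⟨x, C, S, σ, hx, h1, h2, h3, h4, h5, h6, h7, h8, h9, h10⟩ :=
    model_angle c hε hs
  obtain ⟨he0, he1⟩ := hε
  obtain ⟨hs0, hs1⟩ := hs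
  obtain ⟨hc0, hc1⟩ := hc
  have hpi := Real.pi_lt_d4
  have hpi' := Real.pi_gt_d2
  have hm : (Real.pi - ε) ^ 2 ≤ 9.87 := by nlinarith only [hpi, hpi', he0, he1]
  have h11 : (1 - 2 * s) * model' c ε s = c * (2 * (x * S)) := by rw [h2, hx]; ring
  set U := (model c ε s + (1 - s) * model' c ε s) / s with hU
  set V := (model c ε s - s * model' c ε s) / (1 - s) with hV
  have hU0 : 0 < U := div_pos hu hs0
  have hss : 0 < s * (1 - s) := mul_pos hs0 (by linarith)
  have hUV : c * (4 * (C - σ + 2 * (x * S))) ≤ U + V := by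
    rw [hsplit, h11, h1, le_div_iff₀ hss]
    have e1 : 0 ≤ C - σ + 2 * (x * S) := by linarith [sq_nonneg x]
    have e2 : 4 * (s * (1 - s)) ≤ 1 := by linarith [sq_nonneg (2 * s - 1)]
    have := mul_le_mul_of_nonneg_left e2 (mul_nonneg hc0.le e1)
    linarith
  have hmain : 0 < 92 / 10 * (U + V) + 55 / 10 * U - 4 * (c * (9.87 * C)) := by
    rcases le_or_gt 0 x with hx0 | hx0
    · have hs2 : s ≤ 1 / 2 := by
        by_contra! h
        have : x < 0 := by rw [hx]; nlinarith only [h, he1, hpi']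
        linarith
      have hUl : c * (2 * (C - σ)) ≤ U := by
        rw [hU, le_div_iff₀ hs0]
        have hS : 0 ≤ S := by
          by_contra! hneg
          rcases hx0.eq_or_lt with h0 | h0
          · rw [← h0, abs_zero] at h8
            linarith [abs_nonpos_iff.1 h8]
          · linarith [mul_neg_of_pos_of_neg h0 hneg, sq_nonneg x]
        have hp : 0 ≤ model' c ε s := by
          rw [h2]; exact mul_nonneg hc0.le (mul_nonneg (by linarith) hS)
        rw [h1] at hφ ⊢
        have f1 := mul_nonneg (by linarith : (0 : ℝ) ≤ 1 - s) hp
        have f2 := mul_nonneg hφ.le (by linarith : (0 : ℝ) ≤ 1 - 2 * s)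
        linarith
      have : 0 < 92 / 10 * (4 * (C - σ + 2 * (x * S))) + 55 / 10 * (2 * (C - σ)) -
          4 * (9.87 * C) := by linarith [sq_nonneg x]
      linarith [mul_pos hc0 this]
    · rcases le_or_gt x (-8 / 25) with hx1 | hx1
      · have hx2 : 64 / 625 ≤ x ^ 2 := by nlinarith only [hx1]
        have : 0 < 92 / 10 * (4 * (C - σ + 2 * (x * S))) - 4 * (9.87 * C) := by linarith
        linarith [mul_pos hc0 this, mul_nonneg (show (0:ℝ) ≤ 55 / 10 by norm_num) hU0.le]
      · have hSx : x ≤ S := by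
          rw [abs_of_neg hx0] at h8
          linarith [(abs_le.1 h8).1]
        have hm3 : 3 ≤ Real.pi - ε := by linarith
        have hs2 : 1 / 2 < s := by
          by_contra! h
          have : 0 ≤ x := by rw [hx]; exact mul_nonneg (by linarith) (by linarith)
          linarith
        have hs3 : s ≤ 61 / 100 := by
          by_contra! h
          nlinarith only [h, hm3, hx, hx1]
        have hUl : c * ((1 - x ^ 2 / 2 - 1 / 20 + 1.58 * x) * (100 / 61)) ≤ U := by
          rw [hU, le_div_iff₀ hs0]
          rw [h1, h2]
          have e1 : (1 - s) * (c * ((Real.pi - ε) * S)) ≥ c * (1.58 * x) := by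
            have : (1 - s) * ((Real.pi - ε) * S) ≥ 1.58 * x := by
              have f1 : (1 - s) * (Real.pi - ε) ≤ 1.58 := by nlinarith only [hs2, hpi, he0, hm3]
              have f2 : 0 ≤ (1 - s) * (Real.pi - ε) :=
                mul_nonneg (by linarith) (by linarith)
              nlinarith only [f1, f2, hSx, hx0]
            linarith [mul_le_mul_of_nonneg_left this hc0.le]
          have e2 : c * (1 - x ^ 2 / 2 - 1 / 20) ≤ c * (C - σ) := by
            apply mul_le_mul_of_nonneg_left _ hc0.le
            linarith
          have e3 : 0 ≤ 1 - x ^ 2 / 2 - 1 / 20 + 1.58 * x := by nlinarith only [hx0, hx1]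
          have e4 : (1 - x ^ 2 / 2 - 1 / 20 + 1.58 * x) * (100 / 61) * s ≤
              1 - x ^ 2 / 2 - 1 / 20 + 1.58 * x := by
            linarith [mul_nonneg e3 (sub_nonneg.2 hs3)]
          linarith [mul_le_mul_of_nonneg_left e4 hc0.le]
        have : 0 < 92 / 10 * (4 * (C - σ + 2 * (x * S))) +
            55 / 10 * ((1 - x ^ 2 / 2 - 1 / 20 + 1.58 * x) * (100 / 61)) - 4 * (9.87 * C) := by
          have f1 : 0 ≤ x ^ 2 + 0.34 * x + 0.0289 := by
            have := sq_nonneg (x + 0.17)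
            linarith
          linarith
        linarith [mul_pos hc0 this]
  rw [h3]
  have h14 : c * ((Real.pi - ε) ^ 2 * C) ≤ c * (9.87 * C) := by gcongr
  linarith

/-- The numerical inequality behind the reflected case when the normals of the boundary at the two
endpoints of the curve are nearly equal.  Here `π + ν - 2ρ` and `π - ν - 2ρ` are lower bounds for the
turning angles on the two sides.  For `ε = 0` and `s = 1/2` it is an equality; this is the
place where the room provided by `ε` is used. -/
lemma model_same_ineq (hε : ε ∈ Ioo (0 : ℝ) (1 / 10)) (hc : c ∈ Ioo (0 : ℝ) (1 / 100))
    (hs : s ∈ Ioo (0 : ℝ) 1) {ν ρ : ℝ} (hν : |ν| ≤ Real.pi * |model' c ε s|) (hρ0 : 0 ≤ ρ)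
    (hρ : ρ ≤ ε / 200) :
    0 < (Real.pi + ν - 2 * ρ) ^ 2 * ((model c ε s + (1 - s) * model' c ε s) / s) +
      (Real.pi - ν - 2 * ρ) ^ 2 * ((model c ε s - s * model' c ε s) / (1 - s)) +
      4 * model'' c ε s := by
  have hu := model_add_pos hε hc.1 hs.1.le hs.2
  have hv := model_sub_pos hε hc.1 hs.1 hs.2.le
  have hφ := model_pos hε hc.1 hs.1 hs.2
  have hsplit := model_split hs (model c ε s) (model' c ε s)
  obtain ⟨x, C, S, σ, hx, h1, h2, h3, h4, h5, h6, h7, h8, h9, h10⟩ :=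
    model_angle c hε hs
  obtain ⟨he0, he1⟩ := hε
  obtain ⟨hs0, hs1⟩ := hs
  obtain ⟨hc0, hc1⟩ := hc
  have hpi := Real.pi_lt_d4
  have hpi' := Real.pi_gt_d4
  set m := Real.pi - ε with hm
  have hm0 : 0 < m := by linarith
  set φ := model c ε s
  set φ' := model' c ε s
  set U := (φ + (1 - s) * φ') / s with hU
  set V := (φ - s * φ') / (1 - s) with hV
  have hU0 : 0 < U := div_pos hu hs0
  have hV0 : 0 < V := div_pos hv (by linarith)
  have h11 : (1 - 2 * s) * φ' = c * (2 * (x * S)) := by rw [h2, hx]; ring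
  have hss : 0 < s * (1 - s) := mul_pos hs0 (by linarith)
  set q := 1 - 2 * s with hq
  have hxq : x = m * q / 2 := by rw [hx, hq]; ring
  have hq1 : |q| ≤ 1 := abs_le.2 ⟨by linarith, by linarith⟩
  have hφc : φ ≤ c := by rw [h1]; nlinarith only [hc0, h5, h9]
  -- the difference of the two weights
  have hdiff : U - V = (φ * q + φ' * ((1 + q ^ 2) / 2)) / (s * (1 - s)) := by
    have e1 : 1 - s ≠ 0 := by linarith
    rw [hU, hV, hq]
    field_simp
    ring
  have hφ'q : |φ'| ≤ 5 * c * |q| := by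
    rw [h2, abs_mul, abs_mul, abs_of_pos hc0, abs_of_pos hm0]
    have e1 : |x| = m * |q| / 2 := by
      rw [hxq, abs_div, abs_mul, abs_of_pos hm0]; norm_num
    have e2 : m * m ≤ 10 := by nlinarith only [hm0, hm, hpi, he0]
    have e3 : m * |S| ≤ m * (m * |q| / 2) := by rw [← e1]; gcongr
    have e4 : m * (m * |q| / 2) ≤ 5 * |q| := by nlinarith only [abs_nonneg q, e2]
    calc c * (m * |S|) ≤ c * (5 * |q|) := mul_le_mul_of_nonneg_left (e3.trans e4) hc0.le
      _ = _ := by ring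
  have hprod : |φ'| * |q| = φ' * q := by
    rw [← abs_mul, abs_of_nonneg]
    rw [mul_comm, h11]
    have : 0 ≤ x * S := by linarith [sq_nonneg x]
    positivity
  have hdabs : |U - V| ≤ (6 * c * |q|) / (s * (1 - s)) := by
    rw [hdiff, abs_div, abs_of_pos hss]
    gcongr
    calc |φ * q + φ' * ((1 + q ^ 2) / 2)| ≤ |φ * q| + |φ' * ((1 + q ^ 2) / 2)| := abs_add_le _ _
      _ = φ * |q| + |φ'| * ((1 + q ^ 2) / 2) := by
        rw [abs_mul, abs_mul, abs_of_pos hφ, abs_of_nonneg (by positivity : 0 ≤ (1 + q ^ 2) / 2)]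
      _ ≤ c * |q| + (5 * c * |q|) * 1 := by
        have : q ^ 2 ≤ 1 := by rw [← sq_abs]; nlinarith only [abs_nonneg q, hq1]
        gcongr
        linarith
      _ = _ := by ring
  set P := Real.pi - 2 * ρ with hP
  have hP0 : 3.1 ≤ P := by linarith
  have hP1 : P ≤ 3.15 := by linarith
  have hexp : P ^ 2 * (U + V) - 2 * P * (|ν| * |U - V|) ≤
      (Real.pi + ν - 2 * ρ) ^ 2 * U + (Real.pi - ν - 2 * ρ) ^ 2 * V := by
    have e1 : (Real.pi + ν - 2 * ρ) ^ 2 * U + (Real.pi - ν - 2 * ρ) ^ 2 * V =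
        P ^ 2 * (U + V) + 2 * P * (ν * (U - V)) + ν ^ 2 * (U + V) := by rw [hP]; ring
    have e2 : -(|ν| * |U - V|) ≤ ν * (U - V) := by rw [← abs_mul]; exact neg_abs_le _
    have e3 : 0 ≤ ν ^ 2 * (U + V) := by positivity
    rw [e1]
    have e4 := mul_le_mul_of_nonneg_left e2 (by linarith : 0 ≤ 2 * P)
    linarith
  have hnuUV : |ν| * |U - V| ≤ (1 / 5 * (φ' * q)) / (s * (1 - s)) := by
    calc |ν| * |U - V| ≤ (Real.pi * |φ'|) * ((6 * c * |q|) / (s * (1 - s))) := by gcongr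
      _ = (Real.pi * 6 * c * (|φ'| * |q|)) / (s * (1 - s)) := by ring
      _ ≤ _ := by
        rw [hprod]
        have e1 : 0 ≤ φ' * q := by rw [← hprod]; positivity
        have e2 : Real.pi * 6 * c ≤ 1 / 5 := by nlinarith only [hpi, hpi', hc0, hc1]
        gcongr
  have hUV : U + V = (φ + q * φ') / (s * (1 - s)) := hsplit
  have hkey : c * (m ^ 2 * C) * 4 <
      (P ^ 2 * (φ + q * φ') - 2 * P * (1 / 5 * (φ' * q))) / (s * (1 - s)) := by
    rw [lt_div_iff₀ hss]
    have e1 : 4 * (s * (1 - s)) ≤ 1 := by linarith [sq_nonneg (2 * s - 1)]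
    have e2 : 0 ≤ c * (m ^ 2 * C) := by positivity
    have e3 : c * (m ^ 2 * C) * 4 * (s * (1 - s)) ≤ c * (m ^ 2 * C) := by
      have := mul_le_mul_of_nonneg_left e1 e2
      linarith
    refine e3.trans_lt ?_
    rw [mul_comm φ' q, h11, h1]
    have e4 : m ^ 2 + 6 * ε ≤ P ^ 2 := by
      have g1 : 99 / 100 * ε ≤ P - m := by linarith
      have g2 : 61 / 10 ≤ P + m := by linarith
      nlinarith only [g1, g2, he0]
    have e5 : P ^ 2 ≤ 9.87 := by
      have : P ≤ 3.1416 := by linarith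
      nlinarith only [this, hP0]
    have e6 : 0 < P ^ 2 * (C - σ + 2 * (x * S)) - 2 * P * (1 / 5 * (2 * (x * S))) - m ^ 2 * C := by
      have f1 : 0 ≤ x * S := by linarith [sq_nonneg x]
      have f2 : P ^ 2 * σ ≤ 9.87 * (ε / 2) := by gcongr
      have f3 : 6 * ε * C ≤ (P ^ 2 - m ^ 2) * C := by gcongr; linarith
      have f4 : 6 * ε * (1 - x ^ 2 / 2) ≤ 6 * ε * C := by gcongr
      have f5 : 10 * (x * S) ≤ P ^ 2 * (2 * (x * S)) - 2 * P * (1 / 5 * (2 * (x * S))) := by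
        have g1 : 10 ≤ 2 * P ^ 2 - 4 / 5 * P := by nlinarith only [hP0]
        linarith [mul_le_mul_of_nonneg_right g1 f1]
      have f6 : ε * x ^ 2 ≤ 1 / 10 * x ^ 2 := by gcongr
      linarith [sq_nonneg x]
    linarith [mul_pos hc0 e6]
  rw [h3]
  have e7 : (P ^ 2 * (φ + q * φ') - 2 * P * (1 / 5 * (φ' * q))) / (s * (1 - s)) =
      P ^ 2 * (U + V) - 2 * P * ((1 / 5 * (φ' * q)) / (s * (1 - s))) := by
    rw [hUV]; ring
  have e8 : 2 * P * (|ν| * |U - V|) ≤ 2 * P * ((1 / 5 * (φ' * q)) / (s * (1 - s))) := by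
    gcongr
  linarith

end Model

/-! ### First and second variation: direct distance -/

section Variation

/-- First derivative test at a one-sided minimum. -/
lemma deriv_nonneg_of_right_min {f : ℝ → ℝ} {f₁ : ℝ} (hf : HasDerivAt f f₁ 0) (h0 : f 0 = 0)
    (hmin : ∀ᶠ r in 𝓝[>] (0 : ℝ), 0 ≤ f r) : 0 ≤ f₁ := by
  rw [hasDerivAt_iff_tendsto_slope_zero] at hf
  have h1 := hf.mono_left
    (nhdsWithin_mono (t := {0}ᶜ) 0 (show Ioi (0 : ℝ) ⊆ {0}ᶜ from fun r hr => (mem_Ioi.1 hr).ne'))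
  refine ge_of_tendsto h1 ?_
  filter_upwards [hmin, self_mem_nhdsWithin] with r hr hr0
  have : 0 ≤ r⁻¹ := (inv_pos.2 hr0).le
  rw [zero_add, h0, sub_zero, smul_eq_mul]
  positivity

/-- Second derivative test at a one-sided minimum. -/
lemma second_deriv_nonneg_of_right_min {f g : ℝ → ℝ} {f₂ : ℝ}
    (hf : ∀ᶠ r in 𝓝 (0 : ℝ), HasDerivAt f (g r) r) (hg : HasDerivAt g f₂ 0) (h0 : f 0 = 0)
    (h1 : g 0 = 0) (hmin : ∀ᶠ r in 𝓝[>] (0 : ℝ), 0 ≤ f r) : 0 ≤ f₂ := by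
  by_contra! hneg
  rw [hasDerivAt_iff_tendsto_slope_zero] at hg
  have h2 := hg.mono_left
    (nhdsWithin_mono (t := {0}ᶜ) 0 (show Ioi (0 : ℝ) ⊆ {0}ᶜ from fun r hr => (mem_Ioi.1 hr).ne'))
  have h3 : ∀ᶠ r in 𝓝[>] (0 : ℝ), g r < 0 := by
    filter_upwards [h2.eventually_lt_const hneg, self_mem_nhdsWithin] with r hr hr0
    rw [zero_add, h1, sub_zero, smul_eq_mul] at hr
    have : 0 < r⁻¹ := inv_pos.2 hr0
    by_contra! h
    nlinarith
  obtain ⟨ρ, hρ, h4⟩ := Metric.eventually_nhds_iff.1 hf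
  obtain ⟨ρ', hρ', h5⟩ := mem_nhdsGT_iff_exists_Ioo_subset.1 (h3.and hmin)
  have hρ'0 : (0 : ℝ) < ρ' := hρ'
  set r := min ρ ρ' / 2 with hr
  have hr0 : 0 < r := by positivity
  have hr1 : r < ρ := by rw [hr]; linarith [min_le_left ρ ρ']
  have hr2 : r < ρ' := by rw [hr]; linarith [min_le_right ρ ρ']
  have hd : ∀ x ∈ Icc 0 r, HasDerivAt f (g x) x := fun x hx => h4 (by
    rw [Real.dist_eq, sub_zero, abs_of_nonneg hx.1]; linarith [hx.2])
  obtain ⟨ξ, hξ, h6⟩ := exists_hasDerivAt_eq_slope f g hr0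
    (fun x hx => (hd x hx).continuousAt.continuousWithinAt)
    (fun x hx => hd x ⟨hx.1.le, hx.2.le⟩)
  have h7 : g ξ < 0 := (h5 ⟨hξ.1, by linarith [hξ.2]⟩).1
  have h8 : 0 ≤ f r := (h5 ⟨hr0, hr2⟩).2
  rw [h6, h0, sub_zero, sub_zero] at h7
  have : 0 ≤ f r / r := by positivity
  linarith

/-- First and second derivative of the norm along a curve in the plane. -/
lemma exists_deriv_norm {V V₁ : ℝ → Plane} {V₂ : Plane} (hV : ∀ r, HasDerivAt V (V₁ r) r)
    (hV₁ : HasDerivAt V₁ V₂ 0) (h0 : V 0 ≠ 0) :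
    ∃ g : ℝ → ℝ, (∀ᶠ r in 𝓝 (0 : ℝ), HasDerivAt (fun r => ‖V r‖) (g r) r) ∧
      g 0 = inner ℝ (‖V 0‖⁻¹ • V 0) (V₁ 0) ∧
      HasDerivAt g (inner ℝ (‖V 0‖⁻¹ • V 0) V₂ +
        inner ℝ (rotJ (‖V 0‖⁻¹ • V 0)) (V₁ 0) ^ 2 / ‖V 0‖) 0 := by
  have hd : ∀ r, V r ≠ 0 → HasDerivAt (fun r => ‖V r‖) (inner ℝ (V r) (V₁ r) / ‖V r‖) r := by
    intro r hr
    have h1 := ((hV r).inner ℝ (hV r)).sqrt (by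
      rw [real_inner_self_eq_norm_sq]; exact pow_ne_zero 2 (norm_ne_zero_iff.2 hr))
    have h2 : (fun r => √(inner ℝ (V r) (V r))) = fun r => ‖V r‖ := by
      funext r; rw [real_inner_self_eq_norm_sq, Real.sqrt_sq (norm_nonneg _)]
    rw [h2] at h1
    refine h1.congr_deriv ?_
    rw [real_inner_self_eq_norm_sq, Real.sqrt_sq (norm_nonneg _), real_inner_comm (V r) (V₁ r)]
    ring
  have hn : 0 < ‖V 0‖ := norm_pos_iff.2 h0
  refine ⟨fun r => inner ℝ (V r) (V₁ r) / ‖V r‖, ?_, ?_, ?_⟩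
  · filter_upwards [(hV 0).continuousAt.eventually_ne h0] with r hr using hd r hr
  · simp only [inner_smul_left, conj_trivial]; ring
  · have h1 := ((hV 0).inner ℝ hV₁).div (hd 0 h0) hn.ne'
    refine h1.congr_deriv ?_
    set w := ‖V 0‖⁻¹ • V 0 with hw
    have hw1 : ‖w‖ = 1 := by rw [hw, norm_smul, norm_inv, norm_norm, inv_mul_cancel₀ hn.ne']
    have hVw : V 0 = ‖V 0‖ • w := by rw [hw, smul_smul, mul_inv_cancel₀ hn.ne', one_smul]
    have e1 := inner_eq_frame hw1 (V₁ 0) (V₁ 0)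
    have e2 : inner ℝ (V 0) (V₁ 0) = ‖V 0‖ * inner ℝ (V₁ 0) w := by
      conv_lhs => rw [hVw]
      rw [inner_smul_left, real_inner_comm]; rfl
    have e3 : inner ℝ (V 0) V₂ = ‖V 0‖ * inner ℝ w V₂ := by
      conv_lhs => rw [hVw]
      rw [inner_smul_left]; rfl
    rw [e1, e2, e3, real_inner_comm (V₁ 0) (rotJ w)]
    field_simp
    ring

end Variation

section FBArc

/-- An arc of length `L` in `Ω`, parametrised by arclength, whose interior lies in the interior of
`Ω` and which meets the boundary orthogonally at its endpoints. -/
structure FBArc (Ω : Set Plane) (X T : ℝ → Plane) (k : ℝ → ℝ) (L : ℝ) : Prop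
    extends UnitArc X T k where
  L_pos : 0 < L
  interior_mem : ∀ s ∈ Ioo 0 L, X s ∈ interior Ω
  zero_mem : X 0 ∈ frontier Ω
  end_mem : X L ∈ frontier Ω
  T_zero : T 0 = -outwardNormal Ω (X 0)
  T_end : T L = outwardNormal Ω (X L)

variable {Ω : Set Plane} {X T : ℝ → Plane} {k : ℝ → ℝ} {L : ℝ}

lemma FBArc.reversed (h : FBArc Ω X T k L) :
    FBArc Ω (fun s => X (L - s)) (fun s => -T (L - s)) (fun s => -k (L - s)) L where
  toUnitArc := h.toUnitArc.reverse L
  L_pos := h.L_pos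
  interior_mem s hs := h.interior_mem (L - s) ⟨by linarith [hs.2], by linarith [hs.1]⟩
  zero_mem := by simpa using h.end_mem
  end_mem := by simpa using h.zero_mem
  T_zero := by simp [h.T_end]
  T_end := by simp [h.T_zero]

lemma FBArc.mem (h : FBArc Ω X T k L) (hΩ : IsClosed Ω) {s : ℝ} (hs : s ∈ Icc 0 L) : X s ∈ Ω := by
  rcases hs.1.eq_or_lt with h0 | h0
  · rw [← h0]; exact hΩ.frontier_subset h.zero_mem
  · rcases hs.2.eq_or_lt with h1 | h1
    · rw [h1]; exact hΩ.frontier_subset h.end_mem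
    · exact interior_subset (h.interior_mem s ⟨h0, h1⟩)

/-- The chord-arc inequality for the direct distance, as a function of arclength parameters. -/
def DirectBound (X : ℝ → Plane) (L c ε : ℝ) : Prop :=
  ∀ a b, 0 ≤ a → a ≤ b → b ≤ L → 2 * L * model c ε ((b - a) / (2 * L)) ≤ dist (X a) (X b)

/-- The chord-arc inequality for the reflected distance, as a function of arclength parameters.
By the symmetry of the comparison function it makes no difference which endpoint of the curve is
used to measure the reflected arclength. -/
def ReflectedBound (Ω : Set Plane) (X : ℝ → Plane) (L c ε : ℝ) : Prop :=
  ∀ a ∈ Icc 0 L, ∀ b ∈ Icc 0 L, ∀ z ∈ frontier Ω,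
    2 * L * model c ε ((a + b) / (2 * L)) ≤ dist (X a) z + dist (X b) z

variable {c ε : ℝ}

lemma DirectBound.reversed (h : DirectBound X L c ε) :
    DirectBound (fun s => X (L - s)) L c ε := by
  intro a b ha hab hb
  have := h (L - b) (L - a) (by linarith) (by linarith) (by linarith)
  rw [dist_comm, show L - a - (L - b) = b - a by ring] at this
  exact this

lemma ReflectedBound.reversed (hL : 0 < L) (h : ReflectedBound Ω X L c ε) :
    ReflectedBound Ω (fun s => X (L - s)) L c ε := by
  intro a ha b hb z hz
  have := h (L - a) ⟨by linarith [ha.2], by linarith [ha.1]⟩ (L - b)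
    ⟨by linarith [hb.2], by linarith [hb.1]⟩ z hz
  rwa [show (L - a + (L - b)) / (2 * L) = 1 - (a + b) / (2 * L) by field_simp; ring,
    model_symm] at this

/-- The reflected bound extends from the boundary to all points outside the interior, since a
segment from the curve to such a point crosses the boundary. -/
lemma ReflectedBound.of_notMem_interior (h : ReflectedBound Ω X L c ε) (hX : FBArc Ω X T k L)
    (hΩ : IsClosed Ω) {a b : ℝ} (ha : a ∈ Icc 0 L) (hb : b ∈ Icc 0 L) {z : Plane}
    (hz : z ∉ interior Ω) :
    2 * L * model c ε ((a + b) / (2 * L)) ≤ dist (X a) z + dist (X b) z := by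
  obtain ⟨w, hw, hwS⟩ := exists_frontier_segment (hX.mem hΩ ha) hz
  have h1 := h a ha b hb w hwS
  have h2 := dist_add_dist_of_mem_segment hw
  have h3 := dist_triangle (X b) z w
  rw [dist_comm z w] at h3
  linarith

lemma hasDerivAt_model_affine (hL : 0 < L) (e f r : ℝ) :
    HasDerivAt (fun r => 2 * L * model c ε ((e + f * r) / (2 * L)))
      (f * model' c ε ((e + f * r) / (2 * L))) r := by
  have h1 : HasDerivAt (fun r => (e + f * r) / (2 * L)) (f / (2 * L)) r := by
    simpa using (((hasDerivAt_id r).const_mul f).const_add e).div_const (2 * L)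
  have h2 := ((hasDerivAt_model c ε ((e + f * r) / (2 * L))).comp r h1).const_mul (2 * L)
  refine h2.congr_deriv ?_
  field_simp

lemma hasDerivAt_model'_affine (e f r : ℝ) :
    HasDerivAt (fun r => f * model' c ε ((e + f * r) / (2 * L)))
      (f ^ 2 * model'' c ε ((e + f * r) / (2 * L)) / (2 * L)) r := by
  have h1 : HasDerivAt (fun r => (e + f * r) / (2 * L)) (f / (2 * L)) r := by
    simpa using (((hasDerivAt_id r).const_mul f).const_add e).div_const (2 * L)
  have h2 := ((hasDerivAt_model' c ε ((e + f * r) / (2 * L))).comp r h1).const_mul f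
  refine h2.congr_deriv ?_
  ring

lemma UnitArc.hasDerivAt_comp (h : UnitArc X T k) (a p r : ℝ) :
    HasDerivAt (fun r => X (a + p * r)) (p • T (a + p * r)) r := by
  have h1 : HasDerivAt (fun r => a + p * r) p r := by
    simpa using ((hasDerivAt_id r).const_mul p).const_add a
  exact (h.hasDerivAt_X _).scomp r h1

lemma UnitArc.hasDerivAt_comp_T (h : UnitArc X T k) (a p r : ℝ) :
    HasDerivAt (fun r => p • T (a + p * r)) ((p ^ 2 * k (a + p * r)) • rotJ (T (a + p * r))) r := by
  have h1 : HasDerivAt (fun r => a + p * r) p r := by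
    simpa using ((hasDerivAt_id r).const_mul p).const_add a
  refine (((h.hasDerivAt_T _).scomp r h1).const_smul p).congr_deriv ?_
  simp only [smul_smul]
  ring_nf

lemma eventually_nhdsGT {P : ℝ → Prop} (h : ∀ᶠ r in 𝓝 (0 : ℝ), P r) :
    ∀ᶠ r in 𝓝[>] (0 : ℝ), P r := nhdsWithin_le_nhds h

lemma eventually_add_mul_lt (a b p : ℝ) (h : a < b) :
    ∀ᶠ r in 𝓝 (0 : ℝ), a + p * r < b := by
  have : Continuous fun r : ℝ => a + p * r := by fun_prop
  have := this.tendsto 0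
  simp only [mul_zero, add_zero] at this
  exact this.eventually_lt_const h

lemma eventually_lt_add_mul (a b p : ℝ) (h : a < b) :
    ∀ᶠ r in 𝓝 (0 : ℝ), a < b + p * r := by
  have : Continuous fun r : ℝ => b + p * r := by fun_prop
  have := this.tendsto 0
  simp only [mul_zero, add_zero] at this
  exact this.eventually_const_lt h

/-- If `√(1+μ²) - μ S ≥ x` for all `μ`, where `(C, S)` is a unit vector with `C ≥ 0`, then
`x ≤ C`: the minimum over `μ` of the left hand side is `C`. -/
lemma le_of_forall_sqrt {C S x : ℝ} (hCS : C ^ 2 + S ^ 2 = 1) (hC : 0 ≤ C)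
    (h : ∀ μ : ℝ, 0 ≤ √(1 + μ ^ 2) - μ * S - x) : x ≤ C := by
  rcases hC.lt_or_eq with hC | hC
  · have h1 := h (S / C)
    have h2 : 1 + (S / C) ^ 2 = (1 / C) ^ 2 := by field_simp; linarith
    rw [h2, Real.sqrt_sq (by positivity)] at h1
    have h3 : 1 / C - S / C * S = C := by field_simp; linarith
    linarith
  · rw [← hC]
    by_contra! hx
    have hS : S * S = 1 := by rw [← hC] at hCS; linarith
    have h1 := h (S / x)
    have h2 : √(1 + (S / x) ^ 2) ≤ 1 / x + x / 2 := by
      apply Real.sqrt_le_iff.2 ⟨by positivity, ?_⟩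
      have : (S / x) ^ 2 = (1 / x) ^ 2 := by rw [div_pow, sq S, hS, div_pow, one_pow]
      rw [this]
      have e : (1 / x + x / 2) ^ 2 = (1 / x) ^ 2 + 1 + (x / 2) ^ 2 := by field_simp; ring
      rw [e]; nlinarith [sq_nonneg (x / 2)]
    have h3 : S / x * S = 1 / x := by rw [div_mul_eq_mul_div, hS]
    rw [h3] at h1
    linarith

/-- First variation at the starting point of a chord on which equality holds.  At an endpoint of
the curve the direct bound gives one inequality and the reflected bound, with the reflection point
on the tangent line of the boundary, the other. -/
lemma FBArc.first_variation_start (hX : FBArc Ω X T k L) (hΩ : IsConvexC2Domain Ω)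
    (hD : DirectBound X L c ε) (hR : ReflectedBound Ω X L c ε) {a b : ℝ} (ha : 0 ≤ a)
    (hab : a < b) (hb : b ≤ L) (hne : X a ≠ X b)
    (heq : dist (X a) (X b) = 2 * L * model c ε ((b - a) / (2 * L))) :
    inner ℝ (‖X b - X a‖⁻¹ • (X b - X a)) (T a) = model' c ε ((b - a) / (2 * L)) := by
  have hL := hX.L_pos
  set w := ‖X b - X a‖⁻¹ • (X b - X a) with hw
  -- moving the starting point in the direction `p`
  have hmove : ∀ p : ℝ, (∀ᶠ r in 𝓝[>] (0 : ℝ), 0 ≤ a + p * r) →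
      0 ≤ -p * inner ℝ w (T a) + p * model' c ε ((b - a) / (2 * L)) := by
    intro p hp
    set V : ℝ → Plane := fun r => X b - X (a + p * r)
    have hV : ∀ r, HasDerivAt V (-(p • T (a + p * r))) r := fun r =>
      (hX.hasDerivAt_comp a p r).const_sub (X b)
    have hV0 : V 0 = X b - X a := by simp [V]
    obtain ⟨g, hg1, hg2, -⟩ := exists_deriv_norm hV (hX.hasDerivAt_comp_T a p 0).neg
      (by rw [hV0]; exact sub_ne_zero.2 hne.symm)
    have h1 := hg1.self_of_nhds.sub (hasDerivAt_model_affine (c := c) (ε := ε) hL (b - a) (-p) 0)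
    have h2 := deriv_nonneg_of_right_min h1 (by
      simp only [Pi.sub_apply, hV0, mul_zero, add_zero]
      rw [← dist_eq_norm, dist_comm, heq, sub_self]) (by
      filter_upwards [hp, eventually_nhdsGT (eventually_add_mul_lt a b p hab)]
        with r hr1 hr2
      have := hD (a + p * r) b hr1 hr2.le hb
      rw [dist_comm, dist_eq_norm] at this
      simp only [Pi.sub_apply, V]
      rw [show b - a + -p * r = b - (a + p * r) by ring]
      linarith)
    rw [hg2, hV0, ← hw] at h2
    simp only [mul_zero, add_zero, inner_neg_right, inner_smul_right] at h2
    linarith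
  rcases ha.lt_or_eq with ha | ha
  · have h1 := hmove 1 (eventually_nhdsGT
      ((eventually_lt_add_mul 0 a 1 ha).mono fun _ => le_of_lt))
    have h2 := hmove (-1) (eventually_nhdsGT
      ((eventually_lt_add_mul 0 a (-1) ha).mono fun _ => le_of_lt))
    linarith
  · subst ha
    have h1 := hmove 1 (by
      filter_upwards [self_mem_nhdsWithin] with r hr
      have : 0 < r := hr
      linarith)
    refine le_antisymm (by linarith) ?_
    have hwn : ‖w‖ = 1 := by
      rw [hw, norm_smul, norm_inv, norm_norm, inv_mul_cancel₀]
      exact norm_ne_zero_iff.2 (sub_ne_zero.2 hne.symm)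
    have hT := hX.norm_T 0
    set τ := rotJ (T 0) with hτ
    have hCS := norm_sq_eq_frame hT w
    rw [hwn] at hCS
    have hC : 0 ≤ inner ℝ w (T 0) := by
      have := hΩ.support hX.zero_mem (hX.mem hΩ.isClosed ⟨hab.le, hb⟩)
      rw [hw, inner_smul_left, hX.T_zero, inner_neg_right, real_inner_comm]
      apply mul_nonneg
      · simp
      · linarith
    refine le_of_forall_sqrt (S := inner ℝ w τ) (by rw [← hCS]; ring) hC fun μ => ?_
    -- the reflection point moves along the tangent line with speed `μ`
    have ht1 : Tendsto (fun r : ℝ => ‖r⁻¹ • (X r - X 0) - μ • τ‖) (𝓝[>] 0)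
        (𝓝 ‖T 0 - μ • τ‖) := by
      have h2 := hX.hasDerivAt_X 0
      rw [hasDerivAt_iff_tendsto_slope_zero] at h2
      have h3 := h2.mono_left (nhdsWithin_mono (t := {0}ᶜ) 0
        (show Ioi (0 : ℝ) ⊆ {0}ᶜ from fun r hr => (mem_Ioi.1 hr).ne'))
      simp only [zero_add] at h3
      exact (h3.sub_const (μ • τ)).norm
    have hn1 : ‖T 0 - μ • τ‖ = √(1 + μ ^ 2) := by
      rw [eq_comm, Real.sqrt_eq_iff_mul_self_eq (by positivity) (norm_nonneg _), ← sq,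
        norm_sq_eq_frame hT, inner_sub_left, inner_sub_left, inner_smul_left, inner_smul_left,
        hτ, real_inner_self_eq_norm_sq, real_inner_self_eq_norm_sq, norm_rotJ, hT]
      simp
    set V : ℝ → Plane := fun r => (X b - X 0) - r • (μ • τ)
    have hV : ∀ r, HasDerivAt V (-(μ • τ)) r := fun r => by
      simpa using ((hasDerivAt_id r).smul_const (μ • τ)).const_sub (X b - X 0)
    have hV0 : V 0 = X b - X 0 := by simp [V]
    obtain ⟨g, hg1, hg2, -⟩ := exists_deriv_norm hV (hasDerivAt_const (0 : ℝ) (-(μ • τ)))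
      (by rw [hV0]; exact sub_ne_zero.2 hne.symm)
    have h4 := hg1.self_of_nhds.sub (hasDerivAt_model_affine (c := c) (ε := ε) hL b 1 0)
    rw [hasDerivAt_iff_tendsto_slope_zero] at h4
    have h5 := h4.mono_left (nhdsWithin_mono (t := {0}ᶜ) 0
        (show Ioi (0 : ℝ) ⊆ {0}ᶜ from fun r hr => (mem_Ioi.1 hr).ne'))
    have h6 := ht1.add h5
    have h7 : 0 ≤ ‖T 0 - μ • τ‖ + (g 0 - 1 * model' c ε ((b + 1 * 0) / (2 * L))) := by
      refine ge_of_tendsto h6 ?_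
      filter_upwards [self_mem_nhdsWithin,
        eventually_nhdsGT (eventually_add_mul_lt 0 L 1 hL)] with r hr hrL
      have hr : 0 < r := hr
      have hrL : 0 + 1 * r < L := hrL
      have hzint : X 0 + r • (μ • τ) ∉ interior Ω := by
        intro hz
        have := hΩ.support_lt hX.zero_mem hz
        rw [add_sub_cancel_left, inner_smul_right, inner_smul_right, hτ, hX.T_zero, rotJ_neg,
          inner_neg_right, inner_self_rotJ] at this
        simp at this
      have h8 := hR.of_notMem_interior hX hΩ.isClosed (a := r) (b := b)
        ⟨hr.le, by linarith⟩ ⟨hab.le, hb⟩ hzint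
      have h9 : dist (X r) (X 0 + r • (μ • τ)) = r * ‖r⁻¹ • (X r - X 0) - μ • τ‖ := by
        have e : X r - (X 0 + r • (μ • τ)) = r • (r⁻¹ • (X r - X 0) - μ • τ) := by
          rw [smul_sub, smul_inv_smul₀ hr.ne', sub_add_eq_sub_sub]
        rw [dist_eq_norm, e, norm_smul, Real.norm_of_nonneg hr.le]
      have h10 : dist (X b) (X 0 + r • (μ • τ)) = ‖V r‖ := by
        rw [dist_eq_norm, sub_add_eq_sub_sub]
      rw [h9, h10] at h8
      have h11 : ‖V 0‖ = 2 * L * model c ε (b / (2 * L)) := by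
        rw [hV0, ← dist_eq_norm, dist_comm, heq, sub_zero]
      simp only [Pi.sub_apply, zero_add, smul_eq_mul, add_zero, one_mul]
      rw [h11, sub_self, sub_zero]
      rw [add_comm r b] at h8
      have : 0 ≤ r⁻¹ * (r * ‖r⁻¹ • (X r - X 0) - μ • τ‖ +
          (‖V r‖ - 2 * L * model c ε ((b + r) / (2 * L)))) :=
        mul_nonneg (inv_pos.2 hr).le (by linarith)
      rw [mul_add, ← mul_assoc, inv_mul_cancel₀ hr.ne', one_mul] at this
      exact this
    rw [hg2, hV0, ← hw, hn1, inner_neg_right, inner_smul_right] at h7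
    simp only [one_mul, mul_zero, add_zero, sub_zero] at h7 ⊢
    linarith

lemma FBArc.first_variation_end (hX : FBArc Ω X T k L) (hΩ : IsConvexC2Domain Ω)
    (hD : DirectBound X L c ε) (hR : ReflectedBound Ω X L c ε) {a b : ℝ} (ha : 0 ≤ a)
    (hab : a < b) (hb : b ≤ L) (hne : X a ≠ X b)
    (heq : dist (X a) (X b) = 2 * L * model c ε ((b - a) / (2 * L))) :
    inner ℝ (‖X b - X a‖⁻¹ • (X b - X a)) (T b) = model' c ε ((b - a) / (2 * L)) := by
  have h := hX.reversed.first_variation_start hΩ hD.reversed (hR.reversed hX.L_pos)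
    (a := L - b) (b := L - a) (by linarith) (by linarith) (by linarith)
  simp only [sub_sub_cancel, sub_sub_sub_cancel_left] at h
  have := h hne.symm (by rw [dist_comm]; exact heq)
  rw [← this, inner_neg_right, ← inner_neg_left, ← smul_neg, neg_sub, norm_sub_rev]

/-- Second variation of the direct distance in a direction which moves both endpoints with unit
speed and does not rotate the chord. -/
lemma UnitArc.second_variation_direct (hX : UnitArc X T k) (hL : 0 < L) {a b p q : ℝ}
    (hp : p ^ 2 = 1) (hq : q ^ 2 = 1) (hne : X a ≠ X b)
    (heq : dist (X a) (X b) = 2 * L * model c ε ((b - a) / (2 * L)))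
    (hmin : ∀ᶠ r in 𝓝[>] (0 : ℝ),
      2 * L * model c ε ((b - a + (q - p) * r) / (2 * L)) ≤ dist (X (a + p * r)) (X (b + q * r)))
    {w : Plane} (hw : w = ‖X b - X a‖⁻¹ • (X b - X a))
    (ha1 : inner ℝ w (T a) = model' c ε ((b - a) / (2 * L)))
    (hb1 : inner ℝ w (T b) = model' c ε ((b - a) / (2 * L)))
    (hrot : q * inner ℝ (rotJ w) (T b) = p * inner ℝ (rotJ w) (T a)) :
    (q - p) ^ 2 * model'' c ε ((b - a) / (2 * L)) / (2 * L) ≤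
      k b * inner ℝ w (rotJ (T b)) - k a * inner ℝ w (rotJ (T a)) := by
  set V : ℝ → Plane := fun r => X (b + q * r) - X (a + p * r)
  have hV : ∀ r, HasDerivAt V (q • T (b + q * r) - p • T (a + p * r)) r := fun r =>
    (hX.hasDerivAt_comp b q r).sub (hX.hasDerivAt_comp a p r)
  have hV0 : V 0 = X b - X a := by simp [V]
  obtain ⟨g, hg1, hg2, hg3⟩ := exists_deriv_norm hV
    ((hX.hasDerivAt_comp_T b q 0).sub (hX.hasDerivAt_comp_T a p 0))
    (by rw [hV0]; exact sub_ne_zero.2 hne.symm)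
  have h1 := second_deriv_nonneg_of_right_min
    (f := fun r => ‖V r‖ - 2 * L * model c ε ((b - a + (q - p) * r) / (2 * L)))
    (hg1.mono fun r hr => hr.sub (hasDerivAt_model_affine (c := c) (ε := ε) hL (b - a) (q - p) r))
    (hg3.sub (hasDerivAt_model'_affine (b - a) (q - p) 0))
    (by simp only [hV0, mul_zero, add_zero]; rw [← dist_eq_norm, dist_comm, heq, sub_self])
    (by
      rw [hg2, hV0, ← hw]
      simp only [mul_zero, add_zero, inner_sub_right, inner_smul_right, ha1, hb1]; ring)
    (by
      filter_upwards [hmin] with r hr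
      rw [dist_comm, dist_eq_norm] at hr
      simp only [V]; linarith)
  rw [hV0, ← hw] at h1
  simp only [mul_zero, add_zero, inner_sub_right, inner_smul_right, hrot, hp, hq, sub_self] at h1
  simp only [one_mul] at h1
  norm_num at h1
  linarith

lemma model''_nonpos {s : ℝ} (hε : ε ∈ Ioo (0 : ℝ) (1 / 10)) (hc : 0 < c) (hs : s ∈ Icc (0 : ℝ) 1) :
    model'' c ε s ≤ 0 := by
  have hpi := Real.pi_gt_three
  obtain ⟨he0, he1⟩ := hε
  have : 0 ≤ Real.sin ((Real.pi - ε) * s + ε / 2) := by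
    apply Real.sin_nonneg_of_nonneg_of_le_pi
    · have : 0 ≤ (Real.pi - ε) * s := mul_nonneg (by linarith) hs.1
      linarith
    · nlinarith [hs.2]
  rw [model'']
  have : 0 ≤ c * ((Real.pi - ε) ^ 2 * Real.sin ((Real.pi - ε) * s + ε / 2)) := by positivity
  linarith

/-- At a chord on which equality holds, the rate of change of `d - 𝐋 φ(ℓ/𝐋)` along the flow is
positive. -/
theorem FBArc.direct_rate_pos (hX : FBArc Ω X T k L) (hΩ : IsConvexC2Domain Ω)
    (hε : ε ∈ Ioo (0 : ℝ) (1 / 10)) (hc : c ∈ Ioo (0 : ℝ) (1 / 100))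
    (hD : DirectBound X L c ε) (hR : ReflectedBound Ω X L c ε) {a b : ℝ} (ha : 0 ≤ a)
    (hab : a < b) (hb : b ≤ L)
    (heq : dist (X a) (X b) = 2 * L * model c ε ((b - a) / (2 * L))) :
    0 < inner ℝ (‖X b - X a‖⁻¹ • (X b - X a)) (k b • rotJ (T b) - k a • rotJ (T a)) +
      2 * (∫ s in 0..L, k s ^ 2) * (model c ε ((b - a) / (2 * L)) -
        (b - a) / (2 * L) * model' c ε ((b - a) / (2 * L))) +
      model' c ε ((b - a) / (2 * L)) * ∫ s in a..b, k s ^ 2 := by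
  have hL := hX.L_pos
  set s := (b - a) / (2 * L) with hs
  have hs0 : 0 < s := div_pos (by linarith) (by linarith)
  have hs1 : s ≤ 1 / 2 := by rw [hs, div_le_iff₀ (by linarith)]; linarith
  have hφ := model_pos hε hc.1 hs0 (by linarith)
  have hne : X a ≠ X b := by
    rw [← dist_pos, heq]; positivity
  have h1 := hX.first_variation_start hΩ hD hR ha hab hb hne heq
  have h2 := hX.first_variation_end hΩ hD hR ha hab hb hne heq
  rw [← hs] at h1 h2
  have hwn : ‖‖X b - X a‖⁻¹ • (X b - X a)‖ = 1 := by
    rw [norm_smul, norm_inv, norm_norm, inv_mul_cancel₀]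
    exact norm_ne_zero_iff.2 (sub_ne_zero.2 hne.symm)
  obtain ⟨w, hw⟩ : ∃ w, w = ‖X b - X a‖⁻¹ • (X b - X a) := ⟨_, rfl⟩
  rw [← hw] at h1 h2 hwn ⊢
  have hJ : inner ℝ (rotJ w) (T b) ^ 2 = inner ℝ (rotJ w) (T a) ^ 2 := by
    have e1 := norm_sq_eq_frame hwn (T a)
    have e2 := norm_sq_eq_frame hwn (T b)
    rw [hX.norm_T, real_inner_comm, real_inner_comm (rotJ w)] at e1 e2
    rw [h1] at e1
    rw [h2] at e2
    linarith
  have hF := model''_nonpos hε hc.1 (s := s) ⟨hs0.le, by linarith⟩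
  have hsecond : 4 * model'' c ε s / (2 * L) ≤
      k b * inner ℝ w (rotJ (T b)) - k a * inner ℝ w (rotJ (T a)) := by
    rcases sq_eq_sq_iff_eq_or_eq_neg.1 hJ with h3 | h3
    · -- parallel tangents: translate both endpoints in the same direction
      have hle : 4 * model'' c ε s / (2 * L) ≤ 0 :=
        div_nonpos_of_nonpos_of_nonneg (by linarith) (by linarith)
      have hpar : ∀ p : ℝ, p ^ 2 = 1 → (∀ᶠ r in 𝓝[>] (0 : ℝ), 0 ≤ a + p * r ∧ b + p * r ≤ L) →
          4 * model'' c ε s / (2 * L) ≤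
            k b * inner ℝ w (rotJ (T b)) - k a * inner ℝ w (rotJ (T a)) := by
        intro p hp hev
        refine hle.trans ?_
        have := hX.second_variation_direct hL hp hp hne heq (by
          filter_upwards [hev] with r hr
          have := hD (a + p * r) (b + p * r) hr.1 (by linarith) hr.2
          rwa [show b + p * r - (a + p * r) = b - a + (p - p) * r by ring] at this)
          hw h1 h2 (by rw [h3])
        simpa using this
      rcases hb.lt_or_eq with hb' | hb'
      · refine hpar 1 (by norm_num) ?_
        filter_upwards [self_mem_nhdsWithin,
          eventually_nhdsGT (eventually_add_mul_lt b L 1 hb')] with r hr hr'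
        have hr : 0 < r := hr
        exact ⟨by linarith, hr'.le⟩
      rcases ha.lt_or_eq with ha' | ha'
      · refine hpar (-1) (by norm_num) ?_
        filter_upwards [self_mem_nhdsWithin,
          eventually_nhdsGT (eventually_lt_add_mul 0 a (-1) ha')] with r hr hr'
        have hr : 0 < r := hr
        exact ⟨hr'.le, by linarith⟩
      -- the whole curve: `Ω` would lie between two coinciding lines
      exfalso
      subst ha'
      subst hb'
      have hsh : s = 1 / 2 := by rw [hs]; field_simp; ring
      have hz : model' c ε s = 0 := by
        have := model'_symm c ε (1 / 2)
        rw [hsh]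
        norm_num at this ⊢
        linarith
      rw [hz] at h1 h2
      have hTT : T b = T 0 := ext_frame hwn
        (by rw [real_inner_comm, h2, real_inner_comm, h1])
        (by rw [real_inner_comm, h3, real_inner_comm])
      have hm := hX.interior_mem (b / 2) ⟨by linarith, by linarith⟩
      have g1 := hΩ.support_lt hX.zero_mem hm
      have g2 := hΩ.support_lt hX.end_mem hm
      rw [← neg_eq_iff_eq_neg.2 hX.T_zero, inner_neg_left] at g1
      rw [← hX.T_end, hTT] at g2
      have g3 : inner ℝ (T 0) (X b - X 0) = 0 := by
        have e : X b - X 0 = ‖X b - X 0‖ • w := by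
          rw [hw, smul_smul, mul_inv_cancel₀ (norm_ne_zero_iff.2 (sub_ne_zero.2 hne.symm)),
            one_smul]
        rw [e, inner_smul_right, real_inner_comm, h1, mul_zero]
      have g4 : inner ℝ (T 0) (X (b / 2) - X 0) =
          inner ℝ (T 0) (X (b / 2) - X b) + inner ℝ (T 0) (X b - X 0) := by
        rw [← inner_add_right]; simp
      linarith
    · -- symmetric tangents: move the endpoints towards each other
      have := hX.second_variation_direct hL (p := 1) (q := -1) (by norm_num) (by norm_num) hne heq
        (by
          filter_upwards [self_mem_nhdsWithin,
            eventually_nhdsGT (eventually_add_mul_lt a b 2 hab)] with r hr hr'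
          have hr : 0 < r := hr
          have := hD (a + 1 * r) (b + -1 * r) (by linarith) (by linarith) (by linarith)
          rwa [show b + -1 * r - (a + 1 * r) = b - a + (-1 - 1) * r by ring] at this)
        hw h1 h2 (by rw [h3]; ring)
      norm_num at this
      linarith
  -- the arc between the endpoints is almost closed, hence has large energy
  have hloop := hX.loop_energy hab.le
  have hE := hX.energy_mono ha hab.le hb
  have hba : b - a = 2 * L * s := by rw [hs]; field_simp
  have hEab : 15 ≤ (b - a) * ∫ u in a..b, k u ^ 2 := by
    have e1 := model_le_mul hε hc hs0.le
    have e2 : dist (X a) (X b) ≤ 63 / 2000 * (b - a) := by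
      rw [heq, hba]
      have := mul_le_mul_of_nonneg_left e1 (by linarith : 0 ≤ 2 * L)
      linarith
    have e3 : (b - a) * 15 ≤ (b - a) * ((b - a) * ∫ u in a..b, k u ^ 2) := by linarith
    exact le_of_mul_le_mul_left e3 (by linarith)
  have hnum := model_interior_ineq hε hc hs0 hs1
  have hv := model_sub_pos hε hc.1 hs0 (by linarith)
  have hφ' := model'_nonneg hε hc.1 hs0.le hs1
  rw [inner_sub_right, inner_smul_right, inner_smul_right]
  set E := ∫ u in 0..L, k u ^ 2
  set Eab := ∫ u in a..b, k u ^ 2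
  have h5 : 0 < 2 * L * s := by positivity
  have h6 : 0 < (4 * model'' c ε s / (2 * L) +
      Eab * (2 * model c ε s + (1 - 2 * s) * model' c ε s)) * (2 * L * s) := by
    have e1 : (4 * model'' c ε s / (2 * L) +
        Eab * (2 * model c ε s + (1 - 2 * s) * model' c ε s)) * (2 * L * s) =
        4 * model'' c ε s * s +
          ((b - a) * Eab) * (2 * model c ε s + (1 - 2 * s) * model' c ε s) := by
      rw [hba]; field_simp
    rw [e1]
    have e2 : 0 ≤ 2 * model c ε s + (1 - 2 * s) * model' c ε s := by
      have := mul_nonneg (by linarith : 0 ≤ 1 - 2 * s) hφ'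
      linarith
    have := mul_le_mul_of_nonneg_right hEab e2
    linarith
  have h7 := pos_of_mul_pos_left h6 h5.le
  have h8 : 0 ≤ (E - Eab) * (model c ε s - s * model' c ε s) :=
    mul_nonneg (by linarith) hv.le
  nlinarith

end FBArc

/-! ### First and second variation: reflected distance -/

section Reflected

variable {Ω : Set Plane} {X T : ℝ → Plane} {k : ℝ → ℝ} {L c ε : ℝ}

/-- First and second variation of the reflected distance, when the two points of the curve move
with speeds `p, q` and the reflection point moves along a line with velocity `v`. -/
lemma UnitArc.variation_reflected (hX : UnitArc X T k) (hL : 0 < L) {a b : ℝ} {z : Plane}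
    (hxz : X a ≠ z) (hyz : X b ≠ z)
    (heq : dist (X a) z + dist (X b) z = 2 * L * model c ε ((a + b) / (2 * L)))
    {p q : ℝ} {v : Plane}
    (hmin : ∀ᶠ r in 𝓝[>] (0 : ℝ), 2 * L * model c ε ((a + b + (p + q) * r) / (2 * L)) ≤
      dist (X (a + p * r)) (z + r • v) + dist (X (b + q * r)) (z + r • v))
    {w w' : Plane} (hw : w = ‖X a - z‖⁻¹ • (X a - z)) (hw' : w' = ‖X b - z‖⁻¹ • (X b - z)) :
    0 ≤ inner ℝ w (p • T a - v) + inner ℝ w' (q • T b - v) -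
        (p + q) * model' c ε ((a + b) / (2 * L)) ∧
      (inner ℝ w (p • T a - v) + inner ℝ w' (q • T b - v) -
        (p + q) * model' c ε ((a + b) / (2 * L)) = 0 →
        0 ≤ inner ℝ w ((p ^ 2 * k a) • rotJ (T a)) +
            inner ℝ (rotJ w) (p • T a - v) ^ 2 / ‖X a - z‖ +
          (inner ℝ w' ((q ^ 2 * k b) • rotJ (T b)) +
            inner ℝ (rotJ w') (q • T b - v) ^ 2 / ‖X b - z‖) -
          (p + q) ^ 2 * model'' c ε ((a + b) / (2 * L)) / (2 * L)) := by
  have hline : ∀ r : ℝ, HasDerivAt (fun r : ℝ => z + r • v) v r := fun r => by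
    simpa using ((hasDerivAt_id r).smul_const v).const_add z
  set V : ℝ → Plane := fun r => X (a + p * r) - (z + r • v)
  set W : ℝ → Plane := fun r => X (b + q * r) - (z + r • v)
  have hV : ∀ r, HasDerivAt V (p • T (a + p * r) - v) r := fun r =>
    (hX.hasDerivAt_comp a p r).sub (hline r)
  have hW : ∀ r, HasDerivAt W (q • T (b + q * r) - v) r := fun r =>
    (hX.hasDerivAt_comp b q r).sub (hline r)
  have hV0 : V 0 = X a - z := by simp [V]
  have hW0 : W 0 = X b - z := by simp [W]
  obtain ⟨g, hg1, hg2, hg3⟩ := exists_deriv_norm hV ((hX.hasDerivAt_comp_T a p 0).sub_const v)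
    (by rw [hV0]; exact sub_ne_zero.2 hxz)
  obtain ⟨h, hh1, hh2, hh3⟩ := exists_deriv_norm hW ((hX.hasDerivAt_comp_T b q 0).sub_const v)
    (by rw [hW0]; exact sub_ne_zero.2 hyz)
  rw [hV0, ← hw] at hg2 hg3
  rw [hW0, ← hw'] at hh2 hh3
  simp only [mul_zero, add_zero] at hg2 hg3 hh2 hh3
  set f : ℝ → ℝ := fun r => ‖V r‖ + ‖W r‖ -
    2 * L * model c ε ((a + b + (p + q) * r) / (2 * L))
  have hf : ∀ᶠ r in 𝓝 (0 : ℝ), HasDerivAt f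
      (g r + h r - (p + q) * model' c ε ((a + b + (p + q) * r) / (2 * L))) r := by
    filter_upwards [hg1, hh1] with r h1 h2
    exact (h1.add h2).sub (hasDerivAt_model_affine hL _ _ _)
  have hf0 : f 0 = 0 := by
    simp only [f, hV0, hW0, mul_zero, add_zero]
    rw [← dist_eq_norm, ← dist_eq_norm, heq, sub_self]
  have hfmin : ∀ᶠ r in 𝓝[>] (0 : ℝ), 0 ≤ f r := by
    filter_upwards [hmin] with r hr
    rw [dist_eq_norm, dist_eq_norm] at hr
    simp only [f, V, W]; linarith
  refine ⟨?_, fun hzero => ?_⟩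
  · have := deriv_nonneg_of_right_min hf.self_of_nhds hf0 hfmin
    rw [hg2, hh2] at this
    simpa using this
  · have h2 := hasDerivAt_model'_affine (c := c) (ε := ε) (L := L) (a + b) (p + q) 0
    have := second_deriv_nonneg_of_right_min hf ((hg3.add hh3).sub h2) hf0
      (by rw [hg2, hh2]; simpa using hzero) hfmin
    simpa [hV0, hW0] using this

/-- First variation at an interior minimum of the reflected distance defect: the chords make equal
angles with the curve and with the boundary. -/
lemma FBArc.first_variation_reflected (hX : FBArc Ω X T k L) (hΩ : IsConvexC2Domain Ω)
    (hR : ReflectedBound Ω X L c ε) {a b : ℝ} (ha : a ∈ Ioo 0 L) (hb : b ∈ Ioo 0 L) {z : Plane}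
    (hz : z ∈ frontier Ω)
    (heq : dist (X a) z + dist (X b) z = 2 * L * model c ε ((a + b) / (2 * L)))
    {w w' : Plane} (hw : w = ‖X a - z‖⁻¹ • (X a - z)) (hw' : w' = ‖X b - z‖⁻¹ • (X b - z)) :
    inner ℝ w (T a) = model' c ε ((a + b) / (2 * L)) ∧
      inner ℝ w' (T b) = model' c ε ((a + b) / (2 * L)) ∧
      inner ℝ w (boundaryTangent Ω z) + inner ℝ w' (boundaryTangent Ω z) = 0 ∧
      ∀ p q ρ : ℝ,
        (p + q) ^ 2 * model'' c ε ((a + b) / (2 * L)) / (2 * L) ≤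
          inner ℝ w ((p ^ 2 * k a) • rotJ (T a)) +
            inner ℝ (rotJ w) (p • T a - ρ • boundaryTangent Ω z) ^ 2 / ‖X a - z‖ +
          (inner ℝ w' ((q ^ 2 * k b) • rotJ (T b)) +
            inner ℝ (rotJ w') (q • T b - ρ • boundaryTangent Ω z) ^ 2 / ‖X b - z‖) := by
  have hmem : ∀ s ∈ Ioo 0 L, X s ≠ z := fun s hs h => by
    have := hX.interior_mem s hs
    rw [h] at this
    exact hz.2 this
  set τ := boundaryTangent Ω z with hτ
  have hmain : ∀ p q ρ : ℝ, _ := fun p q ρ =>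
    hX.toUnitArc.variation_reflected (c := c) (ε := ε) hX.L_pos (hmem a ha) (hmem b hb) heq
      (p := p) (q := q) (v := ρ • τ) (by
        filter_upwards [eventually_nhdsGT (eventually_add_mul_lt a L p ha.2),
          eventually_nhdsGT (eventually_lt_add_mul 0 a p ha.1),
          eventually_nhdsGT (eventually_add_mul_lt b L q hb.2),
          eventually_nhdsGT (eventually_lt_add_mul 0 b q hb.1)] with r h1 h2 h3 h4
        have hzint : z + r • (ρ • τ) ∉ interior Ω := by
          intro hz'
          have := hΩ.support_lt hz hz'
          rw [add_sub_cancel_left, inner_smul_right, inner_smul_right, hτ, boundaryTangent,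
            inner_self_rotJ] at this
          simp at this
        have := hR.of_notMem_interior hX hΩ.isClosed (a := a + p * r) (b := b + q * r)
          ⟨h2.le, h1.le⟩ ⟨h4.le, h3.le⟩ hzint
        rwa [show a + p * r + (b + q * r) = a + b + (p + q) * r by ring] at this) hw hw'
  have e1 := (hmain 1 0 0).1
  have e2 := (hmain (-1) 0 0).1
  have e3 := (hmain 0 1 0).1
  have e4 := (hmain 0 (-1) 0).1
  have e5 := (hmain 0 0 1).1
  have e6 := (hmain 0 0 (-1)).1
  simp only [zero_smul, one_smul, neg_smul, sub_zero, zero_sub, inner_neg_right, inner_zero_right,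
    neg_neg, add_zero, zero_add, one_mul, neg_mul, zero_mul] at e1 e2 e3 e4 e5 e6
  have f1 : inner ℝ w (T a) = model' c ε ((a + b) / (2 * L)) := by linarith
  have f2 : inner ℝ w' (T b) = model' c ε ((a + b) / (2 * L)) := by linarith
  have f3 : inner ℝ w τ + inner ℝ w' τ = 0 := by linarith
  refine ⟨f1, f2, f3, fun p q ρ => ?_⟩
  have := (hmain p q ρ).2 (by
    simp only [inner_sub_right, inner_smul_right, f1, f2]
    linear_combination (-ρ) * f3)
  linarith

end Reflected

/-! ### Energy estimates for the reflected distance -/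

section Energy

variable {Ω : Set Plane} {X T : ℝ → Plane} {k : ℝ → ℝ} {L c ε : ℝ}

lemma sq_add_le_of_sq_le {a b x y E F : ℝ} (ha : 0 < a) (hb : 0 < b) (hx : x ^ 2 ≤ a * E)
    (hy : y ^ 2 ≤ b * F) : (x + y) ^ 2 ≤ (a + b) * (E + F) := by
  have h1 : 0 ≤ (b * x - a * y) ^ 2 := sq_nonneg _
  have h2 : b ^ 2 * x ^ 2 ≤ b ^ 2 * (a * E) := by gcongr
  have h3 : a ^ 2 * y ^ 2 ≤ a ^ 2 * (b * F) := by gcongr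
  have h4 : (a * b) * (2 * (x * y)) ≤ (a * b) * (b * E + a * F) := by nlinarith
  have h5 := le_of_mul_le_mul_left h4 (mul_pos ha hb)
  nlinarith

/-- If two points of the curve are close to each other and to a tangent line orthogonal to the
curve at its starting point, then the two arcs from the starting point have large energy. -/
lemma UnitArc.positional_energy (hX : UnitArc X T k) {a b d d' e : ℝ} (ha : 0 < a) (hab : a ≤ b)
    (hd : 0 ≤ d) (hd' : 0 ≤ d') (hdd : d + d' ≤ 63 / 2000 * (a + b)) (he : e ≤ 3 / 10000)
    (hdist : dist (X a) (X b) ≤ d + d') (hxa : inner ℝ (X a - X 0) (T 0) ≤ d + e * (d + a))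
    (hxb : inner ℝ (X b - X 0) (T 0) ≤ d' + e * (d' + b)) :
    147 / 10 ≤ (a + b) * ((∫ s in 0..a, k s ^ 2) + ∫ s in 0..b, k s ^ 2) := by
  have hb : 0 < b := by linarith
  have hEa0 : 0 ≤ ∫ s in 0..a, k s ^ 2 := UnitArc.energy_nonneg ha.le
  have hEb0 : 0 ≤ ∫ s in 0..b, k s ^ 2 := UnitArc.energy_nonneg hb.le
  have h1 := hX.inner_chord_start_ge ha.le
  have h2 := hX.inner_chord_start_ge hb.le
  have h3 := hX.loop_energy hab
  have h4 := hX.energy_mono ha.le hab le_rfl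
  simp only [sub_zero] at h1 h2
  set Ea := ∫ s in 0..a, k s ^ 2
  set Eb := ∫ s in 0..b, k s ^ 2
  set Eab := ∫ s in a..b, k s ^ 2
  set S := a + b with hS
  have hS0 : 0 < S := by linarith
  rcases le_or_gt (3 / 5 * S) (b - a) with h5 | h5
  · -- the arc between the two points is long and almost closed
    set g := b - a
    have hg0 : 0 < g := by linarith
    have hgS : g ≤ S := by linarith
    have h6 : 16 * (g - 63 / 2000 * S) ≤ g ^ 2 * Eb := by
      have : g ^ 2 * Eab ≤ g ^ 2 * Eb := by gcongr
      linarith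
    have h7 : 147 / 10 * g ^ 2 ≤ S * (16 * (g - 63 / 2000 * S)) := by
      have := mul_nonneg (sub_nonneg.2 hgS) (sub_nonneg.2 h5)
      nlinarith only [this, hS0, hg0, hgS, h5]
    have h8 : g ^ 2 * (147 / 10) ≤ g ^ 2 * (S * Eb) := by
      have := mul_le_mul_of_nonneg_left h6 hS0.le
      linarith
    have h9 := le_of_mul_le_mul_left h8 (by positivity)
    have h10 : 0 ≤ S * Ea := by positivity
    linarith
  · -- both arcs from the start are long and make little progress
    have ha5 : 1 / 5 * S ≤ a := by linarith
    have hb5 : 1 / 5 * S ≤ b := by linarith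
    have hη : ∀ D t, 0 ≤ D → D ≤ 63 / 2000 * S → 0 ≤ t → t ≤ S → D + e * (D + t) ≤ 4 / 125 * S := by
      intro D t hD0 hD ht0 ht
      have : e * (D + t) ≤ 3 / 10000 * (63 / 2000 * S + S) := by gcongr
      linarith
    have h6 : 4 * (a - 4 / 125 * S) ≤ a ^ 2 * Ea := by
      have := hη d a hd (by linarith) ha.le (by linarith)
      linarith
    have h7 : 4 * (b - 4 / 125 * S) ≤ b ^ 2 * Eb := by
      have := hη d' b hd' (by linarith) hb.le (by linarith)
      linarith
    have h8 : b ^ 2 * (4 * (a - 4 / 125 * S)) ≤ b ^ 2 * (a ^ 2 * Ea) := by gcongr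
    have h9 : a ^ 2 * (4 * (b - 4 / 125 * S)) ≤ a ^ 2 * (b ^ 2 * Eb) := by gcongr
    set P := a * b with hP
    have hP1 : 4 / 25 * S ^ 2 ≤ P := by
      rw [hP, hS]; nlinarith only [ha5, hb5, hS]
    have hP2 : P ≤ 1 / 4 * S ^ 2 := by rw [hP, hS]; nlinarith only [sq_nonneg (a - b)]
    have h10 : S * (b ^ 2 * (4 * (a - 4 / 125 * S)) + a ^ 2 * (4 * (b - 4 / 125 * S))) =
        4 * S ^ 2 * (P - 4 / 125 * (S ^ 2 - 2 * P)) := by rw [hP, hS]; ring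
    have h11 : 147 / 10 * P ^ 2 ≤ 4 * S ^ 2 * (P - 4 / 125 * (S ^ 2 - 2 * P)) := by
      have f1 := mul_nonneg (sub_nonneg.2 hP1) (sub_nonneg.2 hP2)
      have f2 : 0 < S ^ 2 := by positivity
      nlinarith only [f1, f2, hP1, hP2]
    have h12 : P ^ 2 * (147 / 10) ≤ P ^ 2 * (S * (Ea + Eb)) := by
      have f3 := mul_le_mul_of_nonneg_left (add_le_add h8 h9) hS0.le
      rw [h10] at f3
      have f4 : S * (b ^ 2 * (a ^ 2 * Ea) + a ^ 2 * (b ^ 2 * Eb)) = P ^ 2 * (S * (Ea + Eb)) := by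
        rw [hP]; ring
      linarith
    exact le_of_mul_le_mul_left h12 (by positivity)

lemma UnitArc.dist_le (hX : UnitArc X T k) {a b : ℝ} (hab : a ≤ b) : dist (X b) (X a) ≤ b - a := by
  have := Convex.norm_image_sub_le_of_norm_hasDerivWithin_le (f := X) (s := univ)
    (x := a) (y := b) (C := 1) (fun x _ => (hX.hasDerivAt_X x).hasDerivWithinAt)
    (fun x _ => (hX.norm_T x).le) convex_univ (mem_univ _) (mem_univ _)
  rw [dist_eq_norm]
  simpa [abs_of_nonneg (sub_nonneg.2 hab)] using this

/-- If the outward normal at a boundary point `z` points against the curve at its start, then the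
curve cannot advance much between its start and the vicinity of `z`. -/
lemma FBArc.inner_start_le (hX : FBArc Ω X T k L) (hΩ : IsConvexC2Domain Ω) {z : Plane}
    (hz : z ∈ frontier Ω) (hside : inner ℝ (T 0) (outwardNormal Ω z) ≤ 0) {s : ℝ} (hs : 0 ≤ s) :
    inner ℝ (X s - X 0) (T 0) ≤ dist (X s) z +
      |inner ℝ (T 0) (boundaryTangent Ω z)| * (dist (X s) z + s) := by
  have hn := hΩ.norm_outwardNormal hz
  set e := |inner ℝ (T 0) (boundaryTangent Ω z)|
  have h1 : inner ℝ (X s - z) (T 0) ≤ dist (X s) z := by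
    rw [dist_eq_norm]
    have := real_inner_le_norm (X s - z) (T 0)
    rwa [hX.norm_T, mul_one] at this
  have h2 := hΩ.support hz (hΩ.isClosed.frontier_subset hX.zero_mem)
  have h3 : inner ℝ (z - X 0) (T 0) ≤ e * (dist (X s) z + s) := by
    rw [inner_eq_frame hn (z - X 0) (T 0)]
    have e1 : 0 ≤ inner ℝ (z - X 0) (outwardNormal Ω z) := by
      rw [real_inner_comm, ← neg_sub, inner_neg_right]; linarith
    have e2 : ‖z - X 0‖ ≤ dist (X s) z + s := by
      have f1 := hX.dist_le hs
      rw [sub_zero] at f1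
      rw [← dist_eq_norm]
      have := dist_triangle z (X s) (X 0)
      rw [dist_comm z (X s)] at this
      linarith
    have e3 : inner ℝ (z - X 0) (rotJ (outwardNormal Ω z)) *
        inner ℝ (T 0) (rotJ (outwardNormal Ω z)) ≤ (dist (X s) z + s) * e := by
      refine (le_abs_self _).trans ?_
      rw [abs_mul]
      apply mul_le_mul_of_nonneg_right _ (abs_nonneg _)
      refine (abs_real_inner_le_norm _ _).trans ?_
      rw [norm_rotJ, hn, mul_one]
      exact e2
    have e4 := mul_nonpos_of_nonneg_of_nonpos e1 hside
    linarith
  have h4 : inner ℝ (X s - X 0) (T 0) = inner ℝ (X s - z) (T 0) + inner ℝ (z - X 0) (T 0) := by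
    rw [← inner_add_left]; simp
  linarith

/-- The energy estimate for a reflection point on the same side as the starting point. -/
lemma FBArc.energy_start (hX : FBArc Ω X T k L) (hΩ : IsConvexC2Domain Ω) {a b : ℝ}
    (ha : a ∈ Ioo 0 L) (hb : b ∈ Ioo 0 L) {z : Plane} (hz : z ∈ frontier Ω)
    (hdd : dist (X a) z + dist (X b) z ≤ 63 / 2000 * (a + b))
    (hside : inner ℝ (T 0) (outwardNormal Ω z) ≤ 0)
    (hG : |inner ℝ (T 0) (boundaryTangent Ω z)| ≤ 3 / 10000) :
    147 / 10 ≤ (a + b) * ((∫ s in 0..a, k s ^ 2) + ∫ s in 0..b, k s ^ 2) := by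
  have hpos : ∀ s ∈ Ioo 0 L, _ := fun s hs => hX.inner_start_le hΩ hz hside hs.1.le
  have hdist : dist (X a) (X b) ≤ dist (X a) z + dist (X b) z := by
    have := dist_triangle (X a) z (X b)
    rwa [dist_comm z (X b)] at this
  rcases le_total a b with hab | hab
  · exact hX.positional_energy ha.1 hab dist_nonneg dist_nonneg hdd hG hdist
      (hpos a ha) (hpos b hb)
  · have := hX.positional_energy hb.1 hab dist_nonneg dist_nonneg (by linarith) hG
      (by rw [dist_comm, add_comm]; exact hdist) (hpos b hb) (hpos a ha)
    rw [add_comm a b, add_comm (∫ s in 0..a, k s ^ 2)]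
    exact this

/-- The energy estimate for a reflection point on the same side as the end point. -/
lemma FBArc.energy_end (hX : FBArc Ω X T k L) (hΩ : IsConvexC2Domain Ω) {a b : ℝ}
    (ha : a ∈ Ioo 0 L) (hb : b ∈ Ioo 0 L) {z : Plane} (hz : z ∈ frontier Ω)
    (hdd : dist (X a) z + dist (X b) z ≤ 63 / 2000 * (2 * L - (a + b)))
    (hside : 0 ≤ inner ℝ (T L) (outwardNormal Ω z))
    (hG : |inner ℝ (T L) (boundaryTangent Ω z)| ≤ 3 / 10000) :
    147 / 10 ≤ (2 * L - (a + b)) * ((∫ s in a..L, k s ^ 2) + ∫ s in b..L, k s ^ 2) := by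
  have h := hX.reversed.energy_start hΩ (a := L - a) (b := L - b)
    ⟨by linarith [ha.2], by linarith [ha.1]⟩ ⟨by linarith [hb.2], by linarith [hb.1]⟩ hz
    (by simp only [sub_sub_cancel]; linarith)
    (by simp only [sub_zero, inner_neg_left]; linarith)
    (by simp only [sub_zero, inner_neg_left, abs_neg]; exact hG)
  simp only [neg_sq] at h
  rw [intervalIntegral.integral_comp_sub_left (fun s => k s ^ 2),
    intervalIntegral.integral_comp_sub_left (fun s => k s ^ 2)] at h
  simp only [sub_zero, sub_sub_cancel] at h
  rw [show L - a + (L - b) = 2 * L - (a + b) by ring] at h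
  exact h

/-- A unit vector with small component along `J n` is a small rotation of `n` or of `-n`; the
second case is encoded by an extra rotation by `π`. -/
lemma exists_rot_small_or {n v : Plane} (hn : ‖n‖ = 1) (hv : ‖v‖ = 1) {e : ℝ}
    (h : |inner ℝ v (rotJ n)| ≤ e) :
    ∃ ρ : ℝ, |ρ| ≤ Real.pi / 2 * e ∧
      ((0 ≤ inner ℝ v n ∧ v = rot ρ n) ∨ (inner ℝ v n ≤ 0 ∧ v = rot (ρ + Real.pi) n)) := by
  rcases le_total 0 (inner ℝ v n) with h0 | h0
  · obtain ⟨ρ, h1, h2⟩ := exists_rot_small hn hv h h0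
    exact ⟨ρ, h1, Or.inl ⟨h0, h2⟩⟩
  · obtain ⟨ρ, h1, h2⟩ := exists_rot_small (v := n) (w := -v) (e := e) hn (by rwa [norm_neg])
      (by rwa [inner_neg_left, abs_neg]) (by rw [inner_neg_left, neg_nonneg]; exact h0)
    refine ⟨ρ, h1, Or.inr ⟨h0, ?_⟩⟩
    rw [add_comm, ← rot_rot, rot_pi, ← h2, neg_neg]

lemma abs_pi_mul_ge {j : ℤ} (hj : j ≠ 0) (x : ℝ) :
    Real.pi - |x| ≤ |Real.pi * j + x| := by
  have h1 : (1 : ℝ) ≤ |(j : ℝ)| := by exact_mod_cast Int.one_le_abs hj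
  have h2 : Real.pi * 1 ≤ |Real.pi * j| := by
    rw [abs_mul, abs_of_pos Real.pi_pos]; gcongr
  have h3 := abs_sub_abs_le_abs_sub (Real.pi * j) (-x)
  rw [abs_neg, sub_neg_eq_add] at h3
  linarith

/-- If `j + m` is not a multiple of `4`, then `j, m` are both `1`, or both `-1`, or one of them is at
least `3` in absolute value; so if `ν` shortens one of the angles `π j + ν` and `π m - ν`, the other
one makes up for it. -/
lemma exists_turning_split {j m : ℤ} (hj : Odd j) (hm : Odd m) (hjm : ¬ (4 : ℤ) ∣ j + m)
    {ν ρ₀ ρ₁ ω' : ℝ} (hν : |ν| ≤ 1) (h₀ : |ρ₀| ≤ ω') (h₁ : |ρ₁| ≤ ω') :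
    ∃ ν' : ℝ, |ν'| ≤ |ν| ∧ Real.pi + ν' - 2 * ω' ≤ |Real.pi * j + ν - 2 * ρ₀| ∧
      Real.pi - ν' - 2 * ω' ≤ |Real.pi * m - ν + 2 * ρ₁| := by
  have hpi := Real.pi_gt_three
  have g₀ := abs_le.1 h₀
  have g₁ := abs_le.1 h₁
  have gν := abs_le.1 (le_refl |ν|)
  have big : ∀ i : ℤ, 3 ≤ |i| → ∀ x : ℝ, |x| ≤ |ν| + 2 * ω' →
      Real.pi + |ν| - 2 * ω' ≤ |Real.pi * i + x| := by
    intro i hi x hx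
    have h1 : (3 : ℝ) ≤ |(i : ℝ)| := by exact_mod_cast hi
    have h2 : Real.pi * 3 ≤ |Real.pi * i| := by
      rw [abs_mul, abs_of_pos Real.pi_pos]; gcongr
    have h3 := abs_sub_abs_le_abs_sub (Real.pi * i) (-x)
    rw [abs_neg, sub_neg_eq_add] at h3
    linarith
  have small : ∀ i : ℤ, i ≠ 0 → ∀ x : ℝ, |x| ≤ |ν| + 2 * ω' →
      Real.pi - |ν| - 2 * ω' ≤ |Real.pi * i + x| := by
    intro i hi x hx
    have := abs_pi_mul_ge hi x
    linarith
  have hx₀ : |ν - 2 * ρ₀| ≤ |ν| + 2 * ω' := by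
    rw [abs_le]; constructor <;> linarith
  have hx₁ : |-ν + 2 * ρ₁| ≤ |ν| + 2 * ω' := by
    rw [abs_le]; constructor <;> linarith
  have hj0 : j ≠ 0 := by rintro rfl; exact absurd hj (by decide)
  have hm0 : m ≠ 0 := by rintro rfl; exact absurd hm (by decide)
  rw [show Real.pi * j + ν - 2 * ρ₀ = Real.pi * j + (ν - 2 * ρ₀) by ring,
    show Real.pi * m - ν + 2 * ρ₁ = Real.pi * m + (-ν + 2 * ρ₁) by ring]
  -- an odd multiple of `π` other than `± π` leaves plenty of room
  by_cases hj3 : 3 ≤ |j|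
  · exact ⟨|ν|, by rw [abs_abs], big j hj3 _ hx₀, small m hm0 _ hx₁⟩
  by_cases hm3 : 3 ≤ |m|
  · refine ⟨-|ν|, by rw [abs_neg, abs_abs], ?_, ?_⟩
    · have := small j hj0 _ hx₀; linarith
    · have := big m hm3 _ hx₁; linarith
  obtain ⟨j', rfl⟩ := hj
  obtain ⟨m', rfl⟩ := hm
  -- the two signs agree, and then the perturbations `ν` and `-ν` cancel
  have hcase : (2 * j' + 1 = 1 ∧ 2 * m' + 1 = 1) ∨ (2 * j' + 1 = -1 ∧ 2 * m' + 1 = -1) := by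
    have a1 := abs_lt.1 (not_le.1 hj3)
    have a2 := abs_lt.1 (not_le.1 hm3)
    omega
  rcases hcase with ⟨e1, e2⟩ | ⟨e1, e2⟩
  · rw [e1, e2]
    refine ⟨ν, le_rfl, ?_, ?_⟩
    · refine le_trans ?_ (le_abs_self _)
      push_cast; linarith
    · refine le_trans ?_ (le_abs_self _)
      push_cast; linarith
  · rw [e1, e2]
    refine ⟨-ν, by rw [abs_neg], ?_, ?_⟩
    · refine le_trans ?_ (neg_le_abs _)
      push_cast; linarith
    · refine le_trans ?_ (neg_le_abs _)
      push_cast; linarith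

end Energy

/-! ### Rate of change at an extremal reflected chord -/

section ReflectedRate

variable {Ω : Set Plane} {X T : ℝ → Plane} {k : ℝ → ℝ} {L c ε : ℝ}

/-- The total turning of the curve between its ends and two points at which reflected chords make
equal angles with it: up to small errors both sums of turning angles are odd multiples of `π`. -/
lemma UnitArc.exists_turning (hX : UnitArc X T k) {a b : ℝ} {n w w' : Plane} (hn : ‖n‖ = 1)
    (hw : ‖w‖ = 1) (hw' : ‖w'‖ = 1) {ρ₀ ρ₁ : ℝ} {k₀ k₁ : ℤ}
    (h₀ : T 0 = rot (ρ₀ + Real.pi * k₀) n) (h₁ : T L = rot (ρ₁ + Real.pi * k₁) n)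
    (hwn : inner ℝ w' n = inner ℝ w n) (hwJ : inner ℝ w' (rotJ n) = -inner ℝ w (rotJ n))
    (hT : inner ℝ (T b) w' = inner ℝ (T a) w)
    (hJ : inner ℝ (T b) (rotJ w') = inner ℝ (T a) (rotJ w)) :
    ∃ (j m : ℤ) (ν : ℝ), Odd j ∧ Odd m ∧ (Odd (k₁ - k₀) → ¬ (4 : ℤ) ∣ j + m) ∧
      |ν| ≤ Real.pi * |inner ℝ (T a) w| ∧
      (∫ s in 0..a, k s) + (∫ s in 0..b, k s) = Real.pi * j + ν - 2 * ρ₀ ∧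
      (∫ s in a..L, k s) + (∫ s in b..L, k s) = Real.pi * m - ν + 2 * ρ₁ := by
  obtain ⟨ψ, hψ⟩ := exists_rot_eq hn hw
  have hψ' : w' = rot (-ψ) n := by
    apply ext_frame hn
    · rw [hwn, hψ, inner_rot_self _ hn, inner_rot_self _ hn, Real.cos_neg]
    · rw [hwJ, hψ, inner_rot_rotJ _ hn, inner_rot_rotJ _ hn, Real.sin_neg]
  have hJw : ‖rotJ w‖ = 1 := by rw [norm_rotJ, hw]
  have hquarter : ∀ v : Plane, rotJ v = rot (Real.pi / 2) v := fun v => by simp [rot]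
  -- the common angle between tangent and chord
  obtain ⟨δ, i, hδ, hi, hTa⟩ : ∃ (δ : ℝ) (i : ℤ), |δ| ≤ Real.pi / 2 * |inner ℝ (T a) w| ∧ Odd i ∧
      T a = rot (δ + Real.pi / 2 * i) w := by
    obtain ⟨δ, hδ, hcase⟩ := exists_rot_small_or (e := |inner ℝ (T a) w|) hJw (hX.norm_T a)
      (by rw [rotJ_rotJ, inner_neg_right, abs_neg])
    rcases hcase with ⟨-, h⟩ | ⟨-, h⟩
    · refine ⟨δ, 1, hδ, by decide, ?_⟩
      rw [h, hquarter, rot_rot]; push_cast; ring_nf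
    · refine ⟨δ, 3, hδ, by decide, ?_⟩
      rw [h, hquarter, rot_rot]; push_cast; ring_nf
  have hTb : T b = rot (δ + Real.pi / 2 * i) w' := by
    apply ext_frame hw'
    · rw [hT, hTa, inner_rot_self _ hw, inner_rot_self _ hw']
    · rw [hJ, hTa, inner_rot_rotJ _ hw, inner_rot_rotJ _ hw']
  have ea := hX.T_eq_rot 0 a
  have eb := hX.T_eq_rot 0 b
  have eL := hX.T_eq_rot 0 L
  have i1 : (∫ s in 0..a, k s) + (∫ s in a..L, k s) = ∫ s in 0..L, k s :=
    intervalIntegral.integral_add_adjacent_intervals (hX.continuous_k.intervalIntegrable _ _)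
      (hX.continuous_k.intervalIntegrable _ _)
  have i2 : (∫ s in 0..b, k s) + (∫ s in b..L, k s) = ∫ s in 0..L, k s :=
    intervalIntegral.integral_add_adjacent_intervals (hX.continuous_k.intervalIntegrable _ _)
      (hX.continuous_k.intervalIntegrable _ _)
  rw [hTa, hψ, h₀, rot_rot, rot_rot] at ea
  rw [hTb, hψ', h₀, rot_rot, rot_rot] at eb
  rw [h₁, h₀, rot_rot] at eL
  obtain ⟨m1, e1⟩ := rot_eq_rot hn ea
  obtain ⟨m2, e2⟩ := rot_eq_rot hn eb
  obtain ⟨m3, e3⟩ := rot_eq_rot hn eL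
  refine ⟨i - 2 * k₀ - 2 * (m1 + m2), 2 * (k₁ - k₀) - 4 * m3 - (i - 2 * k₀ - 2 * (m1 + m2)), 2 * δ,
    ?_, ?_, ?_, ?_, ?_, ?_⟩
  · obtain ⟨r, rfl⟩ := hi
    exact ⟨r - k₀ - (m1 + m2), by ring⟩
  · obtain ⟨r, rfl⟩ := hi
    exact ⟨(k₁ - k₀) - 2 * m3 - r + k₀ + (m1 + m2) - 1, by ring⟩
  · rintro ⟨r, hr⟩ ⟨t, ht⟩
    omega
  · rw [abs_mul, abs_two]; linarith
  · push_cast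
    linear_combination -e1 - e2
  · push_cast
    linear_combination i1 + i2 - 2 * e3 + e1 + e2

/-- At a reflected chord on which equality holds, the rate of change of
`d̃ - 𝐋 φ(ℓ̃/𝐋)` along the flow is positive. -/
theorem FBArc.reflected_rate_pos (hX : FBArc Ω X T k L) (hΩ : IsConvexC2Domain Ω)
    (hε : ε ∈ Ioo (0 : ℝ) (1 / 10)) (hc : c ∈ Ioo (0 : ℝ) (1 / 100))
    (hR : ReflectedBound Ω X L c ε) {a b : ℝ} (ha : a ∈ Ioo 0 L) (hb : b ∈ Ioo 0 L) {z : Plane}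
    (hz : z ∈ frontier Ω)
    (hG₀ : |inner ℝ (T 0) (boundaryTangent Ω z)| ≤ ε / 375)
    (hG₁ : |inner ℝ (T L) (boundaryTangent Ω z)| ≤ ε / 375)
    (heq : dist (X a) z + dist (X b) z = 2 * L * model c ε ((a + b) / (2 * L))) :
    0 < inner ℝ (‖X a - z‖⁻¹ • (X a - z)) (k a • rotJ (T a)) +
        inner ℝ (‖X b - z‖⁻¹ • (X b - z)) (k b • rotJ (T b)) +
      2 * (∫ s in 0..L, k s ^ 2) * (model c ε ((a + b) / (2 * L)) -
        (a + b) / (2 * L) * model' c ε ((a + b) / (2 * L))) +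
      model' c ε ((a + b) / (2 * L)) * ((∫ s in 0..a, k s ^ 2) + ∫ s in 0..b, k s ^ 2) := by
  have hL := hX.L_pos
  have hpi := Real.pi_gt_d4
  have hpi' := Real.pi_lt_d4
  have hε0 := hε.1
  have hε1 := hε.2
  obtain ⟨w, hw⟩ : ∃ w, w = ‖X a - z‖⁻¹ • (X a - z) := ⟨_, rfl⟩
  obtain ⟨w', hw'⟩ : ∃ w', w' = ‖X b - z‖⁻¹ • (X b - z) := ⟨_, rfl⟩
  obtain ⟨f1, f2, f3, f4⟩ := hX.first_variation_reflected hΩ hR ha hb hz heq hw hw'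
  rw [← hw, ← hw']
  set s := (a + b) / (2 * L) with hs
  have hs0 : 0 < s := div_pos (by linarith [ha.1, hb.1]) (by linarith)
  have hs1 : s < 1 := by rw [hs, div_lt_one (by linarith)]; linarith [ha.2, hb.2]
  have hLs : a + b = 2 * L * s := by rw [hs]; field_simp
  have hLs' : (L - a) + (L - b) = 2 * L * (1 - s) := by linarith
  have hn := hΩ.norm_outwardNormal hz
  set n := outwardNormal Ω z with hndef
  have hτ : boundaryTangent Ω z = rotJ n := rfl
  rw [hτ] at hG₀ hG₁ f3 f4
  have hmem : ∀ r ∈ Ioo 0 L, X r - z ≠ 0 := fun r hr h => by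
    have := hX.interior_mem r hr
    rw [sub_eq_zero.1 h] at this
    exact hz.2 this
  have hunit : ∀ r ∈ Ioo 0 L, ‖‖X r - z‖⁻¹ • (X r - z)‖ = 1 := fun r hr => by
    rw [norm_smul, norm_inv, norm_norm, inv_mul_cancel₀ (norm_ne_zero_iff.2 (hmem r hr))]
  have hneg : ∀ r ∈ Ioo 0 L, inner ℝ (‖X r - z‖⁻¹ • (X r - z)) n < 0 := fun r hr => by
    rw [inner_smul_left, real_inner_comm]
    have := hΩ.support_lt hz (hX.interior_mem r hr)
    exact mul_neg_of_pos_of_neg (by simpa using hmem r hr) this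
  have hw1 : ‖w‖ = 1 := hw ▸ hunit a ha
  have hw1' : ‖w'‖ = 1 := hw' ▸ hunit b hb
  have hwneg : inner ℝ w n < 0 := hw ▸ hneg a ha
  have hwneg' : inner ℝ w' n < 0 := hw' ▸ hneg b hb
  have hwJ : inner ℝ w' (rotJ n) = -inner ℝ w (rotJ n) := by linarith
  have hwn : inner ℝ w' n = inner ℝ w n := by
    have e1 := norm_sq_eq_frame hn w
    have e2 := norm_sq_eq_frame hn w'
    rw [hw1] at e1
    rw [hw1', hwJ] at e2
    have e3 : inner ℝ w' n ^ 2 = inner ℝ w n ^ 2 := by linarith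
    rcases sq_eq_sq_iff_eq_or_eq_neg.1 e3 with h | h
    · exact h
    · linarith
  have hJJ : inner ℝ (rotJ w') (T b) ^ 2 = inner ℝ (rotJ w) (T a) ^ 2 := by
    have e1 := norm_sq_eq_frame hw1 (T a)
    have e2 := norm_sq_eq_frame hw1' (T b)
    rw [hX.norm_T, real_inner_comm, real_inner_comm (rotJ _)] at e1 e2
    rw [f1] at e1
    rw [f2] at e2
    linarith
  -- positivity of the weights and the energies
  have hu := model_add_pos hε hc.1 hs0.le hs1
  have hv := model_sub_pos hε hc.1 hs0 hs1.le
  have hA0 : 0 ≤ (∫ s in 0..a, k s ^ 2) + ∫ s in 0..b, k s ^ 2 :=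
    add_nonneg (UnitArc.energy_nonneg ha.1.le) (UnitArc.energy_nonneg hb.1.le)
  have hB0 : 0 ≤ (∫ s in a..L, k s ^ 2) + ∫ s in b..L, k s ^ 2 :=
    add_nonneg (UnitArc.energy_nonneg ha.2.le) (UnitArc.energy_nonneg hb.2.le)
  have hAB : 2 * (∫ s in 0..L, k s ^ 2) = ((∫ s in 0..a, k s ^ 2) + ∫ s in 0..b, k s ^ 2) +
      ((∫ s in a..L, k s ^ 2) + ∫ s in b..L, k s ^ 2) := by
    have i1 := intervalIntegral.integral_add_adjacent_intervals (hX.intervalIntegrable_sq 0 a)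
      (hX.intervalIntegrable_sq a L)
    have i2 := intervalIntegral.integral_add_adjacent_intervals (hX.intervalIntegrable_sq 0 b)
      (hX.intervalIntegrable_sq b L)
    linarith
  have hCS : ∀ x y : ℝ, x ≤ y → (∫ s in x..y, k s) ^ 2 ≤ (y - x) * ∫ s in x..y, k s ^ 2 :=
    fun x y hxy => sq_integral_le_of_continuous hX.continuous_k hxy
  have hS₁ : ((∫ s in 0..a, k s) + ∫ s in 0..b, k s) ^ 2 ≤
      2 * L * s * ((∫ s in 0..a, k s ^ 2) + ∫ s in 0..b, k s ^ 2) := by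
    have e1 := hCS 0 a ha.1.le
    have e2 := hCS 0 b hb.1.le
    rw [sub_zero] at e1 e2
    rw [← hLs]
    exact sq_add_le_of_sq_le ha.1 hb.1 e1 e2
  have hS₂ : ((∫ s in a..L, k s) + ∫ s in b..L, k s) ^ 2 ≤
      2 * L * (1 - s) * ((∫ s in a..L, k s ^ 2) + ∫ s in b..L, k s ^ 2) := by
    rw [← hLs']
    exact sq_add_le_of_sq_le (by linarith [ha.2]) (by linarith [hb.2]) (hCS a L ha.2.le)
      (hCS b L hb.2.le)
  have hstart : inner ℝ (T 0) n ≤ 0 →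
      147 / 10 ≤ 2 * L * s * ((∫ s in 0..a, k s ^ 2) + ∫ s in 0..b, k s ^ 2) := by
    intro hside
    rw [← hLs]
    refine hX.energy_start hΩ ha hb hz ?_ hside (hG₀.trans (by linarith))
    rw [heq, hLs]
    have := mul_le_mul_of_nonneg_left (model_le_mul hε hc hs0.le) (by linarith : 0 ≤ 2 * L)
    linarith
  have hend : 0 ≤ inner ℝ (T L) n →
      147 / 10 ≤ 2 * L * (1 - s) * ((∫ s in a..L, k s ^ 2) + ∫ s in b..L, k s ^ 2) := by
    intro hside
    rw [← hLs', show L - a + (L - b) = 2 * L - (a + b) by ring]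
    refine hX.energy_end hΩ ha hb hz ?_ hside (hG₁.trans (by linarith))
    rw [heq, show 2 * L - (a + b) = 2 * L * (1 - s) by linarith]
    have := mul_le_mul_of_nonneg_left (model_le_mul' hε hc hs1.le) (by linarith : 0 ≤ 2 * L)
    linarith
  obtain ⟨ρ₀, hρ₀, hcase₀⟩ := exists_rot_small_or hn (hX.norm_T 0) hG₀
  obtain ⟨ρ₁, hρ₁, hcase₁⟩ := exists_rot_small_or hn (hX.norm_T L) hG₁
  have hsmall : Real.pi / 2 * (ε / 375) ≤ ε / 200 := by nlinarith only [hε0, hpi']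
  replace hρ₀ := hρ₀.trans hsmall
  replace hρ₁ := hρ₁.trans hsmall
  have hφ'1 := abs_model'_le (s := s) hε hc
  set A := (∫ s in 0..a, k s ^ 2) + ∫ s in 0..b, k s ^ 2
  set B := (∫ s in a..L, k s ^ 2) + ∫ s in b..L, k s ^ 2
  set u := model c ε s + (1 - s) * model' c ε s with hudef
  set v := model c ε s - s * model' c ε s with hvdef
  have hgoal : ∀ Q : ℝ, Q + 2 * (∫ s in 0..L, k s ^ 2) * v + model' c ε s * A =
      Q + (A * u + B * v) := by
    intro Q; rw [hAB, hudef, hvdef]; ring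
  rw [hgoal]
  -- the curvature terms, for a reflection point moving so that the chords do not rotate
  have hsecond : ∀ q : ℝ, q ^ 2 = 1 → q * inner ℝ (rotJ w') (T b) = inner ℝ (rotJ w) (T a) →
      (1 + q) ^ 2 * model'' c ε s / (2 * L) ≤
        inner ℝ w (k a • rotJ (T a)) + inner ℝ w' (k b • rotJ (T b)) := by
    intro q hq hqJ
    have := f4 1 q (inner ℝ (rotJ w) (T a) / inner ℝ w n)
    have e1 : inner ℝ (rotJ w) (T a) / inner ℝ w n * inner ℝ w n = inner ℝ (rotJ w) (T a) :=
      div_mul_cancel₀ _ hwneg.ne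
    simp only [inner_sub_right, inner_smul_right, inner_rotJ_rotJ, hwn, hqJ, hq, e1, one_mul,
      one_pow, sub_self] at this
    simp only [inner_smul_right]
    simpa using this
  have hE4 : 2 * L * s > 0 := by positivity
  have hE5 : 2 * L * (1 - s) > 0 := mul_pos (by linarith) (by linarith)
  rcases sq_eq_sq_iff_eq_or_eq_neg.1 hJJ with hJ | hJ
  · -- the angles between chords and curve agree: the two points of the curve move in the same sense
    have hK := hsecond 1 (by norm_num) (by rw [one_mul, hJ])
    have hreduce : ∀ α β : ℝ, α ≤ 2 * L * s * A → β ≤ 2 * L * (1 - s) * B →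
        0 < α * (u / s) + β * (v / (1 - s)) + 4 * model'' c ε s →
        0 < inner ℝ w (k a • rotJ (T a)) + inner ℝ w' (k b • rotJ (T b)) + (A * u + B * v) := by
      intro α β hα hβ hpos
      have e1 : α * (u / s) ≤ 2 * L * (A * u) := by
        calc α * (u / s) ≤ (2 * L * s * A) * (u / s) := by gcongr
          _ = _ := by field_simp
      have e2 : β * (v / (1 - s)) ≤ 2 * L * (B * v) := by
        have : 1 - s ≠ 0 := by linarith
        have : 0 ≤ v / (1 - s) := div_nonneg hv.le (by linarith)
        calc β * (v / (1 - s)) ≤ (2 * L * (1 - s) * B) * (v / (1 - s)) := by gcongr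
          _ = _ := by field_simp
      have e3 : 0 < 2 * L * ((1 + 1) ^ 2 * model'' c ε s / (2 * L) + (A * u + B * v)) := by
        have : 2 * L * ((1 + 1) ^ 2 * model'' c ε s / (2 * L) + (A * u + B * v)) =
          4 * model'' c ε s + (2 * L * (A * u) + 2 * L * (B * v)) := by field_simp; ring
        rw [this]; linarith
      have e4 := pos_of_mul_pos_right e3 (by linarith)
      linarith
    have hturn : ∀ k₀ k₁ : ℤ, T 0 = rot (ρ₀ + Real.pi * k₀) n →
        T L = rot (ρ₁ + Real.pi * k₁) n → _ := fun k₀ k₁ h₀ h₁ =>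
      hX.toUnitArc.exists_turning (a := a) (b := b) hn hw1 hw1' h₀ h₁ hwn hwJ
        (by rw [real_inner_comm, f2, real_inner_comm, f1])
        (by rw [real_inner_comm, hJ, real_inner_comm])
    rw [real_inner_comm, f1] at hturn
    have hnu : ∀ ν : ℝ, |ν| ≤ Real.pi * |model' c ε s| → |ν| ≤ 99 / 1000 := by
      intro ν hν
      have : Real.pi * |model' c ε s| ≤ 3.1416 * (63 / 2000) := by gcongr
      linarith
    -- `3.04² ≥ 9.2`
    have hangle : ∀ (j : ℤ) (x ρ ν : ℝ), Odd j → |ν| ≤ 99 / 1000 → |ρ| ≤ ε / 200 →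
        |x| ≤ |ν| + 2 * |ρ| → 92 / 10 ≤ (Real.pi * j + x) ^ 2 := by
      intro j x ρ ν hj h1 h2 h3
      have h4 := abs_pi_mul_ge (j := j) (by rintro rfl; exact absurd hj (by decide)) x
      have h5 : 304 / 100 ≤ |Real.pi * j + x| := by linarith
      rw [← sq_abs]
      nlinarith only [h5]
    have hopposite : ∀ k₀ k₁ : ℤ, T 0 = rot (ρ₀ + Real.pi * k₀) n →
        T L = rot (ρ₁ + Real.pi * k₁) n → Odd (k₁ - k₀) →
        0 < inner ℝ w (k a • rotJ (T a)) + inner ℝ w' (k b • rotJ (T b)) + (A * u + B * v) := by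
      intro k₀ k₁ h₀ h₁ hodd
      obtain ⟨j, m, ν, hj, hm, hjm, hν, e1, e2⟩ := hturn k₀ k₁ h₀ h₁
      obtain ⟨ν', g1, g2, g3⟩ := exists_turning_split hj hm (hjm hodd)
        ((hnu ν hν).trans (by norm_num)) hρ₀ hρ₁
      have g4 := abs_le.1 (g1.trans (hnu ν hν))
      refine hreduce _ _ ((?_ : (Real.pi + ν' - 2 * (ε / 200)) ^ 2 ≤ _).trans hS₁)
        ((?_ : (Real.pi - ν' - 2 * (ε / 200)) ^ 2 ≤ _).trans hS₂)
        (model_same_ineq hε hc ⟨hs0, hs1⟩ (g1.trans hν) (by positivity) le_rfl)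
      · rw [e1, ← sq_abs (Real.pi * j + ν - 2 * ρ₀)]
        exact pow_le_pow_left₀ (by linarith) g2 2
      · rw [e2, ← sq_abs (Real.pi * m - ν + 2 * ρ₁)]
        exact pow_le_pow_left₀ (by linarith) g3 2
    have htri : ∀ x y : ℝ, |x - 2 * y| ≤ |x| + 2 * |y| ∧ |-x + 2 * y| ≤ |x| + 2 * |y| := by
      intro x y
      constructor
      · have := abs_sub x (2 * y)
        rwa [abs_mul, abs_two] at this
      · have := abs_add_le (-x) (2 * y)
        rwa [abs_mul, abs_two, abs_neg] at this
    -- the directions of the two ends of the curve relative to the normal at the reflection point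
    rcases hcase₀ with ⟨p₀, h₀⟩ | ⟨p₀, h₀⟩ <;> rcases hcase₁ with ⟨p₁, h₁⟩ | ⟨p₁, h₁⟩
    · obtain ⟨j, m, ν, hj, hm, hjm, hν, e1, e2⟩ := hturn 0 0 (by simpa using h₀) (by simpa using h₁)
      refine hreduce (92 / 10) (147 / 10) (le_trans ?_ hS₁) (hend p₁) ?_
      · rw [e1, show Real.pi * j + ν - 2 * ρ₀ = Real.pi * j + (ν - 2 * ρ₀) by ring]
        exact hangle j _ ρ₀ ν hj (hnu ν hν) hρ₀ (htri _ _).1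
      · have := model_opposite_ineq hε hc (s := 1 - s) ⟨by linarith, by linarith⟩
        rw [model_symm, model'_symm, model''_symm, sub_sub_cancel] at this
        rw [hudef, hvdef]
        rw [show model c ε s + (1 - s) * model' c ε s = model c ε s - (1 - s) * -model' c ε s by ring,
          show model c ε s - s * model' c ε s = model c ε s + s * -model' c ε s by ring]
        linarith
    · exact hopposite 0 1 (by simpa using h₀) (by simpa using h₁) (by decide)
    · exact hopposite 1 0 (by simpa using h₀) (by simpa using h₁) (by decide)
    · obtain ⟨j, m, ν, hj, hm, hjm, hν, e1, e2⟩ := hturn 1 1 (by simpa using h₀) (by simpa using h₁)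
      refine hreduce (147 / 10) (92 / 10) (hstart p₀) (le_trans ?_ hS₂)
        (model_opposite_ineq hε hc ⟨hs0, hs1⟩)
      rw [e2, show Real.pi * m - ν + 2 * ρ₁ = Real.pi * m + (-ν + 2 * ρ₁) by ring]
      exact hangle m _ ρ₁ ν hm (hnu ν hν) hρ₁ (htri _ _).2
  · -- the angles have opposite signs: the two points move in opposite senses, and the model term drops out
    have hK := hsecond (-1) (by norm_num) (by rw [hJ]; ring)
    norm_num at hK
    -- otherwise the curve is a segment, and the reflection point is on neither side of it
    have hAB0 : 0 < A ∨ 0 < B := by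
      by_contra hcon
      have hA : A = 0 := le_antisymm (by by_contra h; exact hcon (Or.inl (not_le.1 h))) hA0
      have hB : B = 0 := le_antisymm (by by_contra h; exact hcon (Or.inr (not_le.1 h))) hB0
      have g1 : 0 < inner ℝ (T 0) n := by
        by_contra h
        have := hstart (not_lt.1 h)
        rw [hA] at this; linarith
      have g2 : inner ℝ (T L) n < 0 := by
        by_contra h
        have := hend (not_lt.1 h)
        rw [hB] at this; linarith
      have g3 := hCS 0 L hL.le
      have g4 : ∫ s in 0..L, k s ^ 2 = 0 := by linarith
      rw [g4, mul_zero] at g3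
      have g5 := hX.T_eq_rot 0 L
      rw [pow_eq_zero_iff (by norm_num) |>.1 (le_antisymm g3 (sq_nonneg _)), rot_zero] at g5
      rw [g5] at g2
      linarith
    have : 0 < A * u + B * v := by
      rcases hAB0 with h | h
      · have := mul_pos h hu
        have := mul_nonneg hB0 hv.le
        linarith
      · have := mul_nonneg hA0 hu.le
        have := mul_pos h hv
        linarith
    simp only [inner_smul_right] at hK ⊢
    linarith

end ReflectedRate

/-! ### Short chords -/

section Short

variable {Ω : Set Plane} {X T : ℝ → Plane} {k : ℝ → ℝ} {L c ε : ℝ}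

/-- The boundary of `Ω` turns by a small angle only between an endpoint of the curve and any
boundary point within twice the length of the curve. -/
structure SmallTurning (Ω : Set Plane) (X T : ℝ → Plane) (L ε : ℝ) : Prop where
  start : ∀ z ∈ frontier Ω, dist z (X 0) ≤ 2 * L →
    |inner ℝ (T 0) (boundaryTangent Ω z)| ≤ ε / 375
  finish : ∀ z ∈ frontier Ω, dist z (X L) ≤ 2 * L →
    |inner ℝ (T L) (boundaryTangent Ω z)| ≤ ε / 375

lemma SmallTurning.reversed (h : SmallTurning Ω X T L ε) :
    SmallTurning Ω (fun s => X (L - s)) (fun s => -T (L - s)) L ε where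
  start z hz hd := by
    simp only [sub_zero, inner_neg_left, abs_neg] at hd ⊢
    exact h.finish z hz hd
  finish z hz hd := by
    simp only [sub_self, inner_neg_left, abs_neg] at hd ⊢
    exact h.start z hz hd

/-- A chord which is short compared to the radius of curvature is nearly as long as its arc. -/
lemma UnitArc.direct_short (hX : UnitArc X T k) (hL : 0 < L)
    (hε : ε ∈ Ioo (0 : ℝ) (1 / 10)) (hc : c ∈ Ioo (0 : ℝ) (1 / 100))
    {M : ℝ} (hM : ∀ s ∈ Icc 0 L, |k s| ≤ M) {a₀ : ℝ} (hMa : a₀ * M ≤ 1 / 2)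
    {a b : ℝ} (ha : 0 ≤ a) (hab : a < b) (hb : b ≤ L) (hba : b - a ≤ a₀) :
    2 * L * model c ε ((b - a) / (2 * L)) < dist (X a) (X b) := by
  have hM0 : 0 ≤ M := (abs_nonneg _).trans (hM 0 (left_mem_Icc.2 hL.le))
  have h1 := hX.inner_chord_start_ge_of_bound hab.le
    (fun s hs => hM s ⟨ha.trans hs.1, hs.2.trans hb⟩)
    ((mul_le_mul_of_nonneg_right hba hM0).trans hMa)
  have h2 := real_inner_le_norm (X b - X a) (T a)
  rw [hX.norm_T, mul_one, ← dist_eq_norm, dist_comm] at h2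
  have h3 := mul_le_mul_of_nonneg_left (model_le_mul hε hc (s := (b - a) / (2 * L))
    (div_nonneg (by linarith) (by linarith))) (by linarith : 0 ≤ 2 * L)
  have h4 : 2 * L * (63 / 2000 * ((b - a) / (2 * L))) = 63 / 2000 * (b - a) := by field_simp
  linarith

/-- A short reflected chord near the start of the curve satisfies the strict inequality. -/
lemma FBArc.reflected_short (hX : FBArc Ω X T k L) (hΩ : IsConvexC2Domain Ω)
    (hε : ε ∈ Ioo (0 : ℝ) (1 / 10)) (hc : c ∈ Ioo (0 : ℝ) (1 / 100))
    (hG : SmallTurning Ω X T L ε) {M : ℝ} (hM : ∀ s ∈ Icc 0 L, |k s| ≤ M) {a₀ : ℝ}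
    (ha₀ : a₀ ≤ L) (hMa : a₀ * M ≤ 1 / 2) {a b : ℝ} (ha : 0 ≤ a) (hb : 0 ≤ b) (hab : 0 < a + b)
    (hab' : a + b ≤ a₀ / 4) {z : Plane} (hz : z ∈ frontier Ω) :
    2 * L * model c ε ((a + b) / (2 * L)) < dist (X a) z + dist (X b) z := by
  wlog hba : b ≤ a generalizing a b
  · rw [add_comm a b, add_comm (dist (X a) z)]
    exact this hb ha (by linarith) (by linarith) (by linarith)
  by_contra hcon
  have hL := hX.L_pos
  have hM0 : 0 ≤ M := (abs_nonneg _).trans (hM 0 (left_mem_Icc.2 hL.le))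
  have h3 := mul_le_mul_of_nonneg_left (model_le_mul hε hc (s := (a + b) / (2 * L))
    (div_nonneg (by linarith) (by linarith))) (by linarith : 0 ≤ 2 * L)
  have h4 : 2 * L * (63 / 2000 * ((a + b) / (2 * L))) = 63 / 2000 * (a + b) := by field_simp
  have h5 : dist (X a) z ≤ 63 / 1000 * a := by
    have := dist_nonneg (x := X b) (y := z)
    linarith
  have h6 := hX.dist_le ha
  have h7 := dist_triangle z (X a) (X 0)
  rw [dist_comm z (X a)] at h7
  have he := (hG.start z hz (by linarith)).trans (by linarith [hε.2] : ε / 375 ≤ 3 / 10000)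
  rcases le_or_gt (inner ℝ (T 0) (outwardNormal Ω z)) 0 with hside | hside
  · -- the curve starts by moving away from the tangent line at `z`
    have h8 := hX.inner_start_le hΩ hz hside ha
    have h9 := hX.inner_chord_start_ge_of_bound ha
      (fun s hs => hM s ⟨hs.1, by linarith [hs.2]⟩)
      ((mul_le_mul_of_nonneg_right (by linarith : a - 0 ≤ a₀) hM0).trans hMa)
    have h10 : |inner ℝ (T 0) (boundaryTangent Ω z)| * (dist (X a) z + a) ≤
        3 / 10000 * (63 / 1000 * a + a) := by gcongr
    linarith
  · -- the point at arclength `a₀` would lie beyond the tangent line at `z`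
    have ha₀0 : 0 ≤ a₀ := by linarith
    have h9 := hX.inner_chord_start_ge_of_bound ha₀0
      (fun s hs => hM s ⟨hs.1, hs.2.trans ha₀⟩) (by rwa [sub_zero])
    have h10 := hΩ.support hz (hX.mem hΩ.isClosed ⟨ha₀0, ha₀⟩)
    have h11 := hX.dist_le ha₀0
    have h12 : inner ℝ (X a₀ - X 0) (T 0) = inner ℝ (X a₀ - z) (T 0) + inner ℝ (z - X 0) (T 0) := by
      rw [← inner_add_left]; simp
    have h13 := real_inner_le_norm (z - X 0) (T 0)
    rw [hX.norm_T, mul_one, ← dist_eq_norm] at h13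
    have hn := hΩ.norm_outwardNormal hz
    have h14 : inner ℝ (X a₀ - z) (T 0) ≤ dist (X a₀) z * (3 / 10000) := by
      rw [inner_eq_frame hn (X a₀ - z) (T 0)]
      have e1 : inner ℝ (X a₀ - z) (outwardNormal Ω z) * inner ℝ (T 0) (outwardNormal Ω z) ≤ 0 :=
        mul_nonpos_of_nonpos_of_nonneg (by rwa [real_inner_comm]) hside.le
      have e2 : inner ℝ (X a₀ - z) (rotJ (outwardNormal Ω z)) *
          inner ℝ (T 0) (rotJ (outwardNormal Ω z)) ≤ dist (X a₀) z * (3 / 10000) := by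
        refine (le_abs_self _).trans ?_
        rw [abs_mul]
        refine mul_le_mul ?_ he (abs_nonneg _) dist_nonneg
        refine (abs_real_inner_le_norm _ _).trans ?_
        rw [norm_rotJ, hn, mul_one, dist_eq_norm]
      linarith
    have h15 := dist_triangle (X a₀) (X 0) z
    rw [dist_comm (X 0) z] at h15
    linarith

/-- A short reflected chord near the end of the curve satisfies the strict inequality. -/
lemma FBArc.reflected_short' (hX : FBArc Ω X T k L) (hΩ : IsConvexC2Domain Ω)
    (hε : ε ∈ Ioo (0 : ℝ) (1 / 10)) (hc : c ∈ Ioo (0 : ℝ) (1 / 100))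
    (hG : SmallTurning Ω X T L ε) {M : ℝ} (hM : ∀ s ∈ Icc 0 L, |k s| ≤ M) {a₀ : ℝ}
    (ha₀ : a₀ ≤ L) (hMa : a₀ * M ≤ 1 / 2) {a b : ℝ} (ha : a ≤ L) (hb : b ≤ L)
    (hab : 0 < 2 * L - (a + b)) (hab' : 2 * L - (a + b) ≤ a₀ / 4) {z : Plane}
    (hz : z ∈ frontier Ω) :
    2 * L * model c ε ((a + b) / (2 * L)) < dist (X a) z + dist (X b) z := by
  have hL := hX.L_pos
  have h := hX.reversed.reflected_short hΩ hε hc hG.reversed (M := M) (fun s hs => by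
    rw [abs_neg]; exact hM _ ⟨by linarith [hs.2], by linarith [hs.1]⟩) ha₀ hMa
    (a := L - a) (b := L - b) (by linarith) (by linarith) (by linarith) (by linarith) hz
  simp only [sub_sub_cancel] at h
  rwa [show (L - a + (L - b)) / (2 * L) = 1 - (a + b) / (2 * L) by field_simp; ring,
    model_symm] at h

end Short

/-! ### Regularity of the flow and the evolution of arclength -/

section TimeInterval

variable {T : EReal}

lemma ordConnected_timeInterval : OrdConnected (timeInterval T) :=
  ⟨fun _ hx _ hy _ hz =>
    ⟨hx.1.trans hz.1, (EReal.coe_le_coe_iff.2 hz.2).trans_lt hy.2⟩⟩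

lemma convex_timeInterval : Convex ℝ (timeInterval T) := ordConnected_timeInterval.convex

lemma timeInterval_mem_nhds {t : ℝ} (ht : t ∈ timeInterval T) (h0 : 0 < t) :
    timeInterval T ∈ 𝓝 t := by
  have h1 : ∀ᶠ s : ℝ in 𝓝 t, (s : EReal) < T :=
    continuous_coe_real_ereal.continuousAt.eventually (gt_mem_nhds ht.2)
  filter_upwards [h1, lt_mem_nhds h0] with s hs hs'
  exact ⟨hs'.le, hs⟩

lemma zero_mem_timeInterval (hT : 0 < T) : (0 : ℝ) ∈ timeInterval T := ⟨le_rfl, by simpa using hT⟩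

lemma uniqueDiffOn_timeInterval (hT : 0 < T) : UniqueDiffOn ℝ (timeInterval T) := by
  apply uniqueDiffOn_convex convex_timeInterval
  obtain ⟨r, h0, h1⟩ := EReal.lt_iff_exists_real_btwn.1 hT
  have h0' : 0 < r := by exact_mod_cast h0
  exact ⟨r, mem_interior_iff_mem_nhds.2 (timeInterval_mem_nhds ⟨h0'.le, h1⟩ h0')⟩

lemma Icc_subset_timeInterval {t : ℝ} (ht : t ∈ timeInterval T) : Icc 0 t ⊆ timeInterval T :=
  fun _ hs => ⟨hs.1, (EReal.coe_le_coe_iff.2 hs.2).trans_lt ht.2⟩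

end TimeInterval

section Slices

variable {E : Type*} [NormedAddCommGroup E] [NormedSpace ℝ E] {F : ℝ × ℝ → E} {I : Set ℝ}

lemma DifferentiableOn.hasDerivWithinAt_fst (hF : DifferentiableOn ℝ F (Icc 0 1 ×ˢ I)) {x t : ℝ}
    (hx : x ∈ Icc (0 : ℝ) 1) (ht : t ∈ I) :
    HasDerivWithinAt (fun u => F (u, t)) (fderivWithin ℝ F (Icc 0 1 ×ˢ I) (x, t) (1, 0))
      (Icc 0 1) x := by
  have h1 := (hF (x, t) ⟨hx, ht⟩).hasFDerivWithinAt
  have h2 : HasDerivWithinAt (fun u : ℝ => (u, t)) ((1 : ℝ), (0 : ℝ)) (Icc 0 1) x :=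
    ((hasDerivAt_id x).prodMk (hasDerivAt_const x t)).hasDerivWithinAt
  exact h1.comp_hasDerivWithinAt x h2 fun u hu => (⟨hu, ht⟩ : (u, t) ∈ Icc (0 : ℝ) 1 ×ˢ I)

lemma DifferentiableOn.hasDerivWithinAt_snd (hF : DifferentiableOn ℝ F (Icc 0 1 ×ˢ I)) {x t : ℝ}
    (hx : x ∈ Icc (0 : ℝ) 1) (ht : t ∈ I) :
    HasDerivWithinAt (fun s => F (x, s)) (fderivWithin ℝ F (Icc 0 1 ×ˢ I) (x, t) (0, 1)) I t := by
  have h1 := (hF (x, t) ⟨hx, ht⟩).hasFDerivWithinAt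
  have h2 : HasDerivWithinAt (fun s : ℝ => (x, s)) ((0 : ℝ), (1 : ℝ)) I t :=
    ((hasDerivAt_const t x).prodMk (hasDerivAt_id t)).hasDerivWithinAt
  exact h1.comp_hasDerivWithinAt t h2 fun s hs => (⟨hx, hs⟩ : (x, s) ∈ Icc (0 : ℝ) 1 ×ˢ I)

lemma ContDiffOn.derivWithin_fst (hI : UniqueDiffOn ℝ I) (hF : ContDiffOn ℝ ∞ F (Icc 0 1 ×ˢ I)) :
    ContDiffOn ℝ ∞ (fun p : ℝ × ℝ => derivWithin (fun u => F (u, p.2)) (Icc 0 1) p.1)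
      (Icc 0 1 ×ˢ I) := by
  have hQ := (uniqueDiffOn_Icc (zero_lt_one (α := ℝ))).prod hI
  refine ((hF.fderivWithin hQ (m := ∞) (by simp)).clm_apply
    (contDiffOn_const (c := ((1 : ℝ), (0 : ℝ))))).congr fun p hp => ?_
  exact (((hF.differentiableOn (by simp)).hasDerivWithinAt_fst hp.1 hp.2).derivWithin
    (uniqueDiffOn_Icc zero_lt_one p.1 hp.1))

/-- Mixed second derivatives commute, up to the boundary of the parameter domain. -/
lemma ContDiffOn.exists_mixed (hI : UniqueDiffOn ℝ I) (hF : ContDiffOn ℝ ∞ F (Icc 0 1 ×ˢ I))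
    {x t : ℝ} (hx : x ∈ Icc (0 : ℝ) 1) (ht : t ∈ interior I) :
    ∃ D : E,
      HasDerivWithinAt (fun s => derivWithin (fun u => F (u, s)) (Icc 0 1) x) D I t ∧
      HasDerivWithinAt (fun u => derivWithin (fun s => F (u, s)) I t) D (Icc 0 1) x := by
  set Q : Set (ℝ × ℝ) := Icc 0 1 ×ˢ I with hQdef
  have hQ : UniqueDiffOn ℝ Q := (uniqueDiffOn_Icc (zero_lt_one (α := ℝ))).prod hI
  have ht' : t ∈ I := interior_subset ht
  have hmem : (x, t) ∈ Q := ⟨hx, ht'⟩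
  have hdiff : DifferentiableOn ℝ F Q := hF.differentiableOn (by simp)
  have hdiff2 : DifferentiableOn ℝ (fderivWithin ℝ F Q) Q :=
    (hF.fderivWithin hQ (m := ∞) (by simp)).differentiableOn (by simp)
  have hsymm : IsSymmSndFDerivWithinAt ℝ F Q (x, t) := by
    refine (hF (x, t) hmem).isSymmSndFDerivWithinAt
      (by simpa using WithTop.coe_le_coe.2 (le_top : (2 : ℕ∞) ≤ ⊤)) hQ ?_ hmem
    rw [hQdef, interior_prod_eq, closure_prod_eq, interior_Icc,
      closure_Ioo (zero_ne_one (α := ℝ))]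
    exact ⟨hx, subset_closure ht⟩
  refine ⟨fderivWithin ℝ (fderivWithin ℝ F Q) Q (x, t) (0, 1) (1, 0), ?_, ?_⟩
  · have h := (hdiff2.hasDerivWithinAt_snd hx ht').clm_apply
      (hasDerivWithinAt_const t I ((1 : ℝ), (0 : ℝ)))
    simp only [map_zero, add_zero] at h
    refine h.congr_of_mem (fun s hs => ?_) ht'
    exact (hdiff.hasDerivWithinAt_fst hx hs).derivWithin (uniqueDiffOn_Icc zero_lt_one x hx)
  · have h := (hdiff2.hasDerivWithinAt_fst hx ht').clm_apply
      (hasDerivWithinAt_const x (Icc (0 : ℝ) 1) ((0 : ℝ), (1 : ℝ)))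
    simp only [map_zero, add_zero] at h
    rw [hsymm]
    refine h.congr_of_mem (fun u hu => ?_) hx
    exact (hdiff.hasDerivWithinAt_snd hu ht').derivWithin (hI t ht')

end Slices

section Curve

/-- The Frenet equation `dT/dx = |c'| κ J T`. -/
lemma hasDerivWithinAt_unitTangent {c : ℝ → Plane} {x : ℝ} (hx : x ∈ Icc (0 : ℝ) 1)
    (hne : ∀ u ∈ Icc (0 : ℝ) 1, velocity c u ≠ 0)
    (hd : DifferentiableWithinAt ℝ (velocity c) (Icc 0 1) x) :
    HasDerivWithinAt (unitTangent c)
      ((‖velocity c x‖ * curvature c x) • rotJ (unitTangent c x)) (Icc 0 1) x := by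
  have hunit : ∀ u ∈ Icc (0 : ℝ) 1, ‖unitTangent c u‖ = 1 := fun u hu => by
    rw [unitTangent, norm_smul, norm_inv, norm_norm, inv_mul_cancel₀ (norm_ne_zero_iff.2 (hne u hu))]
  have hT : DifferentiableWithinAt ℝ (unitTangent c) (Icc 0 1) x :=
    ((hd.norm ℝ (hne x hx)).inv (norm_ne_zero_iff.2 (hne x hx))).smul hd
  have hT' := hT.hasDerivWithinAt
  refine hT'.congr_deriv ?_
  have horth : inner ℝ (derivWithin (unitTangent c) (Icc 0 1) x) (unitTangent c x) = 0 := by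
    have h1 := hT'.inner ℝ hT'
    have h2 : HasDerivWithinAt (fun u => inner ℝ (unitTangent c u) (unitTangent c u)) 0
        (Icc 0 1) x := by
      refine (hasDerivWithinAt_const x (Icc (0 : ℝ) 1) (1 : ℝ)).congr_of_mem (fun u hu => ?_) hx
      rw [real_inner_self_eq_norm_sq, hunit u hu, one_pow]
    have h3 := (uniqueDiffOn_Icc zero_lt_one x hx).eq_deriv _ h1 h2
    rw [real_inner_comm] at h3
    linarith
  have hv := norm_ne_zero_iff.2 (hne x hx)
  apply ext_frame (hunit x hx)
  · rw [horth, inner_smul_left, inner_rotJ_self, mul_zero]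
  · rw [inner_smul_left, inner_rotJ_rotJ, real_inner_self_eq_norm_sq, hunit x hx, curvature,
      unitNormal, inner_neg_right, neg_neg, inner_smul_left]
    simp only [RCLike.conj_to_real, one_pow, mul_one]
    field_simp

end Curve

section Flow

variable {Ω : Set Plane} {T : EReal} {γ : ℝ → ℝ → Plane}

lemma norm_unitTangent {c : ℝ → Plane} {x : ℝ} (h : velocity c x ≠ 0) : ‖unitTangent c x‖ = 1 := by
  rw [unitTangent, norm_smul, norm_inv, norm_norm, inv_mul_cancel₀ (norm_ne_zero_iff.2 h)]

lemma norm_smul_unitTangent {c : ℝ → Plane} {x : ℝ} (h : velocity c x ≠ 0) :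
    ‖velocity c x‖ • unitTangent c x = velocity c x := by
  rw [unitTangent, smul_smul, mul_inv_cancel₀ (norm_ne_zero_iff.2 h), one_smul]

lemma IsFreeBoundaryCSF.contDiffOn_velocity (hγ : IsFreeBoundaryCSF Ω T γ) (hT : 0 < T) :
    ContDiffOn ℝ ∞ (fun p : ℝ × ℝ => velocity (fun u => γ u p.2) p.1)
      (Icc 0 1 ×ˢ timeInterval T) :=
  hγ.smooth.derivWithin_fst (uniqueDiffOn_timeInterval hT)

lemma IsFreeBoundaryCSF.contDiffOn_unitTangent (hγ : IsFreeBoundaryCSF Ω T γ) (hT : 0 < T) :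
    ContDiffOn ℝ ∞ (fun p : ℝ × ℝ => unitTangent (fun u => γ u p.2) p.1)
      (Icc 0 1 ×ˢ timeInterval T) := by
  have h := hγ.contDiffOn_velocity hT
  have hne : ∀ p ∈ Icc (0 : ℝ) 1 ×ˢ timeInterval T, velocity (fun u => γ u p.2) p.1 ≠ 0 :=
    fun p hp => hγ.immersed p.2 hp.2 p.1 hp.1
  exact ((h.norm ℝ hne).inv fun p hp => norm_ne_zero_iff.2 (hne p hp)).smul h

lemma IsFreeBoundaryCSF.continuousOn_curvature (hγ : IsFreeBoundaryCSF Ω T γ) (hT : 0 < T) :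
    ContinuousOn (fun p : ℝ × ℝ => curvature (fun u => γ u p.2) p.1)
      (Icc 0 1 ×ˢ timeInterval T) := by
  have h := (hγ.contDiffOn_velocity hT).continuousOn
  have h1 := (hγ.contDiffOn_unitTangent hT).continuousOn
  have h2 := ((hγ.contDiffOn_unitTangent hT).derivWithin_fst
    (F := fun p : ℝ × ℝ => unitTangent (fun u => γ u p.2) p.1)
    (uniqueDiffOn_timeInterval hT)).continuousOn
  have h3 : ContinuousOn (fun p : ℝ × ℝ => ‖velocity (fun u => γ u p.2) p.1‖⁻¹)
      (Icc 0 1 ×ˢ timeInterval T) :=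
    h.norm.inv₀ fun p hp => norm_ne_zero_iff.2 (hγ.immersed p.2 hp.2 p.1 hp.1)
  exact ((h3.smul h2).inner (continuous_rotJ.comp_continuousOn h1).neg).neg

lemma ContinuousOn.slice_fst {E : Type*} [TopologicalSpace E] {F : ℝ × ℝ → E} {I J : Set ℝ}
    (h : ContinuousOn F (J ×ˢ I)) {t : ℝ} (ht : t ∈ I) : ContinuousOn (fun x => F (x, t)) J :=
  h.comp (by fun_prop) fun x hx => (⟨hx, ht⟩ : (x, t) ∈ J ×ˢ I)

lemma IsFreeBoundaryCSF.hasDerivWithinAt_space (hγ : IsFreeBoundaryCSF Ω T γ) {x t : ℝ}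
    (hx : x ∈ Icc (0 : ℝ) 1) (ht : t ∈ timeInterval T) :
    HasDerivWithinAt (fun u => γ u t) (velocity (fun u => γ u t) x) (Icc 0 1) x :=
  ((hγ.smooth.differentiableOn (by simp)).hasDerivWithinAt_fst hx
    ht).differentiableWithinAt.hasDerivWithinAt

lemma IsFreeBoundaryCSF.hasDerivWithinAt_unitTangent (hγ : IsFreeBoundaryCSF Ω T γ) (hT : 0 < T)
    {x t : ℝ} (hx : x ∈ Icc (0 : ℝ) 1) (ht : t ∈ timeInterval T) :
    HasDerivWithinAt (unitTangent fun u => γ u t)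
      ((‖velocity (fun u => γ u t) x‖ * curvature (fun u => γ u t) x) •
        rotJ (unitTangent (fun u => γ u t) x)) (Icc 0 1) x :=
  _root_.hasDerivWithinAt_unitTangent hx (hγ.immersed t ht)
    (((hγ.contDiffOn_velocity hT).differentiableOn (by simp)).hasDerivWithinAt_fst hx
      ht).differentiableWithinAt

/-- The flow equation, up to the endpoints of the curve. -/
lemma IsFreeBoundaryCSF.derivWithin_time (hγ : IsFreeBoundaryCSF Ω T γ) (hT : 0 < T)
    {x t : ℝ} (hx : x ∈ Icc (0 : ℝ) 1) (ht : t ∈ timeInterval T) :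
    derivWithin (fun s => γ x s) (timeInterval T) t =
      curvature (fun u => γ u t) x • rotJ (unitTangent (fun u => γ u t) x) := by
  have hI := uniqueDiffOn_timeInterval hT
  have hQ := (uniqueDiffOn_Icc (zero_lt_one (α := ℝ))).prod hI
  have hdiff := hγ.smooth.differentiableOn (by simp)
  have h1 : ContinuousOn (fun u => derivWithin (fun s => γ u s) (timeInterval T) t) (Icc 0 1) := by
    have := ((hγ.smooth.fderivWithin hQ (m := ∞) (by simp)).clm_apply
      (contDiffOn_const (c := ((0 : ℝ), (1 : ℝ))))).continuousOn.slice_fst ht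
    exact this.congr fun u hu => (hdiff.hasDerivWithinAt_snd hu ht).derivWithin (hI t ht)
  have h2 : ContinuousOn (fun x => curvature (fun u => γ u t) x •
      rotJ (unitTangent (fun u => γ u t) x)) (Icc 0 1) :=
    ((hγ.continuousOn_curvature hT).slice_fst ht).smul (continuous_rotJ.comp_continuousOn
      ((hγ.contDiffOn_unitTangent hT).continuousOn.slice_fst ht))
  have h3 : EqOn (fun u => derivWithin (fun s => γ u s) (timeInterval T) t)
      (fun x => curvature (fun u => γ u t) x • rotJ (unitTangent (fun u => γ u t) x))
      (Ioo 0 1) := fun u hu => by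
    have := hγ.evolution t ht u hu
    rw [unitNormal, smul_neg, neg_neg] at this
    exact this
  exact h3.of_subset_closure h1 h2 Ioo_subset_Icc_self
    (closure_Ioo (zero_ne_one (α := ℝ))).ge hx

lemma IsFreeBoundaryCSF.hasDerivAt_time (hγ : IsFreeBoundaryCSF Ω T γ) (hT : 0 < T)
    {x t : ℝ} (hx : x ∈ Icc (0 : ℝ) 1) (ht : t ∈ timeInterval T) (h0 : 0 < t) :
    HasDerivAt (fun s => γ x s)
      (curvature (fun u => γ u t) x • rotJ (unitTangent (fun u => γ u t) x)) t := by
  have h := ((hγ.smooth.differentiableOn (by simp)).hasDerivWithinAt_snd hx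
    ht).differentiableWithinAt.hasDerivWithinAt
  rw [hγ.derivWithin_time hT hx ht] at h
  exact h.hasDerivAt (timeInterval_mem_nhds ht h0)

/-- Evolution of the length element: `∂_t |γ_x| = - κ² |γ_x|`. -/
lemma IsFreeBoundaryCSF.hasDerivAt_speed (hγ : IsFreeBoundaryCSF Ω T γ) (hT : 0 < T)
    {x t : ℝ} (hx : x ∈ Icc (0 : ℝ) 1) (ht : t ∈ timeInterval T) (h0 : 0 < t) :
    HasDerivAt (fun s => ‖velocity (fun u => γ u s) x‖)
      (-(curvature (fun u => γ u t) x ^ 2 * ‖velocity (fun u => γ u t) x‖)) t := by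
  have hnhds := timeInterval_mem_nhds ht h0
  obtain ⟨D, hD1, hD2⟩ := hγ.smooth.exists_mixed (uniqueDiffOn_timeInterval hT) hx
    (mem_interior_iff_mem_nhds.2 hnhds)
  have hD1' : HasDerivAt (fun s => velocity (fun u => γ u s) x) D t := hD1.hasDerivAt hnhds
  have hne := hγ.immersed t ht x hx
  have hv := norm_ne_zero_iff.2 hne
  have hτ := hγ.hasDerivWithinAt_unitTangent hT hx ht
  have hnorm := norm_unitTangent hne
  -- the velocity of the flow is normal to the curve
  have h1 := hD2.inner ℝ hτ
  have h2 : HasDerivWithinAt (fun u => inner ℝ (derivWithin (fun s => γ u s) (timeInterval T) t)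
      (unitTangent (fun u => γ u t) u)) 0 (Icc 0 1) x := by
    refine (hasDerivWithinAt_const x (Icc (0 : ℝ) 1) (0 : ℝ)).congr_of_mem (fun u hu => ?_) hx
    rw [hγ.derivWithin_time hT hu ht, inner_smul_left, inner_rotJ_self, mul_zero]
  have h3 := (uniqueDiffOn_Icc zero_lt_one x hx).eq_deriv _ h1 h2
  rw [hγ.derivWithin_time hT hx ht, inner_smul_left, inner_smul_right, inner_rotJ_rotJ,
    real_inner_self_eq_norm_sq, hnorm] at h3
  simp only [RCLike.conj_to_real, one_pow, mul_one] at h3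
  have h4 := hD1'.norm_sq.sqrt (by positivity)
  simp only [Real.sqrt_sq (norm_nonneg _)] at h4
  refine h4.congr_deriv ?_
  have h5 : inner ℝ (velocity (fun u => γ u t) x) D =
      ‖velocity (fun u => γ u t) x‖ * inner ℝ D (unitTangent (fun u => γ u t) x) := by
    rw [real_inner_comm, ← inner_smul_right, norm_smul_unitTangent hne]
  rw [h5]
  field_simp
  linarith

/-- Evolution of arclength. -/
lemma IsFreeBoundaryCSF.hasDerivAt_arclength (hγ : IsFreeBoundaryCSF Ω T γ) (hT : 0 < T)
    {x t : ℝ} (hx : x ∈ Icc (0 : ℝ) 1) (ht : t ∈ timeInterval T) (h0 : 0 < t) :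
    HasDerivAt (fun s => ∫ u in 0..x, ‖velocity (fun u => γ u s) u‖)
      (-∫ u in 0..x, curvature (fun u => γ u t) u ^ 2 * ‖velocity (fun u => γ u t) u‖) t := by
  obtain ⟨r, hr, hrI⟩ := Metric.nhds_basis_closedBall.mem_iff.1
    (Filter.inter_mem (timeInterval_mem_nhds ht h0) (lt_mem_nhds h0))
  have hvc := (hγ.contDiffOn_velocity hT).continuousOn.norm
  have hkc := (((hγ.continuousOn_curvature hT).pow 2).mul hvc).neg
  have hsub : uIcc 0 x ⊆ Icc 0 1 := by rw [uIcc_of_le hx.1]; exact Icc_subset_Icc_right hx.2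
  obtain ⟨M, hM⟩ := (isCompact_Icc.prod (isCompact_closedBall t r)).exists_bound_of_continuousOn
    (hkc.mono (prod_mono_right fun s hs => (hrI hs).1))
  have h := intervalIntegral.hasDerivAt_integral_of_dominated_loc_of_deriv_le (μ := MeasureTheory.volume)
    (𝕜 := ℝ) (a := 0) (b := x) (x₀ := t) (s := Metric.closedBall t r) (bound := fun _ => M)
    (F := fun s u => ‖velocity (fun u => γ u s) u‖)
    (F' := fun s u => -(curvature (fun u => γ u s) u ^ 2 * ‖velocity (fun u => γ u s) u‖))
    (Metric.closedBall_mem_nhds t hr)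
    (by
      filter_upwards [Metric.closedBall_mem_nhds t hr] with s hs
      exact (intervalIntegrable_iff.1
        ((hvc.slice_fst (hrI hs).1).mono hsub).intervalIntegrable).aestronglyMeasurable)
    ((hvc.slice_fst ht).mono hsub).intervalIntegrable
    (intervalIntegrable_iff.1
      ((hkc.slice_fst ht).mono hsub).intervalIntegrable).aestronglyMeasurable
    (Eventually.of_forall fun u hu s hs => hM (u, s) ⟨hsub (uIoc_subset_uIcc hu), hs⟩)
    (by simp)
    (Eventually.of_forall fun u hu s hs =>
      hγ.hasDerivAt_speed hT (hsub (uIoc_subset_uIcc hu)) (hrI hs).1 (hrI hs).2)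
  rw [← intervalIntegral.integral_neg]
  exact h.2

end Flow

/-! ### Parametrisation by arclength -/

section Arclength

/-- The arclength from the starting point of the curve. -/
noncomputable def arclength (c : ℝ → Plane) (x : ℝ) : ℝ := ∫ u in (0 : ℝ)..x, ‖velocity c u‖

lemma arclength_zero (c : ℝ → Plane) : arclength c 0 = 0 := intervalIntegral.integral_same

lemma arclength_one (c : ℝ → Plane) : arclength c 1 = curveLength c := rfl

variable {c : ℝ → Plane}

lemma arclength_sub (hv : ContinuousOn (velocity c) (Icc 0 1)) {x y : ℝ} (hx : x ∈ Icc (0 : ℝ) 1)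
    (hy : y ∈ Icc (0 : ℝ) 1) :
    arclength c y - arclength c x = ∫ u in x..y, ‖velocity c u‖ := by
  have hint : ∀ a ∈ Icc (0 : ℝ) 1, ∀ b ∈ Icc (0 : ℝ) 1,
      IntervalIntegrable (fun u => ‖velocity c u‖) MeasureTheory.volume a b := fun a ha b hb =>
    (hv.norm.mono (uIcc_subset_Icc ha hb)).intervalIntegrable
  have h0 : (0 : ℝ) ∈ Icc (0 : ℝ) 1 := ⟨le_rfl, zero_le_one⟩
  exact intervalIntegral.integral_interval_sub_left (hint 0 h0 y hy) (hint 0 h0 x hx)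

lemma arclength_strictMonoOn (hv : ContinuousOn (velocity c) (Icc 0 1))
    (hne : ∀ u ∈ Icc (0 : ℝ) 1, velocity c u ≠ 0) : StrictMonoOn (arclength c) (Icc 0 1) := by
  intro x hx y hy hxy
  rw [← sub_pos, arclength_sub hv hx hy]
  have hsub : Icc x y ⊆ Icc 0 1 := Icc_subset_Icc hx.1 hy.2
  refine intervalIntegral.intervalIntegral_pos_of_pos_on
    ((hv.norm.mono (by rwa [uIcc_of_le hxy.le])).intervalIntegrable) (fun u hu => ?_) hxy
  exact norm_pos_iff.2 (hne u (hsub (Ioo_subset_Icc_self hu)))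

lemma continuousOn_arclength (hv : ContinuousOn (velocity c) (Icc 0 1)) :
    ContinuousOn (arclength c) (Icc 0 1) := by
  have h := intervalIntegral.continuousOn_primitive_interval (μ := MeasureTheory.volume)
    (a := 0) (b := 1) (f := fun u => ‖velocity c u‖)
    (by rw [uIcc_of_le zero_le_one]; exact hv.norm.integrableOn_Icc)
  rwa [uIcc_of_le zero_le_one] at h

/-- A regular curve whose tangent satisfies the Frenet equation is a unit speed curve, up to
reparametrisation and extension to the whole line. -/
lemma exists_unitArc (hc : ∀ x ∈ Icc (0 : ℝ) 1, HasDerivWithinAt c (velocity c x) (Icc 0 1) x)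
    (hne : ∀ u ∈ Icc (0 : ℝ) 1, velocity c u ≠ 0) (hv : ContinuousOn (velocity c) (Icc 0 1))
    (hk : ContinuousOn (curvature c) (Icc 0 1))
    (hτ : ∀ x ∈ Icc (0 : ℝ) 1, HasDerivWithinAt (unitTangent c)
      ((‖velocity c x‖ * curvature c x) • rotJ (unitTangent c x)) (Icc 0 1) x) :
    ∃ (X T : ℝ → Plane) (k : ℝ → ℝ), UnitArc X T k ∧ ∀ x ∈ Icc (0 : ℝ) 1,
      X (arclength c x) = c x ∧ T (arclength c x) = unitTangent c x ∧
      k (arclength c x) = curvature c x ∧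
      ∫ s in 0..arclength c x, k s ^ 2 = ∫ u in 0..x, curvature c u ^ 2 * ‖velocity c u‖ := by
  have h01 : (0 : ℝ) ≤ 1 := zero_le_one
  -- extend speed and curvature to the line, as constants outside `[0,1]`
  set v : ℝ → ℝ := IccExtend h01 (domRestrict (Icc 0 1) fun u => ‖velocity c u‖) with hvdef
  set κ : ℝ → ℝ := IccExtend h01 (domRestrict (Icc 0 1) (curvature c)) with hκdef
  have hvc : Continuous v := (continuousOn_iff_continuous_domRestrict.1 hv.norm).Icc_extend'
  have hκc : Continuous κ := (continuousOn_iff_continuous_domRestrict.1 hk).Icc_extend'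
  have hve : ∀ x ∈ Icc (0 : ℝ) 1, v x = ‖velocity c x‖ := fun x hx =>
    IccExtend_of_mem h01 _ hx
  have hκe : ∀ x ∈ Icc (0 : ℝ) 1, κ x = curvature c x := fun x hx =>
    IccExtend_of_mem h01 _ hx
  obtain ⟨m, hm, hmv⟩ : ∃ m > 0, ∀ x, m ≤ v x := by
    obtain ⟨x₀, hx₀, hmin⟩ := isCompact_Icc.exists_isMinOn (nonempty_Icc.2 h01) hv.norm
    refine ⟨‖velocity c x₀‖, norm_pos_iff.2 (hne x₀ hx₀), fun x => ?_⟩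
    exact hmin (projIcc 0 1 h01 x).2
  set A : ℝ → ℝ := fun x => ∫ u in 0..x, v u with hAdef
  have hA : ∀ x, HasDerivAt A (v x) x := fun x => hvc.integral_hasStrictDerivAt 0 x |>.hasDerivAt
  have hAe : ∀ x ∈ Icc (0 : ℝ) 1, A x = arclength c x := by
    intro x hx
    apply intervalIntegral.integral_congr
    intro u hu
    rw [uIcc_of_le hx.1] at hu
    exact hve u ⟨hu.1, hu.2.trans hx.2⟩
  have hAmono : StrictMono A := strictMono_of_hasDerivAt_pos hA fun x => hm.trans_le (hmv x)
  have hAcont : Continuous A := continuous_iff_continuousAt.2 fun x => (hA x).continuousAt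
  have hA0 : A 0 = 0 := intervalIntegral.integral_same
  have hgrow : Monotone fun x => A x - m * x := by
    refine monotone_of_hasDerivAt_nonneg (f' := fun x => v x - m) (fun x => ?_)
      fun x => sub_nonneg.2 (hmv x)
    simpa using (hA x).fun_sub ((hasDerivAt_id x).const_mul m)
  have hAsurj : Function.Surjective A := by
    apply hAcont.surjective
    · refine tendsto_atTop_mono' atTop ?_ (tendsto_id.const_mul_atTop hm)
      filter_upwards [eventually_ge_atTop 0] with x hx
      have := hgrow hx
      simp only [hA0, mul_zero, sub_zero] at this
      simp only [id]; linarith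
    · refine tendsto_atBot_mono' atBot ?_ (tendsto_id.const_mul_atBot hm)
      filter_upwards [eventually_le_atBot 0] with x hx
      have := hgrow hx
      simp only [hA0, mul_zero, sub_zero] at this
      simp only [id]; linarith
  set e := hAmono.orderIsoOfSurjective A hAsurj
  have heA : ∀ x, e.symm (A x) = x := fun x => e.symm_apply_apply x
  set k : ℝ → ℝ := fun s => κ (e.symm s) with hkdef
  have hkc : Continuous k := hκc.comp e.symm.continuous
  have hkA : ∀ x ∈ Icc (0 : ℝ) 1, k (A x) = curvature c x := fun x hx => by
    rw [hkdef]; simp only [heA]; exact hκe x hx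
  set Θ : ℝ → ℝ := fun s => ∫ r in 0..s, k r
  have hΘ : ∀ s, HasDerivAt Θ (k s) s := fun s => hkc.integral_hasStrictDerivAt 0 s |>.hasDerivAt
  set T : ℝ → Plane := fun s => rot (Θ s) (unitTangent c 0) with hTdef
  have hT : ∀ s, HasDerivAt T (k s • rotJ (T s)) s := by
    intro s
    have h := ((hΘ s).cos.smul_const (unitTangent c 0)).add
      ((hΘ s).sin.smul_const (rotJ (unitTangent c 0)))
    refine h.congr_deriv ?_
    simp only [hTdef, rot, rotJ_add, rotJ_smul, rotJ_rotJ]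
    module
  have hTc : Continuous T := continuous_iff_continuousAt.2 fun s => (hT s).continuousAt
  set X : ℝ → Plane := fun s => c 0 + ∫ r in 0..s, T r
  have hX : ∀ s, HasDerivAt X (T s) s := fun s =>
    (hTc.integral_hasStrictDerivAt 0 s |>.hasDerivAt).const_add (c 0)
  have hTA : ∀ x ∈ Icc (0 : ℝ) 1, T (A x) = unitTangent c x := by
    have hd : ∀ x ∈ Icc (0 : ℝ) 1,
        HasDerivWithinAt (fun x => ‖T (A x) - unitTangent c x‖ ^ 2) 0 (Icc 0 1) x := by
      intro x hx
      have h1 : HasDerivAt (fun x => T (A x)) (v x • (k (A x) • rotJ (T (A x)))) x :=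
        (hT (A x)).scomp x (hA x)
      refine (h1.hasDerivWithinAt.fun_sub (hτ x hx)).norm_sq.congr_deriv ?_
      rw [hkA x hx, hve x hx, smul_smul, ← smul_sub, ← rotJ_sub, inner_smul_right,
        inner_self_rotJ, mul_zero, mul_zero]
    intro x hx
    have h := constant_of_derivWithin_zero (fun x hx => (hd x hx).differentiableWithinAt)
      (fun x hx => (hd x (Ico_subset_Icc_self hx)).derivWithin
        (uniqueDiffOn_Icc zero_lt_one x (Ico_subset_Icc_self hx))) x hx
    have h0 : T (A 0) = unitTangent c 0 := by simp [hTdef, hA0, Θ]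
    rw [h0, sub_self, norm_zero] at h
    exact sub_eq_zero.1 (norm_eq_zero.1 (pow_eq_zero_iff (by norm_num) |>.1 (h.trans (by norm_num))))
  refine ⟨X, T, k, ⟨fun s => ?_, hX, hT, hkc⟩, fun x hx => ?_⟩
  · rw [hTdef, norm_rot]
    exact norm_unitTangent (hne 0 ⟨le_rfl, h01⟩)
  refine ⟨?_, by rw [← hAe x hx]; exact hTA x hx, by rw [← hAe x hx]; exact hkA x hx, ?_⟩
  · have hd : ∀ x ∈ Icc (0 : ℝ) 1,
        HasDerivWithinAt (fun x => X (A x) - c x) 0 (Icc 0 1) x := by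
      intro x hx
      have h1 : HasDerivAt (fun x => X (A x)) (v x • T (A x)) x := (hX (A x)).scomp x (hA x)
      refine (h1.hasDerivWithinAt.fun_sub (hc x hx)).congr_deriv ?_
      rw [hTA x hx, hve x hx, norm_smul_unitTangent (hne x hx), sub_self]
    have h := constant_of_derivWithin_zero (fun x hx => (hd x hx).differentiableWithinAt)
      (fun x hx => (hd x (Ico_subset_Icc_self hx)).derivWithin
        (uniqueDiffOn_Icc zero_lt_one x (Ico_subset_Icc_self hx))) x hx
    rw [← hAe x hx]
    have h0 : X (A 0) - c 0 = 0 := by simp [X, hA0]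
    rw [h0] at h
    exact sub_eq_zero.1 h
  · rw [← hAe x hx]
    have h := intervalIntegral.integral_comp_mul_deriv (a := 0) (b := x) (f := A) (f' := v)
      (g := fun s => k s ^ 2) (fun y _ => hA y) hvc.continuousOn (hkc.pow 2)
    rw [hA0] at h
    rw [← h]
    apply intervalIntegral.integral_congr
    intro u hu
    rw [uIcc_of_le hx.1] at hu
    have hu' : u ∈ Icc (0 : ℝ) 1 := ⟨hu.1, hu.2.trans hx.2⟩
    simp only [Function.comp]
    rw [hkA u hu', hve u hu']

/-- A curve which starts orthogonally to the boundary of a convex domain and runs into the interior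
has the inward normal as its initial tangent. -/
lemma UnitArc.tangent_eq_neg_normal {Ω : Set Plane} {X T : ℝ → Plane} {k : ℝ → ℝ}
    (hX : UnitArc X T k) (hΩ : IsConvexC2Domain Ω) {L : ℝ} (hL : 0 < L)
    (hint : ∀ s ∈ Ioo 0 L, X s ∈ interior Ω) (h0 : X 0 ∈ frontier Ω)
    (horth : inner ℝ (rotJ (T 0)) (outwardNormal Ω (X 0)) = 0) :
    T 0 = -outwardNormal Ω (X 0) := by
  have hn := hΩ.norm_outwardNormal h0
  set n := outwardNormal Ω (X 0)
  have h1 : 0 ≤ -inner ℝ n (T 0) := by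
    have hd : HasDerivAt (fun s => -inner ℝ n (X s - X 0)) (-inner ℝ n (T 0)) 0 := by
      have := ((hasDerivAt_const (0 : ℝ) n).inner ℝ ((hX.hasDerivAt_X 0).sub_const (X 0))).fun_neg
      simpa using this
    refine deriv_nonneg_of_right_min hd (by simp) ?_
    filter_upwards [self_mem_nhdsWithin, eventually_nhdsGT (gt_mem_nhds hL)] with s hs hs'
    have := hΩ.support_lt h0 (hint s ⟨hs, hs'⟩)
    linarith
  have h2 : inner ℝ (T 0) (rotJ n) = 0 := by
    rw [inner_rotJ_left] at horth; linarith
  have h3 := norm_sq_eq_frame hn (T 0)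
  rw [hX.norm_T, h2] at h3
  rw [real_inner_comm] at h1
  have h4 : inner ℝ (T 0) n = -1 := by nlinarith
  apply ext_frame hn
  · rw [h4, inner_neg_left, real_inner_self_eq_norm_sq, hn]; norm_num
  · rw [h2, inner_neg_left, inner_self_rotJ, neg_zero]

/-- The unit speed curve `X` (with unit tangent `τ` and curvature `k`) is the arclength
parametrisation of the curve `c`, which meets `∂Ω` orthogonally at its endpoints. -/
structure IsArcOf (Ω : Set Plane) (c : ℝ → Plane) (X τ : ℝ → Plane) (k : ℝ → ℝ) : Prop
    extends FBArc Ω X τ k (curveLength c) where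
  velocity_ne_zero : ∀ x ∈ Icc (0 : ℝ) 1, velocity c x ≠ 0
  continuousOn_velocity : ContinuousOn (velocity c) (Icc 0 1)
  X_eq : ∀ x ∈ Icc (0 : ℝ) 1, X (arclength c x) = c x
  T_eq : ∀ x ∈ Icc (0 : ℝ) 1, τ (arclength c x) = unitTangent c x
  k_eq : ∀ x ∈ Icc (0 : ℝ) 1, k (arclength c x) = curvature c x
  energy_eq : ∀ x ∈ Icc (0 : ℝ) 1, ∫ s in 0..arclength c x, k s ^ 2 =
    ∫ u in 0..x, curvature c u ^ 2 * ‖velocity c u‖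

/-- Each time slice of the flow has an arclength parametrisation. -/
theorem IsFreeBoundaryCSF.exists_arc {Ω : Set Plane} {T : EReal} {γ : ℝ → ℝ → Plane}
    (hγ : IsFreeBoundaryCSF Ω T γ) (hT : 0 < T) (hΩ : IsConvexC2Domain Ω) {t : ℝ}
    (ht : t ∈ timeInterval T) :
    ∃ (X τ : ℝ → Plane) (k : ℝ → ℝ), IsArcOf Ω (fun u => γ u t) X τ k := by
  have hne := hγ.immersed t ht
  have hv : ContinuousOn (velocity fun u => γ u t) (Icc 0 1) :=
    (hγ.contDiffOn_velocity hT).continuousOn.slice_fst ht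
  obtain ⟨X, τ, k, hX, hXe⟩ := exists_unitArc
    (fun x hx => hγ.hasDerivWithinAt_space hx ht) hne hv
    ((hγ.continuousOn_curvature hT).slice_fst ht)
    (fun x hx => hγ.hasDerivWithinAt_unitTangent hT hx ht)
  set c := fun u => γ u t
  have hmono := arclength_strictMonoOn hv hne
  have m0 : (0 : ℝ) ∈ Icc (0 : ℝ) 1 := ⟨le_rfl, zero_le_one⟩
  have m1 : (1 : ℝ) ∈ Icc (0 : ℝ) 1 := ⟨zero_le_one, le_rfl⟩
  have hL : 0 < curveLength c := by
    have := hmono m0 m1 zero_lt_one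
    rwa [arclength_zero, arclength_one] at this
  have hcont := continuousOn_arclength hv
  have e0 := hXe 0 m0
  have e1 := hXe 1 m1
  rw [arclength_zero] at e0
  rw [arclength_one] at e1
  have hint : ∀ s ∈ Ioo 0 (curveLength c), X s ∈ interior Ω := by
    intro s hs
    obtain ⟨x, hx, rfl⟩ := intermediate_value_Ioo zero_le_one hcont
      (by rwa [arclength_zero, arclength_one] : s ∈ Ioo (arclength c 0) (arclength c 1))
    rw [(hXe x (Ioo_subset_Icc_self hx)).1]
    exact hγ.interior_mem t ht x hx
  have hf0 : X 0 ∈ frontier Ω := by rw [e0.1]; exact hγ.endpoint_mem t ht 0 (by simp)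
  have hf1 : X (curveLength c) ∈ frontier Ω := by
    rw [e1.1]; exact hγ.endpoint_mem t ht 1 (by simp)
  have ho : ∀ x ∈ ({0, 1} : Set ℝ),
      inner ℝ (rotJ (unitTangent c x)) (outwardNormal Ω (γ x t)) = 0 := fun x hx => by
    have := hγ.orthogonal t ht x hx
    rwa [unitNormal, inner_neg_left, neg_eq_zero] at this
  refine ⟨X, τ, k, ⟨hX, hL, hint, hf0, hf1, ?_, ?_⟩, hne, hv, fun x hx => (hXe x hx).1,
    fun x hx => (hXe x hx).2.1, fun x hx => (hXe x hx).2.2.1, fun x hx => (hXe x hx).2.2.2⟩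
  · refine hX.tangent_eq_neg_normal hΩ hL hint hf0 ?_
    rw [e0.2.1, e0.1]; exact ho 0 (by simp)
  · have := (hX.reverse (curveLength c)).tangent_eq_neg_normal hΩ hL
      (fun s hs => hint _ ⟨by linarith [hs.2], by linarith [hs.1]⟩) (by simpa using hf1)
      (by
        simp only [sub_zero, rotJ_neg, inner_neg_left, neg_eq_zero]
        rw [e1.2.1, e1.1]; exact ho 1 (by simp))
    simpa using this

namespace IsArcOf

variable {Ω : Set Plane} {X τ : ℝ → Plane} {k : ℝ → ℝ} {x y : ℝ} (h : IsArcOf Ω c X τ k)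
include h

lemma strictMonoOn : StrictMonoOn (arclength c) (Icc 0 1) :=
  arclength_strictMonoOn h.continuousOn_velocity h.velocity_ne_zero

lemma arclength_mem (hx : x ∈ Icc (0 : ℝ) 1) : arclength c x ∈ Icc 0 (curveLength c) := by
  have h0 := h.strictMonoOn.monotoneOn ⟨le_rfl, zero_le_one⟩ hx hx.1
  have h1 := h.strictMonoOn.monotoneOn hx ⟨zero_le_one, le_rfl⟩ hx.2
  rw [arclength_zero] at h0
  rw [arclength_one] at h1
  exact ⟨h0, h1⟩

lemma arclength_mem_Ioo (hx : x ∈ Ioo (0 : ℝ) 1) : arclength c x ∈ Ioo 0 (curveLength c) := by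
  have hx' := Ioo_subset_Icc_self hx
  have h0 := h.strictMonoOn ⟨le_rfl, zero_le_one⟩ hx' hx.1
  have h1 := h.strictMonoOn hx' ⟨zero_le_one, le_rfl⟩ hx.2
  rw [arclength_zero] at h0
  rw [arclength_one] at h1
  exact ⟨h0, h1⟩

lemma exists_arclength_eq {s : ℝ} (hs : s ∈ Icc 0 (curveLength c)) :
    ∃ x ∈ Icc (0 : ℝ) 1, arclength c x = s :=
  intermediate_value_Icc zero_le_one (continuousOn_arclength h.continuousOn_velocity)
    (by rwa [arclength_zero, arclength_one] : s ∈ Icc (arclength c 0) (arclength c 1))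

lemma arcDist_eq (hx : x ∈ Icc (0 : ℝ) 1) (hy : y ∈ Icc (0 : ℝ) 1) :
    arcDist c x y = |arclength c y - arclength c x| := by
  rw [arclength_sub h.continuousOn_velocity hx hy, arcDist]

lemma reflectedArcDist_eq (hx : x ∈ Icc (0 : ℝ) 1) (hy : y ∈ Icc (0 : ℝ) 1) :
    reflectedArcDist c x y = min (arclength c x + arclength c y)
      (2 * curveLength c - (arclength c x + arclength c y)) := by
  have hx' := h.arclength_mem hx
  have hy' := h.arclength_mem hy
  have m0 : (0 : ℝ) ∈ Icc (0 : ℝ) 1 := ⟨le_rfl, zero_le_one⟩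
  have m1 : (1 : ℝ) ∈ Icc (0 : ℝ) 1 := ⟨zero_le_one, le_rfl⟩
  rw [reflectedArcDist, h.arcDist_eq hx m0, h.arcDist_eq hy m0, h.arcDist_eq hx m1,
    h.arcDist_eq hy m1, arclength_zero, arclength_one, zero_sub, zero_sub, abs_neg, abs_neg,
    abs_of_nonneg hx'.1, abs_of_nonneg hy'.1, abs_of_nonneg (sub_nonneg.2 hx'.2),
    abs_of_nonneg (sub_nonneg.2 hy'.2)]
  congr 1
  ring

/-- The lower bound for the extended chord-arc profile amounts to lower bounds for the direct and
the reflected distances. -/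
lemma chordArcBound_iff {a ε : ℝ} :
    ChordArcBound Ω c ε a ↔
      DirectBound X (curveLength c) a ε ∧ ReflectedBound Ω X (curveLength c) a ε := by
  have hL := h.L_pos
  have hmodel : ∀ δ : ℝ, a * doubledLength c *
        (Real.sin ((Real.pi - ε) * (δ / doubledLength c) + ε / 2) - Real.sin (ε / 2)) =
      2 * curveLength c * model a ε (δ / (2 * curveLength c)) := fun δ => by
    rw [model, doubledLength]; ring
  have hsymm : ∀ s : ℝ, model a ε ((2 * curveLength c - s) / (2 * curveLength c)) =
      model a ε (s / (2 * curveLength c)) := fun s => by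
    rw [← model_symm a ε (s / _)]; congr 1; field_simp
  constructor
  · intro hb
    refine ⟨fun r s hr hrs hs => ?_, fun r hr s hs z hz => ?_⟩
    · obtain ⟨x, hx, rfl⟩ := h.exists_arclength_eq ⟨hr, hrs.trans hs⟩
      obtain ⟨y, hy, rfl⟩ := h.exists_arclength_eq ⟨hr.trans hrs, hs⟩
      rw [← hmodel, h.X_eq x hx, h.X_eq y hy]
      refine (hb _ ⟨by linarith, by linarith⟩).trans ((min_le_left _ _).trans ?_)
      exact csInf_le ⟨0, by rintro _ ⟨_, _, _, _, _, rfl⟩; exact dist_nonneg⟩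
        ⟨x, hx, y, hy, by rw [h.arcDist_eq hx hy, abs_of_nonneg (by linarith)], rfl⟩
    · obtain ⟨x, hx, rfl⟩ := h.exists_arclength_eq hr
      obtain ⟨y, hy, rfl⟩ := h.exists_arclength_eq hs
      rw [h.X_eq x hx, h.X_eq y hy]
      have h1 : 2 * curveLength c *
          model a ε ((arclength c x + arclength c y) / (2 * curveLength c)) =
          2 * curveLength c * model a ε (reflectedArcDist c x y / (2 * curveLength c)) := by
        rw [h.reflectedArcDist_eq hx hy]
        rcases min_choice (arclength c x + arclength c y)
          (2 * curveLength c - (arclength c x + arclength c y)) with e | e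
        · rw [e]
        · rw [e, hsymm]
      have hmem : reflectedArcDist c x y ∈ Icc 0 (curveLength c) := by
        rw [h.reflectedArcDist_eq hx hy]
        refine ⟨le_min (add_nonneg hr.1 hs.1) (by linarith [hr.2, hs.2]), ?_⟩
        rcases le_total (arclength c x + arclength c y) (curveLength c) with e | e
        · exact (min_le_left _ _).trans e
        · exact (min_le_right _ _).trans (by linarith)
      rw [h1, ← hmodel]
      refine (hb _ hmem).trans ((min_le_right _ _).trans ?_)
      refine le_trans (csInf_le ⟨0, ?_⟩ ⟨x, hx, y, hy, rfl, rfl⟩)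
        (csInf_le ⟨0, ?_⟩ ⟨z, hz, rfl⟩)
      · rintro _ ⟨x, _, y, _, _, rfl⟩
        refine Real.sInf_nonneg ?_
        rintro _ ⟨z, _, rfl⟩
        positivity
      · rintro _ ⟨z, _, rfl⟩
        positivity
  · rintro ⟨hD, hR⟩ δ hδ
    rw [hmodel]
    obtain ⟨y₀, hy₀, hy₀e⟩ := h.exists_arclength_eq hδ
    have m0 : (0 : ℝ) ∈ Icc (0 : ℝ) 1 := ⟨le_rfl, zero_le_one⟩
    refine le_min (le_csInf ⟨_, 0, m0, y₀, hy₀, ?_, rfl⟩ ?_)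
      (le_csInf ⟨_, 0, m0, y₀, hy₀, ?_, rfl⟩ ?_)
    · rw [h.arcDist_eq m0 hy₀, arclength_zero, hy₀e, sub_zero, abs_of_nonneg hδ.1]
    · rintro _ ⟨x, hx, y, hy, hxy, rfl⟩
      rw [h.arcDist_eq hx hy] at hxy
      have hx' := h.arclength_mem hx
      have hy' := h.arclength_mem hy
      rw [← h.X_eq x hx, ← h.X_eq y hy]
      rcases le_total (arclength c x) (arclength c y) with e | e
      · rw [abs_of_nonneg (sub_nonneg.2 e)] at hxy
        rw [← hxy]
        exact hD _ _ hx'.1 e hy'.2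
      · rw [abs_of_nonpos (sub_nonpos.2 e), neg_sub] at hxy
        rw [← hxy, dist_comm]
        exact hD _ _ hy'.1 e hx'.2
    · rw [h.reflectedArcDist_eq m0 hy₀, arclength_zero, hy₀e, zero_add,
        min_eq_left (by linarith [hδ.2])]
    · rintro _ ⟨x, hx, y, hy, hxy, rfl⟩
      rw [h.reflectedArcDist_eq hx hy] at hxy
      refine le_csInf ⟨_, X 0, h.zero_mem, rfl⟩ ?_
      rintro _ ⟨z, hz, rfl⟩
      have h1 := hR _ (h.arclength_mem hx) _ (h.arclength_mem hy) z hz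
      rw [h.X_eq x hx, h.X_eq y hy] at h1
      rcases min_choice (arclength c x + arclength c y)
          (2 * curveLength c - (arclength c x + arclength c y)) with e | e
      · rwa [← hxy, e]
      · rwa [← hxy, e, hsymm]

end IsArcOf

end Arclength

/-! ### The chord-arc defects along the flow -/

section Defect

/-- The defect `d - 𝐋 φ(ℓ/𝐋)` in the chord-arc inequality for the direct distance. -/
noncomputable def directDefect (c : ℝ → Plane) (a ε x y : ℝ) : ℝ :=
  dist (c x) (c y) - 2 * curveLength c *
    model a ε ((arclength c y - arclength c x) / (2 * curveLength c))

/-- The defect `|x - z| + |y - z| - 𝐋 φ(ℓ̃/𝐋)` in the chord-arc inequality for the reflected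
distance, with reflection point `z`. -/
noncomputable def reflectedDefect (c : ℝ → Plane) (a ε x y : ℝ) (z : Plane) : ℝ :=
  dist (c x) z + dist (c y) z - 2 * curveLength c *
    model a ε ((arclength c x + arclength c y) / (2 * curveLength c))

variable {Ω : Set Plane} {T : EReal} {γ : ℝ → ℝ → Plane} {c ε t : ℝ}

lemma IsArcOf.directBound_iff {C X τ : ℝ → Plane} {k : ℝ → ℝ} (h : IsArcOf Ω C X τ k) :
    DirectBound X (curveLength C) c ε ↔
      ∀ x ∈ Icc (0 : ℝ) 1, ∀ y ∈ Icc (0 : ℝ) 1, x ≤ y → 0 ≤ directDefect C c ε x y := by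
  constructor
  · intro hD x hx y hy hxy
    have := hD _ _ (h.arclength_mem hx).1 (h.strictMonoOn.monotoneOn hx hy hxy)
      (h.arclength_mem hy).2
    rw [h.X_eq x hx, h.X_eq y hy] at this
    exact sub_nonneg.2 this
  · intro hD a b ha hab hb
    obtain ⟨x, hx, rfl⟩ := h.exists_arclength_eq ⟨ha, hab.trans hb⟩
    obtain ⟨y, hy, rfl⟩ := h.exists_arclength_eq ⟨ha.trans hab, hb⟩
    rw [h.X_eq x hx, h.X_eq y hy]
    exact sub_nonneg.1 (hD x hx y hy ((h.strictMonoOn.le_iff_le hx hy).1 hab))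

lemma IsArcOf.reflectedBound_iff {C X τ : ℝ → Plane} {k : ℝ → ℝ} (h : IsArcOf Ω C X τ k) :
    ReflectedBound Ω X (curveLength C) c ε ↔
      ∀ x ∈ Icc (0 : ℝ) 1, ∀ y ∈ Icc (0 : ℝ) 1, ∀ z ∈ frontier Ω,
        0 ≤ reflectedDefect C c ε x y z := by
  constructor
  · intro hR x hx y hy z hz
    have := hR _ (h.arclength_mem hx) _ (h.arclength_mem hy) z hz
    rw [h.X_eq x hx, h.X_eq y hy] at this
    exact sub_nonneg.2 this
  · intro hR a ha b hb z hz
    obtain ⟨x, hx, rfl⟩ := h.exists_arclength_eq ha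
    obtain ⟨y, hy, rfl⟩ := h.exists_arclength_eq hb
    rw [h.X_eq x hx, h.X_eq y hy]
    exact sub_nonneg.1 (hR x hx y hy z hz)

/-- First derivative test at the first zero of a nonnegative function. -/
lemma deriv_nonpos_of_left_min {f : ℝ → ℝ} {f' t : ℝ} (hf : HasDerivAt f f' t) (h0 : f t = 0)
    (hmin : ∀ᶠ s in 𝓝[<] t, 0 ≤ f s) : f' ≤ 0 := by
  have h1 : HasDerivAt (fun r => f (t - r)) (-f') 0 := by
    have h2 : HasDerivAt (fun r : ℝ => t - r) (-1) 0 := (hasDerivAt_id (0 : ℝ)).const_sub t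
    have h3 : HasDerivAt f f' (t - 0) := by rwa [sub_zero]
    exact (h3.comp (0 : ℝ) h2).congr_deriv (by ring)
  have h2 : Tendsto (fun r : ℝ => t - r) (𝓝[>] 0) (𝓝[<] t) := by
    refine tendsto_nhdsWithin_iff.2 ⟨?_, ?_⟩
    · have : Tendsto (fun r : ℝ => t - r) (𝓝 0) (𝓝 (t - 0)) :=
        (continuous_const.sub continuous_id).continuousAt
      rw [sub_zero] at this
      exact this.mono_left nhdsWithin_le_nhds
    · filter_upwards [self_mem_nhdsWithin] with r hr
      have : 0 < r := hr
      simp [this]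
  have := deriv_nonneg_of_right_min h1 (by simpa using h0) (h2.eventually hmin)
  linarith

/-- Time derivative of the comparison term `𝐋 φ(ℓ/𝐋)`. -/
lemma hasDerivAt_comparison {L ℓ : ℝ → ℝ} {E e : ℝ} (hL : HasDerivAt L (-E) t)
    (hℓ : HasDerivAt ℓ (-e) t) (h0 : 0 < L t) :
    HasDerivAt (fun s => 2 * L s * model c ε (ℓ s / (2 * L s)))
      (-(2 * E * (model c ε (ℓ t / (2 * L t)) -
          ℓ t / (2 * L t) * model' c ε (ℓ t / (2 * L t))) +
        model' c ε (ℓ t / (2 * L t)) * e)) t := by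
  have h2L := hL.const_mul 2
  have h1 := (hasDerivAt_model c ε (ℓ t / (2 * L t))).comp t (hℓ.fun_div h2L (by positivity))
  refine (h2L.fun_mul h1).congr_deriv ?_
  simp only [Function.comp]
  have := h0.ne'
  field_simp
  ring

lemma hasDerivAt_norm_of_ne {V : ℝ → Plane} {V' : Plane} (hV : HasDerivAt V V' t) (h : V t ≠ 0) :
    HasDerivAt (fun s => ‖V s‖) (inner ℝ (‖V t‖⁻¹ • V t) V') t := by
  have h1 := hV.norm_sq.sqrt (by have := norm_pos_iff.2 h; positivity)
  simp only [Real.sqrt_sq (norm_nonneg _)] at h1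
  refine h1.congr_deriv ?_
  rw [inner_smul_left, RCLike.conj_to_real]
  have := norm_ne_zero_iff.2 h
  field_simp

/-- Time derivative of the direct defect, in terms of an arclength parametrisation. -/
lemma IsFreeBoundaryCSF.hasDerivAt_directDefect (hγ : IsFreeBoundaryCSF Ω T γ) (hT : 0 < T)
    (ht : t ∈ timeInterval T) (h0 : 0 < t) {X τ : ℝ → Plane} {k : ℝ → ℝ}
    (h : IsArcOf Ω (fun u => γ u t) X τ k) {x y : ℝ} (hx : x ∈ Icc (0 : ℝ) 1)
    (hy : y ∈ Icc (0 : ℝ) 1) {a b L : ℝ} (ha : a = arclength (fun u => γ u t) x)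
    (hb : b = arclength (fun u => γ u t) y) (hL : L = curveLength fun u => γ u t)
    (hne : X a ≠ X b) :
    HasDerivAt (fun s => directDefect (fun u => γ u s) c ε x y)
      (inner ℝ (‖X b - X a‖⁻¹ • (X b - X a)) (k b • rotJ (τ b) - k a • rotJ (τ a)) +
      2 * (∫ s in 0..L, k s ^ 2) * (model c ε ((b - a) / (2 * L)) -
        (b - a) / (2 * L) * model' c ε ((b - a) / (2 * L))) +
      model' c ε ((b - a) / (2 * L)) * ∫ s in a..b, k s ^ 2) t := by
  have m1 : (1 : ℝ) ∈ Icc (0 : ℝ) 1 := ⟨zero_le_one, le_rfl⟩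
  have hsplit : ∫ s in a..b, k s ^ 2 = (∫ s in 0..b, k s ^ 2) - ∫ s in 0..a, k s ^ 2 :=
    (intervalIntegral.integral_interval_sub_left (h.intervalIntegrable_sq 0 b)
      (h.intervalIntegrable_sq 0 a)).symm
  have eL := h.energy_eq 1 m1
  rw [arclength_one, ← hL] at eL
  have dL := hγ.hasDerivAt_arclength hT m1 ht h0
  have dℓ := (hγ.hasDerivAt_arclength hT hy ht h0).fun_sub (hγ.hasDerivAt_arclength hT hx ht h0)
  rw [← h.energy_eq x hx, ← h.energy_eq y hy, ← ha, ← hb,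
    show -(∫ s in 0..b, k s ^ 2) - -(∫ s in 0..a, k s ^ 2) =
      -((∫ s in 0..b, k s ^ 2) - ∫ s in 0..a, k s ^ 2) by ring] at dℓ
  rw [← eL] at dL
  have hcmp := hasDerivAt_comparison (c := c) (ε := ε) dL dℓ (h.L_pos)
  have hV := (hγ.hasDerivAt_time hT hy ht h0).fun_sub (hγ.hasDerivAt_time hT hx ht h0)
  rw [← h.k_eq x hx, ← h.T_eq x hx, ← h.k_eq y hy, ← h.T_eq y hy, ← ha, ← hb] at hV
  have eX : γ x t = X a := by rw [ha, h.X_eq x hx]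
  have eY : γ y t = X b := by rw [hb, h.X_eq y hy]
  have hd := hasDerivAt_norm_of_ne hV (by rw [eX, eY]; exact sub_ne_zero.2 hne.symm)
  rw [eX, eY] at hd
  have hfin := hd.fun_sub hcmp
  have hfun : (fun s => directDefect (fun u => γ u s) c ε x y) = fun s => ‖γ y s - γ x s‖ -
      2 * (∫ u in 0..1, ‖velocity (fun u => γ u s) u‖) *
        model c ε (((∫ u in 0..y, ‖velocity (fun u => γ u s) u‖) -
          ∫ u in 0..x, ‖velocity (fun u => γ u s) u‖) /
            (2 * ∫ u in 0..1, ‖velocity (fun u => γ u s) u‖)) := by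
    funext s
    rw [directDefect, dist_comm, dist_eq_norm]
    rfl
  rw [hfun]
  refine hfin.congr_deriv ?_
  rw [hsplit, ha, hb, hL]
  simp only [arclength, curveLength]
  ring

/-- Time derivative of the reflected defect, in terms of an arclength parametrisation. -/
lemma IsFreeBoundaryCSF.hasDerivAt_reflectedDefect (hγ : IsFreeBoundaryCSF Ω T γ) (hT : 0 < T)
    (ht : t ∈ timeInterval T) (h0 : 0 < t) {X τ : ℝ → Plane} {k : ℝ → ℝ}
    (h : IsArcOf Ω (fun u => γ u t) X τ k) {x y : ℝ} (hx : x ∈ Icc (0 : ℝ) 1)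
    (hy : y ∈ Icc (0 : ℝ) 1) {a b L : ℝ} (ha : a = arclength (fun u => γ u t) x)
    (hb : b = arclength (fun u => γ u t) y) (hL : L = curveLength fun u => γ u t) {z : Plane}
    (hxz : X a ≠ z) (hyz : X b ≠ z) :
    HasDerivAt (fun s => reflectedDefect (fun u => γ u s) c ε x y z)
      (inner ℝ (‖X a - z‖⁻¹ • (X a - z)) (k a • rotJ (τ a)) +
        inner ℝ (‖X b - z‖⁻¹ • (X b - z)) (k b • rotJ (τ b)) +
      2 * (∫ s in 0..L, k s ^ 2) * (model c ε ((a + b) / (2 * L)) -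
        (a + b) / (2 * L) * model' c ε ((a + b) / (2 * L))) +
      model' c ε ((a + b) / (2 * L)) * ((∫ s in 0..a, k s ^ 2) + ∫ s in 0..b, k s ^ 2)) t := by
  have m1 : (1 : ℝ) ∈ Icc (0 : ℝ) 1 := ⟨zero_le_one, le_rfl⟩
  have eL := h.energy_eq 1 m1
  rw [arclength_one, ← hL] at eL
  have dL := hγ.hasDerivAt_arclength hT m1 ht h0
  have dℓ := (hγ.hasDerivAt_arclength hT hx ht h0).fun_add (hγ.hasDerivAt_arclength hT hy ht h0)
  rw [← h.energy_eq x hx, ← h.energy_eq y hy, ← ha, ← hb, ← neg_add] at dℓ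
  rw [← eL] at dL
  have hcmp := hasDerivAt_comparison (c := c) (ε := ε) dL dℓ (h.L_pos)
  have hV := (hγ.hasDerivAt_time hT hx ht h0).sub_const z
  have hW := (hγ.hasDerivAt_time hT hy ht h0).sub_const z
  rw [← h.k_eq x hx, ← h.T_eq x hx, ← ha] at hV
  rw [← h.k_eq y hy, ← h.T_eq y hy, ← hb] at hW
  have eX : γ x t = X a := by rw [ha, h.X_eq x hx]
  have eY : γ y t = X b := by rw [hb, h.X_eq y hy]
  have hd := hasDerivAt_norm_of_ne hV (by rw [eX]; exact sub_ne_zero.2 hxz)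
  have hd' := hasDerivAt_norm_of_ne hW (by rw [eY]; exact sub_ne_zero.2 hyz)
  rw [eX] at hd
  rw [eY] at hd'
  have hfin := (hd.fun_add hd').fun_sub hcmp
  have hfun : (fun s => reflectedDefect (fun u => γ u s) c ε x y z) =
      fun s => ‖γ x s - z‖ + ‖γ y s - z‖ -
      2 * (∫ u in 0..1, ‖velocity (fun u => γ u s) u‖) *
        model c ε (((∫ u in 0..x, ‖velocity (fun u => γ u s) u‖) +
          ∫ u in 0..y, ‖velocity (fun u => γ u s) u‖) /
            (2 * ∫ u in 0..1, ‖velocity (fun u => γ u s) u‖)) := by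
    funext s
    rw [reflectedDefect, dist_eq_norm, dist_eq_norm]
    rfl
  rw [hfun]
  refine hfin.congr_deriv ?_
  rw [ha, hb, hL]
  simp only [arclength, curveLength]
  ring

/-- Arclength depends continuously on the parameter and on time. -/
lemma IsFreeBoundaryCSF.continuousOn_arclength (hγ : IsFreeBoundaryCSF Ω T γ) (hT : 0 < T)
    (ht : t ∈ timeInterval T) :
    ContinuousOn (fun p : ℝ × ℝ => arclength (fun u => γ u p.2) p.1) (Icc 0 1 ×ˢ Icc 0 t) := by
  have h01 : (0 : ℝ) ≤ 1 := zero_le_one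
  -- the speed, extended to the plane
  obtain ⟨g, hg, hge⟩ : ∃ g : ℝ → ℝ → ℝ, Continuous (fun p : ℝ × ℝ => g p.1 p.2) ∧
      ∀ s ∈ Icc 0 t, ∀ u ∈ Icc (0 : ℝ) 1, g s u = ‖velocity (fun u => γ u s) u‖ := by
    refine ⟨fun s u => ‖velocity (fun u => γ u (projIcc 0 t ht.1 s)) (projIcc 0 1 h01 u)‖, ?_,
      fun s hs u hu => by simp only [projIcc_of_mem ht.1 hs, projIcc_of_mem h01 hu]⟩
    have h1 := (hγ.contDiffOn_velocity hT).continuousOn.norm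
    refine h1.comp_continuous (f := fun p : ℝ × ℝ =>
      ((projIcc 0 1 h01 p.2 : ℝ), (projIcc 0 t ht.1 p.1 : ℝ))) ?_ fun p => ?_
    · exact ((continuous_subtype_val.comp continuous_projIcc).comp continuous_snd).prodMk
        ((continuous_subtype_val.comp continuous_projIcc).comp continuous_fst)
    · exact ⟨(projIcc 0 1 h01 p.2).2, Icc_subset_timeInterval ht (projIcc 0 t ht.1 p.1).2⟩
  have hA : Continuous fun p : ℝ × ℝ => ∫ u in (0 : ℝ)..p.1, g p.2 u :=
    intervalIntegral.continuous_parametric_intervalIntegral_of_continuous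
      (f := fun (p : ℝ × ℝ) u => g p.2 u)
      (hg.comp (continuous_fst.snd.prodMk continuous_snd)) continuous_fst
  refine hA.continuousOn.congr fun p hp => ?_
  apply intervalIntegral.integral_congr
  intro u hu
  rw [uIcc_of_le hp.1.1] at hu
  exact (hge p.2 hp.2 u ⟨hu.1, hu.2.trans hp.1.2⟩).symm

lemma IsFreeBoundaryCSF.continuousOn_curveLength (hγ : IsFreeBoundaryCSF Ω T γ) (hT : 0 < T)
    (ht : t ∈ timeInterval T) : ContinuousOn (fun s => curveLength fun u => γ u s) (Icc 0 t) :=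
  (hγ.continuousOn_arclength hT ht).comp (f := fun s : ℝ => ((1 : ℝ), s)) (by fun_prop)
    fun s hs => (⟨⟨zero_le_one, le_rfl⟩, hs⟩ : ((1 : ℝ), s) ∈ Icc (0 : ℝ) 1 ×ˢ Icc 0 t)

/-- The length is non-increasing along the flow. -/
lemma IsFreeBoundaryCSF.curveLength_antitoneOn (hγ : IsFreeBoundaryCSF Ω T γ) (hT : 0 < T)
    (ht : t ∈ timeInterval T) : AntitoneOn (fun s => curveLength fun u => γ u s) (Icc 0 t) := by
  have hd : ∀ s ∈ interior (Icc 0 t), HasDerivAt (fun s => curveLength fun u => γ u s) _ s :=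
    fun s hs => by
    rw [interior_Icc] at hs
    exact hγ.hasDerivAt_arclength hT ⟨zero_le_one, le_rfl⟩
      (Icc_subset_timeInterval ht (Ioo_subset_Icc_self hs)) hs.1
  refine antitoneOn_of_deriv_nonpos (convex_Icc 0 t) (hγ.continuousOn_curveLength hT ht)
    (fun s hs => (hd s hs).differentiableAt.differentiableWithinAt) fun s hs => ?_
  rw [(hd s hs).deriv, neg_nonpos]
  exact intervalIntegral.integral_nonneg zero_le_one fun u _ => by positivity

end Defect

/-! ### Preservation of the chord-arc bound -/

section Preservation

variable {Ω : Set Plane} {T : EReal} {γ : ℝ → ℝ → Plane} {c ε t : ℝ}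

/-- The smallness of length times curvature along the flow bounds the turning of the boundary near
the curve. -/
lemma IsFreeBoundaryCSF.smallTurning (hΩ : IsConvexC2Domain Ω) (hT : 0 < T)
    (hγ : IsFreeBoundaryCSF Ω T γ) {K : Set Plane}
    (hflowK : ∀ t ∈ timeInterval T, ∀ x ∈ Icc (0 : ℝ) 1, γ x t ∈ K)
    (hnearK : ∀ t ∈ timeInterval T, ∀ x ∈ ({0, 1} : Set ℝ),
      frontier Ω ∩ Metric.ball (γ x t) (3 * curveLength (fun u => γ u t)) ⊆ K)
    (hgapK : ∀ p ∈ frontier Ω \ K,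
      ¬ Bornology.IsBounded (connectedComponentIn (frontier Ω \ K) p))
    {C : ℝ} (hC : IsLUB (boundaryCurvature Ω '' (frontier Ω ∩ K)) C)
    (hε : ε ∈ Ioo (0 : ℝ) (1 / 10))
    (hL : curveLength (fun u => γ u 0) * (1 + C) ≤ ε / 1000)
    (ht : t ∈ timeInterval T) {X τ : ℝ → Plane} {k : ℝ → ℝ}
    (h : IsArcOf Ω (fun u => γ u t) X τ k) :
    SmallTurning Ω X τ (curveLength fun u => γ u t) ε := by
  have hL0 := h.L_pos
  have m0 : (0 : ℝ) ∈ Icc (0 : ℝ) 1 := ⟨le_rfl, zero_le_one⟩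
  have m1 : (1 : ℝ) ∈ Icc (0 : ℝ) 1 := ⟨zero_le_one, le_rfl⟩
  have hLC : curveLength (fun u => γ u t) * max (1 + C) 0 ≤ ε / 1000 := by
    have hanti := hγ.curveLength_antitoneOn hT ht ⟨le_rfl, ht.1⟩ ⟨ht.1, le_rfl⟩ ht.1
    rcases le_total (1 + C) 0 with h1 | h1
    · rw [max_eq_right h1, mul_zero]; linarith [hε.1]
    · rw [max_eq_left h1]
      exact (mul_le_mul_of_nonneg_right hanti h1).trans hL
  have e0 : X 0 = γ 0 t := by
    have := h.X_eq 0 m0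
    rwa [arclength_zero] at this
  have e1 : X (curveLength fun u => γ u t) = γ 1 t := by
    have := h.X_eq 1 m1
    rwa [arclength_one] at this
  have key : ∀ x ∈ ({0, 1} : Set ℝ), ∀ z ∈ frontier Ω,
      dist z (γ x t) ≤ 2 * curveLength (fun u => γ u t) →
      |inner ℝ (outwardNormal Ω (γ x t)) (boundaryTangent Ω z)| ≤ ε / 375 := by
    intro x hx z hz hd
    have hx' : x ∈ Icc (0 : ℝ) 1 := by
      rcases hx with rfl | rfl
      exacts [m0, m1]
    have hball : ∀ s ∈ frontier Ω, dist s (γ x t) ≤ dist z (γ x t) → s ∈ K := fun s hs hsd =>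
      hnearK t ht x hx ⟨hs, Metric.mem_ball.2 (by linarith)⟩
    have hmul : max (1 + C) 0 * dist z (γ x t) ≤ 2 * (ε / 1000) := by
      calc max (1 + C) 0 * dist z (γ x t)
          ≤ max (1 + C) 0 * (2 * curveLength fun u => γ u t) := by gcongr
        _ ≤ _ := by linarith
    have := hΩ.abs_inner_normal_tangent_le (hγ.endpoint_mem t ht x hx) hz (hflowK t ht x hx')
      (hball z hz le_rfl) hgapK (le_max_right (1 + C) 0)
      (fun s hs => lt_of_lt_of_le (lt_of_le_of_lt (hC.1 (mem_image_of_mem _ hs))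
        (by linarith : C < 1 + C)) (le_max_left _ _)) hball (by linarith [hε.2])
    rw [boundaryTangent, real_inner_comm, inner_rotJ_left, abs_neg] at this
    exact this.trans (by linarith)
  refine ⟨fun z hz hd => ?_, fun z hz hd => ?_⟩
  · rw [h.T_zero, inner_neg_left, abs_neg, e0]
    exact key 0 (by simp) z hz (by rwa [e0] at hd)
  · rw [h.T_end, e1]
    exact key 1 (by simp) z hz (by rwa [e1] at hd)

lemma IsFreeBoundaryCSF.continuousOn_comp_position (hγ : IsFreeBoundaryCSF Ω T γ)
    (ht : t ∈ timeInterval T) {P : Type*} [TopologicalSpace P] {S : Set P} {x s : P → ℝ}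
    (hx : ContinuousOn x S) (hs : ContinuousOn s S) (hxm : MapsTo x S (Icc 0 1))
    (hsm : MapsTo s S (Icc 0 t)) : ContinuousOn (fun p => γ (x p) (s p)) S :=
  ContinuousOn.comp (g := fun p : ℝ × ℝ => γ p.1 p.2) (f := fun p => (x p, s p))
    hγ.smooth.continuousOn (hx.prodMk hs) fun p hp =>
    (⟨hxm hp, Icc_subset_timeInterval ht (hsm hp)⟩ :
      (x p, s p) ∈ Icc (0 : ℝ) 1 ×ˢ timeInterval T)

lemma IsFreeBoundaryCSF.continuousOn_comp_arclength (hγ : IsFreeBoundaryCSF Ω T γ) (hT : 0 < T)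
    (ht : t ∈ timeInterval T) {P : Type*} [TopologicalSpace P] {S : Set P} {x s : P → ℝ}
    (hx : ContinuousOn x S) (hs : ContinuousOn s S) (hxm : MapsTo x S (Icc 0 1))
    (hsm : MapsTo s S (Icc 0 t)) : ContinuousOn (fun p => arclength (fun u => γ u (s p)) (x p)) S :=
  ContinuousOn.comp (g := fun p : ℝ × ℝ => arclength (fun u => γ u p.2) p.1)
    (f := fun p => (x p, s p)) (hγ.continuousOn_arclength hT ht) (hx.prodMk hs) fun p hp =>
      (⟨hxm hp, hsm hp⟩ : (x p, s p) ∈ Icc (0 : ℝ) 1 ×ˢ Icc 0 t)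

lemma IsFreeBoundaryCSF.curveLength_pos (hγ : IsFreeBoundaryCSF Ω T γ) (hT : 0 < T)
    (hΩ : IsConvexC2Domain Ω) (ht : t ∈ timeInterval T) : 0 < curveLength fun u => γ u t := by
  obtain ⟨X, τ, k, h⟩ := hγ.exists_arc hT hΩ ht
  exact h.L_pos

lemma IsFreeBoundaryCSF.continuousOn_directDefect (hγ : IsFreeBoundaryCSF Ω T γ) (hT : 0 < T)
    (hΩ : IsConvexC2Domain Ω) (ht : t ∈ timeInterval T) {P : Type*} [TopologicalSpace P] {S : Set P}
    {x y s : P → ℝ} (hx : ContinuousOn x S) (hy : ContinuousOn y S) (hs : ContinuousOn s S)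
    (hxm : MapsTo x S (Icc 0 1)) (hym : MapsTo y S (Icc 0 1)) (hsm : MapsTo s S (Icc 0 t)) :
    ContinuousOn (fun p => directDefect (fun u => γ u (s p)) c ε (x p) (y p)) S := by
  have hL : ContinuousOn (fun p => 2 * curveLength fun u => γ u (s p)) S :=
    continuousOn_const.mul (ContinuousOn.comp (g := fun s => curveLength fun u => γ u s)
      (hγ.continuousOn_curveLength hT ht) hs hsm)
  have hL0 : ∀ p ∈ S, (2 * curveLength fun u => γ u (s p)) ≠ 0 := fun p hp =>
    (mul_pos two_pos (hγ.curveLength_pos hT hΩ (Icc_subset_timeInterval ht (hsm hp)))).ne'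
  have hX := hγ.continuousOn_comp_position ht hx hs hxm hsm
  have hY := hγ.continuousOn_comp_position ht hy hs hym hsm
  have hA := hγ.continuousOn_comp_arclength hT ht hx hs hxm hsm
  have hB := hγ.continuousOn_comp_arclength hT ht hy hs hym hsm
  exact (continuous_dist.comp_continuousOn (ContinuousOn.prodMk hX hY)).sub (hL.mul
    ((continuous_model c ε).comp_continuousOn (ContinuousOn.div (ContinuousOn.sub hB hA) hL hL0)))

lemma IsFreeBoundaryCSF.continuousOn_reflectedDefect (hγ : IsFreeBoundaryCSF Ω T γ) (hT : 0 < T)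
    (hΩ : IsConvexC2Domain Ω) (ht : t ∈ timeInterval T) {P : Type*} [TopologicalSpace P] {S : Set P}
    {x y s : P → ℝ} {z : P → Plane} (hx : ContinuousOn x S) (hy : ContinuousOn y S)
    (hs : ContinuousOn s S) (hz : ContinuousOn z S)
    (hxm : MapsTo x S (Icc 0 1)) (hym : MapsTo y S (Icc 0 1)) (hsm : MapsTo s S (Icc 0 t)) :
    ContinuousOn (fun p => reflectedDefect (fun u => γ u (s p)) c ε (x p) (y p) (z p)) S := by
  have hL : ContinuousOn (fun p => 2 * curveLength fun u => γ u (s p)) S :=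
    continuousOn_const.mul (ContinuousOn.comp (g := fun s => curveLength fun u => γ u s)
      (hγ.continuousOn_curveLength hT ht) hs hsm)
  have hL0 : ∀ p ∈ S, (2 * curveLength fun u => γ u (s p)) ≠ 0 := fun p hp =>
    (mul_pos two_pos (hγ.curveLength_pos hT hΩ (Icc_subset_timeInterval ht (hsm hp)))).ne'
  have hX := hγ.continuousOn_comp_position ht hx hs hxm hsm
  have hY := hγ.continuousOn_comp_position ht hy hs hym hsm
  have hA := hγ.continuousOn_comp_arclength hT ht hx hs hxm hsm
  have hB := hγ.continuousOn_comp_arclength hT ht hy hs hym hsm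
  exact (ContinuousOn.add (continuous_dist.comp_continuousOn (ContinuousOn.prodMk hX hz)) 
    (continuous_dist.comp_continuousOn (ContinuousOn.prodMk hY hz))).sub (hL.mul
    ((continuous_model c ε).comp_continuousOn (ContinuousOn.div (ContinuousOn.add hA hB) hL hL0)))

/-- If the chord-arc bounds have held up to time `t`, then the direct one is strict at time `t`. -/
lemma IsFreeBoundaryCSF.directDefect_pos (hγ : IsFreeBoundaryCSF Ω T γ) (hT : 0 < T)
    (hΩ : IsConvexC2Domain Ω) (hε : ε ∈ Ioo (0 : ℝ) (1 / 10)) (hc : c ∈ Ioo (0 : ℝ) (1 / 100))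
    (ht : t ∈ timeInterval T) (h0 : 0 < t) {X τ : ℝ → Plane} {k : ℝ → ℝ}
    (h : IsArcOf Ω (fun u => γ u t) X τ k)
    (hD : DirectBound X (curveLength fun u => γ u t) c ε)
    (hR : ReflectedBound Ω X (curveLength fun u => γ u t) c ε) {x y : ℝ}
    (hx : x ∈ Icc (0 : ℝ) 1) (hy : y ∈ Icc (0 : ℝ) 1) (hxy : x < y)
    (hpast : ∀ s ∈ Ico 0 t, 0 ≤ directDefect (fun u => γ u s) c ε x y) :
    0 < directDefect (fun u => γ u t) c ε x y := by
  refine lt_of_le_of_ne (h.directBound_iff.1 hD x hx y hy hxy.le) fun heq => ?_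
  have hlt := h.strictMonoOn hx hy hxy
  have hxm := h.arclength_mem hx
  have hym := h.arclength_mem hy
  have hL := h.L_pos
  have heq' : dist (X (arclength (fun u => γ u t) x)) (X (arclength (fun u => γ u t) y)) =
      2 * (curveLength fun u => γ u t) * model c ε ((arclength (fun u => γ u t) y -
        arclength (fun u => γ u t) x) / (2 * curveLength fun u => γ u t)) := by
    rw [h.X_eq x hx, h.X_eq y hy]
    exact sub_eq_zero.1 heq.symm
  have hne : X (arclength (fun u => γ u t) x) ≠ X (arclength (fun u => γ u t) y) := by
    rw [← dist_pos, heq']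
    refine mul_pos (by linarith) (model_pos hε hc.1 (div_pos (by linarith) (by linarith)) ?_)
    rw [div_lt_one (by linarith)]
    linarith [hxm.1, hym.2]
  have hpos := h.direct_rate_pos hΩ hε hc hD hR hxm.1 hlt hym.2 heq'
  have hder := hγ.hasDerivAt_directDefect (c := c) (ε := ε) hT ht h0 h hx hy rfl rfl rfl hne
  have := deriv_nonpos_of_left_min hder heq.symm (by
    filter_upwards [Ioo_mem_nhdsLT h0] with s hs
    exact hpast s ⟨hs.1.le, hs.2⟩)
  linarith

/-- If the chord-arc bounds have held up to time `t`, then the reflected one is strict at time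
`t`. -/
lemma IsFreeBoundaryCSF.reflectedDefect_pos (hγ : IsFreeBoundaryCSF Ω T γ) (hT : 0 < T)
    (hΩ : IsConvexC2Domain Ω) (hε : ε ∈ Ioo (0 : ℝ) (1 / 10)) (hc : c ∈ Ioo (0 : ℝ) (1 / 100))
    (ht : t ∈ timeInterval T) (h0 : 0 < t) {X τ : ℝ → Plane} {k : ℝ → ℝ}
    (h : IsArcOf Ω (fun u => γ u t) X τ k)
    (hG : SmallTurning Ω X τ (curveLength fun u => γ u t) ε)
    (hD : DirectBound X (curveLength fun u => γ u t) c ε)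
    (hR : ReflectedBound Ω X (curveLength fun u => γ u t) c ε)
    (hpastD : ∀ s ∈ Ico 0 t, ∀ x ∈ Icc (0 : ℝ) 1, ∀ y ∈ Icc (0 : ℝ) 1, x ≤ y →
      0 ≤ directDefect (fun u => γ u s) c ε x y) {x y : ℝ} {z : Plane}
    (hx : x ∈ Icc (0 : ℝ) 1) (hy : y ∈ Icc (0 : ℝ) 1) (hz : z ∈ frontier Ω)
    (hxy : 0 < x + y) (hxy' : x + y < 2)
    (hpast : ∀ s ∈ Ico 0 t, 0 ≤ reflectedDefect (fun u => γ u s) c ε x y z) :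
    0 < reflectedDefect (fun u => γ u t) c ε x y z := by
  wlog hle : x ≤ y generalizing x y
  · have hcomm : ∀ s, reflectedDefect (fun u => γ u s) c ε x y z =
        reflectedDefect (fun u => γ u s) c ε y x z := fun s => by
      rw [reflectedDefect, reflectedDefect, add_comm (dist _ z), add_comm (arclength _ x)]
    rw [hcomm]
    exact this hy hx (by linarith) (by linarith) (fun s hs => by rw [← hcomm]; exact hpast s hs)
      (by linarith)
  refine lt_of_le_of_ne (h.reflectedBound_iff.1 hR x hx y hy z hz) fun heq => ?_
  have hL := h.L_pos
  have heq' : dist (X (arclength (fun u => γ u t) x)) z +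
      dist (X (arclength (fun u => γ u t) y)) z =
      2 * (curveLength fun u => γ u t) * model c ε ((arclength (fun u => γ u t) x +
        arclength (fun u => γ u t) y) / (2 * curveLength fun u => γ u t)) := by
    rw [h.X_eq x hx, h.X_eq y hy]
    exact sub_eq_zero.1 heq.symm
  have htri : dist (X (arclength (fun u => γ u t) x)) (X (arclength (fun u => γ u t) y)) ≤
      dist (X (arclength (fun u => γ u t) x)) z + dist (X (arclength (fun u => γ u t) y)) z :=
    dist_triangle_right _ _ _
  rw [heq', h.X_eq x hx, h.X_eq y hy] at htri
  have hstrict : x < y → 0 < directDefect (fun u => γ u t) c ε x y := fun hlt =>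
    hγ.directDefect_pos hT hΩ hε hc ht h0 h hD hR hx hy hlt fun s hs => hpastD s hs x hx y hy hle
  rcases hx.1.eq_or_lt with hx0 | hx0
  · -- a reflected chord from the starting point is at least as long as the direct chord
    have := hstrict (by linarith)
    rw [directDefect, ← hx0, arclength_zero, sub_zero] at this
    rw [← hx0, arclength_zero, zero_add] at htri
    linarith
  rcases hy.2.eq_or_lt with hy1 | hy1
  · -- similarly for a reflected chord from the end point
    have := hstrict (by linarith)
    rw [directDefect, hy1, arclength_one] at this
    rw [hy1, arclength_one] at htri
    set L := curveLength fun u => γ u t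
    rw [show (arclength (fun u => γ u t) x + L) / (2 * L) =
      1 - (L - arclength (fun u => γ u t) x) / (2 * L) by field_simp; ring, model_symm] at htri
    linarith
  have hxI : x ∈ Ioo (0 : ℝ) 1 := ⟨hx0, by linarith⟩
  have hyI : y ∈ Ioo (0 : ℝ) 1 := ⟨by linarith, hy1⟩
  have hxm := h.arclength_mem_Ioo hxI
  have hym := h.arclength_mem_Ioo hyI
  have hne : ∀ a ∈ Ioo 0 (curveLength fun u => γ u t), X a ≠ z := fun a ha hz' =>
    hz.2 (hz' ▸ h.interior_mem a ha)
  -- the reflection point is close to both endpoints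
  have hφ : dist (X (arclength (fun u => γ u t) x)) z +
      dist (X (arclength (fun u => γ u t) y)) z ≤ 63 / 2000 * (arclength (fun u => γ u t) x +
        arclength (fun u => γ u t) y) := by
    rw [heq']
    have h1 := mul_le_mul_of_nonneg_left (model_le_mul hε hc
      (s := (arclength (fun u => γ u t) x + arclength (fun u => γ u t) y) /
        (2 * curveLength fun u => γ u t))
      (div_nonneg (by linarith [hxm.1, hym.1]) (by linarith)))
      (by linarith : 0 ≤ 2 * curveLength fun u => γ u t)
    have h2 : 2 * (curveLength fun u => γ u t) * (63 / 2000 * ((arclength (fun u => γ u t) x +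
      arclength (fun u => γ u t) y) / (2 * curveLength fun u => γ u t))) =
      63 / 2000 * (arclength (fun u => γ u t) x + arclength (fun u => γ u t) y) := by field_simp
    linarith
  have hd0 := dist_nonneg (x := X (arclength (fun u => γ u t) y)) (y := z)
  have hG₀ := hG.start z hz (by
    have h1 := h.dist_le hxm.1.le
    have h2 := dist_triangle_left z (X 0) (X (arclength (fun u => γ u t) x))
    linarith [hxm.2, hym.2])
  have hG₁ := hG.finish z hz (by
    have h1 := h.dist_le hxm.2.le
    have h2 := dist_triangle_left z (X (curveLength fun u => γ u t))
      (X (arclength (fun u => γ u t) x))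
    rw [dist_comm (X (curveLength fun u => γ u t))] at h1
    linarith [hxm.1, hxm.2, hym.2])
  have hpos := h.reflected_rate_pos hΩ hε hc hR hxm hym hz hG₀ hG₁ heq'
  have hder := hγ.hasDerivAt_reflectedDefect (c := c) (ε := ε) hT ht h0 h hx hy rfl rfl rfl
    (hne _ hxm) (hne _ hym)
  have := deriv_nonpos_of_left_min hder heq.symm (by
    filter_upwards [Ioo_mem_nhdsLT h0] with s hs
    exact hpast s ⟨hs.1.le, hs.2⟩)
  linarith

lemma nonneg_of_left {f : ℝ → ℝ} (h0 : 0 < t) (hf : ContinuousOn f (Icc 0 t))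
    (h : ∀ s ∈ Ioo 0 t, 0 ≤ f s) : 0 ≤ f t := by
  have h1 : Tendsto f (𝓝[<] t) (𝓝 (f t)) := by
    rw [← nhdsWithin_Ico_eq_nhdsLT h0]
    exact (hf t ⟨h0.le, le_rfl⟩).mono Ico_subset_Icc_self
  refine ge_of_tendsto h1 ?_
  filter_upwards [Ioo_mem_nhdsLT h0] with s hs
  exact h s hs

end Preservation

section Continuity

variable {Ω : Set Plane} {T : EReal} {γ : ℝ → ℝ → Plane} {c ε : ℝ}

/-- On a compact time interval, the chord-arc bounds hold uniformly for short chords. -/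
lemma IsFreeBoundaryCSF.exists_short (hγ : IsFreeBoundaryCSF Ω T γ) (hT : 0 < T)
    (hΩ : IsConvexC2Domain Ω) (hε : ε ∈ Ioo (0 : ℝ) (1 / 10)) (hc : c ∈ Ioo (0 : ℝ) (1 / 100))
    (hG : ∀ t ∈ timeInterval T, ∀ (X τ : ℝ → Plane) (k : ℝ → ℝ),
      IsArcOf Ω (fun u => γ u t) X τ k → SmallTurning Ω X τ (curveLength fun u => γ u t) ε)
    {t₁ : ℝ} (ht₁ : t₁ ∈ timeInterval T) :
    ∃ δ > 0, ∀ s ∈ Icc 0 t₁, ∀ x ∈ Icc (0 : ℝ) 1, ∀ y ∈ Icc (0 : ℝ) 1,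
      (x ≤ y → arclength (fun u => γ u s) y - arclength (fun u => γ u s) x ≤ δ →
        0 ≤ directDefect (fun u => γ u s) c ε x y) ∧
      ∀ z ∈ frontier Ω, (arclength (fun u => γ u s) x + arclength (fun u => γ u s) y ≤ δ ∨
        2 * (curveLength fun u => γ u s) -
          (arclength (fun u => γ u s) x + arclength (fun u => γ u s) y) ≤ δ) →
        0 ≤ reflectedDefect (fun u => γ u s) c ε x y z := by
  have hsub := Icc_subset_timeInterval ht₁
  obtain ⟨M, hM⟩ := (isCompact_Icc.prod isCompact_Icc).exists_bound_of_continuousOn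
    ((hγ.continuousOn_curvature hT).mono (prod_mono_right hsub))
  have hM0 : 0 ≤ M := (norm_nonneg _).trans
    (hM (0, 0) ⟨⟨le_rfl, zero_le_one⟩, ⟨le_rfl, ht₁.1⟩⟩)
  have hL₁ := hγ.curveLength_pos hT hΩ ht₁
  set a₀ := min (curveLength fun u => γ u t₁) (1 / (2 * (M + 1))) with ha₀
  have ha₀pos : 0 < a₀ := lt_min hL₁ (by positivity)
  have ha₀M : a₀ * M ≤ 1 / 2 := by
    calc a₀ * M ≤ 1 / (2 * (M + 1)) * (M + 1) := by gcongr; exacts [min_le_right _ _, by linarith]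
      _ = 1 / 2 := by field_simp
  refine ⟨a₀ / 4, by positivity, fun s hs x hx y hy => ?_⟩
  obtain ⟨X, τ, k, h⟩ := hγ.exists_arc hT hΩ (hsub hs)
  have hL := h.L_pos
  have hxm := h.arclength_mem hx
  have hym := h.arclength_mem hy
  have hk : ∀ r ∈ Icc 0 (curveLength fun u => γ u s), |k r| ≤ M := fun r hr => by
    obtain ⟨x, hx, rfl⟩ := h.exists_arclength_eq hr
    rw [h.k_eq x hx]
    exact hM (x, s) ⟨hx, hs⟩
  have ha₀L : a₀ ≤ curveLength fun u => γ u s := (min_le_left _ _).trans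
    (hγ.curveLength_antitoneOn hT ht₁ hs ⟨ht₁.1, le_rfl⟩ hs.2)
  have hturn := hG s (hsub hs) X τ k h
  refine ⟨fun hxy hle => ?_, fun z hz hle => ?_⟩
  · rcases (h.strictMonoOn.monotoneOn hx hy hxy).eq_or_lt with he | hlt
    · rw [directDefect, he, sub_self, zero_div, model_zero, mul_zero, sub_zero]
      exact dist_nonneg
    · have := h.toUnitArc.direct_short hL hε hc hk ha₀M hxm.1 hlt hym.2 (by linarith)
      rw [h.X_eq x hx, h.X_eq y hy] at this
      exact (sub_pos.2 this).le
  · have hX := h.X_eq x hx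
    have hY := h.X_eq y hy
    rcases hle with hle | hle
    · rcases (add_nonneg hxm.1 hym.1).eq_or_lt with he | hlt
      · rw [reflectedDefect, ← he, zero_div, model_zero, mul_zero, sub_zero]
        positivity
      · have := h.reflected_short hΩ hε hc hturn hk ha₀L ha₀M hxm.1 hym.1 hlt hle hz
        rw [hX, hY] at this
        exact (sub_pos.2 this).le
    · rcases (by linarith [hxm.2, hym.2] : 0 ≤ 2 * (curveLength fun u => γ u s) -
          (arclength (fun u => γ u s) x + arclength (fun u => γ u s) y)).eq_or_lt with he | hlt
      · rw [reflectedDefect, ← sub_eq_zero.1 he.symm, div_self (by linarith), model_one, mul_zero,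
          sub_zero]
        positivity
      · have := h.reflected_short' hΩ hε hc hturn hk ha₀L ha₀M hxm.2 hym.2 hlt hle hz
        rw [hX, hY] at this
        exact (sub_pos.2 this).le

/-- If the chord-arc bounds hold strictly at the initial time, then they hold at all times: at a
first time at which one of the defects vanished, its time derivative would be positive. -/
theorem IsFreeBoundaryCSF.defects_nonneg (hγ : IsFreeBoundaryCSF Ω T γ) (hT : 0 < T)
    (hΩ : IsConvexC2Domain Ω) (hε : ε ∈ Ioo (0 : ℝ) (1 / 10)) (hc : c ∈ Ioo (0 : ℝ) (1 / 100))
    {K : Set Plane} (hK : IsCompact K)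
    (hflowK : ∀ t ∈ timeInterval T, ∀ x ∈ Icc (0 : ℝ) 1, γ x t ∈ K)
    (hG : ∀ t ∈ timeInterval T, ∀ (X τ : ℝ → Plane) (k : ℝ → ℝ),
      IsArcOf Ω (fun u => γ u t) X τ k → SmallTurning Ω X τ (curveLength fun u => γ u t) ε)
    (h0D : ∀ x ∈ Icc (0 : ℝ) 1, ∀ y ∈ Icc (0 : ℝ) 1, x < y →
      0 < directDefect (fun u => γ u 0) c ε x y)
    (h0R : ∀ x ∈ Icc (0 : ℝ) 1, ∀ y ∈ Icc (0 : ℝ) 1, ∀ z ∈ frontier Ω, 0 < x + y → x + y < 2 →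
      0 < reflectedDefect (fun u => γ u 0) c ε x y z)
    {t₁ : ℝ} (ht₁ : t₁ ∈ timeInterval T) :
    (∀ x ∈ Icc (0 : ℝ) 1, ∀ y ∈ Icc (0 : ℝ) 1, x ≤ y →
      0 ≤ directDefect (fun u => γ u t₁) c ε x y) ∧
    ∀ x ∈ Icc (0 : ℝ) 1, ∀ y ∈ Icc (0 : ℝ) 1, ∀ z ∈ frontier Ω,
      0 ≤ reflectedDefect (fun u => γ u t₁) c ε x y z := by
  have hsub := Icc_subset_timeInterval ht₁
  obtain ⟨δ, hδ, hshort⟩ := hγ.exists_short hT hΩ hε hc hG ht₁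
  obtain ⟨ρ, hρ⟩ := hK.isBounded.subset_closedBall (0 : Plane)
  -- reflection points which compete with the comparison function stay in a compact set
  set Z : Set Plane := frontier Ω ∩ Metric.closedBall 0 (ρ + 2 * curveLength fun u => γ u 0)
  have hZ : IsCompact Z := (isCompact_closedBall _ _).inter_left isClosed_frontier
  have hZmem : ∀ s ∈ Icc 0 t₁, ∀ x ∈ Icc (0 : ℝ) 1, ∀ y ∈ Icc (0 : ℝ) 1, ∀ z ∈ frontier Ω,
      reflectedDefect (fun u => γ u s) c ε x y z ≤ 0 → z ∈ Z := by
    intro s hs x hx y hy z hz hle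
    refine ⟨hz, ?_⟩
    obtain ⟨X, τ, k, h⟩ := hγ.exists_arc hT hΩ (hsub hs)
    have hL := h.L_pos
    have hanti := hγ.curveLength_antitoneOn hT ht₁ ⟨le_rfl, ht₁.1⟩ hs hs.1
    have hs0 : 0 ≤ (arclength (fun u => γ u s) x + arclength (fun u => γ u s) y) /
        (2 * curveLength fun u => γ u s) :=
      div_nonneg (add_nonneg (h.arclength_mem hx).1 (h.arclength_mem hy).1) (by linarith)
    have hs1 : (arclength (fun u => γ u s) x + arclength (fun u => γ u s) y) /
        (2 * curveLength fun u => γ u s) ≤ 1 := by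
      rw [div_le_one (by linarith)]
      linarith [(h.arclength_mem hx).2, (h.arclength_mem hy).2]
    have hm : model c ε ((arclength (fun u => γ u s) x + arclength (fun u => γ u s) y) /
        (2 * curveLength fun u => γ u s)) ≤ 1 := by
      have := model_le_mul hε hc hs0
      linarith
    have hm' := mul_le_mul_of_nonneg_left hm
      (by linarith : 0 ≤ 2 * curveLength fun u => γ u s)
    rw [reflectedDefect] at hle
    have h1 := hρ (hflowK s (hsub hs) x hx)
    rw [Metric.mem_closedBall] at h1 ⊢
    have h2 := dist_triangle_left z 0 (γ x s)
    have h3 := dist_nonneg (x := γ y s) (y := z)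
    simp only at hanti
    linarith
  -- the space-time points at which the inequalities fail to be strict
  set SD : Set (ℝ × ℝ × ℝ) := Icc 0 t₁ ×ˢ Icc 0 1 ×ˢ Icc 0 1
  set SR : Set (ℝ × ℝ × ℝ × Plane) := Icc 0 t₁ ×ˢ Icc 0 1 ×ˢ Icc 0 1 ×ˢ Z
  set BD : Set (ℝ × ℝ × ℝ) := SD ∩ (fun p =>
    (arclength (fun u => γ u p.1) p.2.2 - arclength (fun u => γ u p.1) p.2.1,
      directDefect (fun u => γ u p.1) c ε p.2.1 p.2.2)) ⁻¹' (Ici δ ×ˢ Iic 0) with hBD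
  set BR : Set (ℝ × ℝ × ℝ × Plane) := SR ∩ (fun p =>
    (arclength (fun u => γ u p.1) p.2.1 + arclength (fun u => γ u p.1) p.2.2.1,
      2 * (curveLength fun u => γ u p.1) -
        (arclength (fun u => γ u p.1) p.2.1 + arclength (fun u => γ u p.1) p.2.2.1),
      reflectedDefect (fun u => γ u p.1) c ε p.2.1 p.2.2.1 p.2.2.2)) ⁻¹'
        (Ici δ ×ˢ Ici δ ×ˢ Iic 0) with hBR
  have hBDc : IsCompact BD := by
    have hSD : IsCompact SD := isCompact_Icc.prod (isCompact_Icc.prod isCompact_Icc)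
    have c1 : ContinuousOn (fun p : ℝ × ℝ × ℝ => p.1) SD := by fun_prop
    have c2 : ContinuousOn (fun p : ℝ × ℝ × ℝ => p.2.1) SD := by fun_prop
    have c3 : ContinuousOn (fun p : ℝ × ℝ × ℝ => p.2.2) SD := by fun_prop
    have m1 : MapsTo (fun p : ℝ × ℝ × ℝ => p.1) SD (Icc 0 t₁) := fun p hp => hp.1
    have m2 : MapsTo (fun p : ℝ × ℝ × ℝ => p.2.1) SD (Icc 0 1) := fun p hp => hp.2.1
    have m3 : MapsTo (fun p : ℝ × ℝ × ℝ => p.2.2) SD (Icc 0 1) := fun p hp => hp.2.2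
    refine hSD.of_isClosed_subset (ContinuousOn.preimage_isClosed_of_isClosed
      (ContinuousOn.prodMk (ContinuousOn.sub
        (hγ.continuousOn_comp_arclength hT ht₁ c3 c1 m3 m1)
        (hγ.continuousOn_comp_arclength hT ht₁ c2 c1 m2 m1))
        (hγ.continuousOn_directDefect hT hΩ ht₁ c2 c3 c1 m2 m3 m1)) hSD.isClosed
        (isClosed_Ici.prod isClosed_Iic)) inter_subset_left
  have hBRc : IsCompact BR := by
    have hSR : IsCompact SR := isCompact_Icc.prod (isCompact_Icc.prod (isCompact_Icc.prod hZ))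
    have c1 : ContinuousOn (fun p : ℝ × ℝ × ℝ × Plane => p.1) SR := by fun_prop
    have c2 : ContinuousOn (fun p : ℝ × ℝ × ℝ × Plane => p.2.1) SR := by fun_prop
    have c3 : ContinuousOn (fun p : ℝ × ℝ × ℝ × Plane => p.2.2.1) SR := by fun_prop
    have c4 : ContinuousOn (fun p : ℝ × ℝ × ℝ × Plane => p.2.2.2) SR := by fun_prop
    have m1 : MapsTo (fun p : ℝ × ℝ × ℝ × Plane => p.1) SR (Icc 0 t₁) := fun p hp => hp.1
    have m2 : MapsTo (fun p : ℝ × ℝ × ℝ × Plane => p.2.1) SR (Icc 0 1) := fun p hp => hp.2.1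
    have m3 : MapsTo (fun p : ℝ × ℝ × ℝ × Plane => p.2.2.1) SR (Icc 0 1) := fun p hp => hp.2.2.1
    have hA := ContinuousOn.add (hγ.continuousOn_comp_arclength hT ht₁ c2 c1 m2 m1)
      (hγ.continuousOn_comp_arclength hT ht₁ c3 c1 m3 m1)
    have hL : ContinuousOn (fun p : ℝ × ℝ × ℝ × Plane => 2 * curveLength fun u => γ u p.1) SR :=
      continuousOn_const.mul (ContinuousOn.comp (g := fun s => curveLength fun u => γ u s)
        (hγ.continuousOn_curveLength hT ht₁) c1 m1)
    refine hSR.of_isClosed_subset (ContinuousOn.preimage_isClosed_of_isClosed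
      (ContinuousOn.prodMk hA (ContinuousOn.prodMk (ContinuousOn.sub hL hA)
        (hγ.continuousOn_reflectedDefect hT hΩ ht₁ c2 c3 c1 c4 m2 m3 m1))) hSR.isClosed
        (isClosed_Ici.prod (isClosed_Ici.prod isClosed_Iic))) inter_subset_left
  set B : Set ℝ := Prod.fst '' BD ∪ Prod.fst '' BR
  have hB : IsCompact B := (hBDc.image continuous_fst).union (hBRc.image continuous_fst)
  -- outside these times the bounds hold
  have hgood : ∀ s ∈ Icc 0 t₁, s ∉ B →
      (∀ x ∈ Icc (0 : ℝ) 1, ∀ y ∈ Icc (0 : ℝ) 1, x ≤ y →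
        0 ≤ directDefect (fun u => γ u s) c ε x y) ∧
      ∀ x ∈ Icc (0 : ℝ) 1, ∀ y ∈ Icc (0 : ℝ) 1, ∀ z ∈ frontier Ω,
        0 ≤ reflectedDefect (fun u => γ u s) c ε x y z := by
    intro s hs hsB
    refine ⟨fun x hx y hy hxy => ?_, fun x hx y hy z hz => ?_⟩
    · by_contra hcon
      have h1 : δ ≤ arclength (fun u => γ u s) y - arclength (fun u => γ u s) x :=
        le_of_not_ge fun hle => hcon ((hshort s hs x hx y hy).1 hxy hle)
      exact hsB (Or.inl ⟨(s, x, y), ⟨⟨hs, hx, hy⟩, h1, (not_le.1 hcon).le⟩, rfl⟩)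
    · by_contra hcon
      have h1 : δ ≤ arclength (fun u => γ u s) x + arclength (fun u => γ u s) y :=
        le_of_not_ge fun hle => hcon ((hshort s hs x hx y hy).2 z hz (Or.inl hle))
      have h2 : δ ≤ 2 * (curveLength fun u => γ u s) -
          (arclength (fun u => γ u s) x + arclength (fun u => γ u s) y) :=
        le_of_not_ge fun hle => hcon ((hshort s hs x hx y hy).2 z hz (Or.inr hle))
      have h3 := (not_le.1 hcon).le
      exact hsB (Or.inr ⟨(s, x, y, z), ⟨⟨hs, hx, hy, hZmem s hs x hx y hy z hz h3⟩, h1, h2, h3⟩,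
        rfl⟩)
  suffices hempty : B = ∅ by
    exact hgood t₁ ⟨ht₁.1, le_rfl⟩ (by rw [hempty]; exact notMem_empty _)
  by_contra hne
  obtain ⟨t, htB, hmin⟩ := hB.exists_isLeast (nonempty_iff_ne_empty.2 hne)
  have htI : t ∈ Icc 0 t₁ := by
    rcases htB with ⟨p, hp, rfl⟩ | ⟨p, hp, rfl⟩
    exacts [hp.1.1, hp.1.1]
  have ht := hsub htI
  have hpast : ∀ s ∈ Ico 0 t, _ := fun s hs =>
    hgood s ⟨hs.1, hs.2.le.trans htI.2⟩ fun h => absurd (hmin h) (not_le.2 hs.2)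
  obtain ⟨X, τ, k, h⟩ := hγ.exists_arc hT hΩ ht
  -- at the first such time the inequalities are strict: initially by assumption, later by the
  -- evolution of the defects
  obtain ⟨hstrictD, hstrictR⟩ : (∀ x ∈ Icc (0 : ℝ) 1, ∀ y ∈ Icc (0 : ℝ) 1, x < y →
        0 < directDefect (fun u => γ u t) c ε x y) ∧
      ∀ x ∈ Icc (0 : ℝ) 1, ∀ y ∈ Icc (0 : ℝ) 1, ∀ z ∈ frontier Ω, 0 < x + y → x + y < 2 →
        0 < reflectedDefect (fun u => γ u t) c ε x y z := by
    rcases htI.1.eq_or_lt with h0 | h0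
    · rw [← h0]; exact ⟨h0D, h0R⟩
    have hD : DirectBound X (curveLength fun u => γ u t) c ε :=
      h.directBound_iff.2 fun x hx y hy hxy => nonneg_of_left
        (f := fun s => directDefect (fun u => γ u s) c ε x y) h0
        (hγ.continuousOn_directDefect hT hΩ ht continuousOn_const continuousOn_const
          continuousOn_id (fun _ _ => hx) (fun _ _ => hy) fun _ hs => hs)
        fun s hs => (hpast s (Ioo_subset_Ico_self hs)).1 x hx y hy hxy
    have hR : ReflectedBound Ω X (curveLength fun u => γ u t) c ε :=
      h.reflectedBound_iff.2 fun x hx y hy z hz => nonneg_of_left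
        (f := fun s => reflectedDefect (fun u => γ u s) c ε x y z) h0
        (hγ.continuousOn_reflectedDefect hT hΩ ht continuousOn_const continuousOn_const
          continuousOn_id continuousOn_const (fun _ _ => hx) (fun _ _ => hy) fun _ hs => hs)
        fun s hs => (hpast s (Ioo_subset_Ico_self hs)).2 x hx y hy z hz
    exact ⟨fun x hx y hy hxy => hγ.directDefect_pos hT hΩ hε hc ht h0 h hD hR hx hy hxy
        fun s hs => (hpast s hs).1 x hx y hy hxy.le,
      fun x hx y hy z hz h1 h2 => hγ.reflectedDefect_pos hT hΩ hε hc ht h0 h (hG t ht X τ k h)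
        hD hR (fun s hs => (hpast s hs).1) hx hy hz h1 h2 fun s hs => (hpast s hs).2 x hx y hy z hz⟩
  rcases htB with ⟨⟨s, x, y⟩, ⟨⟨-, hx, hy⟩, hlen, hle⟩, rfl⟩ |
    ⟨⟨s, x, y, z⟩, ⟨⟨-, hx, hy, hz⟩, hlen, hlen', hle⟩, rfl⟩
  · simp only [mem_Ici, mem_Iic] at hlen hle hx hy
    refine absurd (hstrictD x hx y hy ?_) (not_lt.2 hle)
    by_contra hyx
    have := h.strictMonoOn.monotoneOn hy hx (not_lt.1 hyx)
    linarith
  · simp only [mem_Ici, mem_Iic] at hlen hlen' hle hx hy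
    refine absurd (hstrictR x hx y hy z hz.1 ?_ ?_) (not_lt.2 hle)
    · by_contra hcon
      have e1 : x = 0 := by linarith [hx.1, hy.1]
      have e2 : y = 0 := by linarith [hx.1, hy.1]
      rw [e1, e2, arclength_zero] at hlen
      linarith
    · by_contra hcon
      have e1 : x = 1 := by linarith [hx.2, hy.2]
      have e2 : y = 1 := by linarith [hx.2, hy.2]
      rw [e1, e2, arclength_one] at hlen'
      linarith

lemma model_lt_model {s a : ℝ} (hε : ε ∈ Ioo (0 : ℝ) (1 / 10)) (hac : a < c) (h0 : 0 < s)
    (h1 : s < 1) : model a ε s < model c ε s := by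
  have h2 := model_pos (c := c - a) hε (sub_pos.2 hac) h0 h1
  have h3 : model (c - a) ε s = model c ε s - model a ε s := by simp only [model]; ring
  linarith

end Continuity

theorem mainTheorem2
    (Ω : Set Plane) (hΩ : IsConvexC2Domain Ω)
    (T : EReal) (hT : 0 < T)
    (γ : ℝ → ℝ → Plane) (hγ : IsFreeBoundaryCSF Ω T γ)
    (K : Set Plane) (hK : IsCompact K)
    (hflowK : ∀ t ∈ timeInterval T, ∀ x ∈ Icc (0 : ℝ) 1, γ x t ∈ K)
    (hnearK : ∀ t ∈ timeInterval T, ∀ x ∈ ({0, 1} : Set ℝ),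
      frontier Ω ∩ Metric.ball (γ x t) (3 * curveLength (fun u => γ u t)) ⊆ K)
    (hgapK : ∀ p ∈ frontier Ω \ K,
      ¬ Bornology.IsBounded (connectedComponentIn (frontier Ω \ K) p))
    (C : ℝ) (hC : IsLUB (boundaryCurvature Ω '' (frontier Ω ∩ K)) C)
    (ε : ℝ) (hε : ε ∈ Ioo (0 : ℝ) (1 / 10))
    (hL : curveLength (fun u => γ u 0) * (1 + C) ≤ ε / 1000)
    (c : ℝ) (hc : c ∈ Ioo (0 : ℝ) (1 / 100))
    (h0 : ChordArcBound Ω (fun u => γ u 0) ε c) :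
    ∀ t ∈ timeInterval T, ChordArcBound Ω (fun u => γ u t) ε c := by
  intro t ht
  have hG : ∀ t ∈ timeInterval T, ∀ (X τ : ℝ → Plane) (k : ℝ → ℝ),
      IsArcOf Ω (fun u => γ u t) X τ k → SmallTurning Ω X τ (curveLength fun u => γ u t) ε :=
    fun t ht X τ k h => hγ.smallTurning hΩ hT hflowK hnearK hgapK hC hε hL ht h
  obtain ⟨X₀, τ₀, k₀, h₀⟩ := hγ.exists_arc hT hΩ (zero_mem_timeInterval hT)
  obtain ⟨X, τ, k, h⟩ := hγ.exists_arc hT hΩ ht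
  obtain ⟨hD₀, hR₀⟩ := h₀.chordArcBound_iff.1 h0
  rw [h₀.directBound_iff] at hD₀
  rw [h₀.reflectedBound_iff] at hR₀
  -- a smaller constant makes the initial inequalities strict
  have key : ∀ a ∈ Ioo 0 c, _ := fun a ha =>
    hγ.defects_nonneg (c := a) (ε := ε) hT hΩ hε ⟨ha.1, ha.2.trans hc.2⟩ hK hflowK hG
      (fun x hx y hy hxy => by
        have hlt := h₀.strictMonoOn hx hy hxy
        have hL := h₀.L_pos
        have := model_lt_model (ε := ε) hε ha.2 (s := (arclength (fun u => γ u 0) y -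
          arclength (fun u => γ u 0) x) / (2 * curveLength fun u => γ u 0))
          (div_pos (by linarith) (by linarith)) (by
            rw [div_lt_one (by linarith)]
            linarith [(h₀.arclength_mem hx).1, (h₀.arclength_mem hy).2])
        have h1 := mul_lt_mul_of_pos_left this
          (by linarith : 0 < 2 * curveLength fun u => γ u 0)
        have h2 := hD₀ x hx y hy hxy.le
        rw [directDefect] at h2 ⊢
        linarith)
      (fun x hx y hy z hz hpos hlt2 => by
        have hL := h₀.L_pos
        have hxm := h₀.arclength_mem hx
        have hym := h₀.arclength_mem hy
        have hs0 : 0 < arclength (fun u => γ u 0) x + arclength (fun u => γ u 0) y := by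
          rcases hx.1.eq_or_lt with e | e
          · have := h₀.strictMonoOn ⟨le_rfl, zero_le_one⟩ hy (by linarith)
            rw [arclength_zero] at this
            linarith [hxm.1]
          · have := h₀.strictMonoOn ⟨le_rfl, zero_le_one⟩ hx e
            rw [arclength_zero] at this
            linarith [hym.1]
        have hs1 : arclength (fun u => γ u 0) x + arclength (fun u => γ u 0) y <
            2 * curveLength fun u => γ u 0 := by
          rcases hx.2.eq_or_lt with e | e
          · have := h₀.strictMonoOn hy ⟨zero_le_one, le_rfl⟩ (by linarith)
            rw [arclength_one] at this
            linarith [hxm.2]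
          · have := h₀.strictMonoOn hx ⟨zero_le_one, le_rfl⟩ e
            rw [arclength_one] at this
            linarith [hym.2]
        have := model_lt_model (ε := ε) hε ha.2 (s := (arclength (fun u => γ u 0) x +
          arclength (fun u => γ u 0) y) / (2 * curveLength fun u => γ u 0))
          (div_pos hs0 (by linarith)) (by rwa [div_lt_one (by linarith)])
        have h1 := mul_lt_mul_of_pos_left this
          (by linarith : 0 < 2 * curveLength fun u => γ u 0)
        have h2 := hR₀ x hx y hy z hz
        rw [reflectedDefect] at h2 ⊢
        linarith) ht
  have hlim : ∀ s d : ℝ, (∀ a ∈ Ioo 0 c, 0 ≤ d - 2 * (curveLength fun u => γ u t) * model a ε s) →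
      0 ≤ d - 2 * (curveLength fun u => γ u t) * model c ε s := by
    intro s d hd
    refine nonneg_of_left (t := c)
      (f := fun a => d - 2 * (curveLength fun u => γ u t) * model a ε s) hc.1 ?_ hd
    simp only [model]; fun_prop
  refine h.chordArcBound_iff.2 ⟨h.directBound_iff.2 fun x hx y hy hxy => ?_,
    h.reflectedBound_iff.2 fun x hx y hy z hz => ?_⟩
  · exact hlim _ _ fun a ha => (key a ha).1 x hx y hy hxy
  · exact hlim _ _ fun a ha => (key a ha).2 x hx y hy z hz
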